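/- Let $X\subset\mathbb C^N$ be a closed algebraic subset of pure dimension $n<N$, with a (finite) algebraic Whitney stratification $\mathcal S$ with connected strata, and let $\hat{\mathcal S}$ be an algebraic Whitney stratification, with connected strata, of the projective closure $\bar X\subset\mathbb P^N$ such that $\bar X\cap H^\infty$ is a union of strata ($H^\infty$ the hyperplane at infinity) and which restricts to $\mathcal S$ on $X$. Let $X_{\rm reg}$ be the regular locus of $X$; let $T^*_XM$ be the closure in $\mathbb C^N\times\check{\mathbb C}^N$ of $T^*_{X_{\rm reg}}M=\{(x,\xi): x\in X_{\rm reg},\ \xi|_{T_xX}=0\}$, where $M=\mathbb C^N$, and define $T^*_{\bar S}M$ likewise as the closure of the conormal space of the stratum $S$. Let $p:\mathbb C^N\times\mathbb P(\check{\mathbb C}^N)\to\mathbb P(\check{\mathbb C}^N)$ be the projection. For a linear subspace $\check H\subset\check{\mathbb C}^N$ of dimension $m\ge1$ consider the following conditions. (P) (a) $\mathbb P(T^*_XM)\cap p^{-1}(\mathbb P(\check H))$ is of pure dimension $m-1$ or empty; (b) $p^{-1}(\mathbb P(\check H))$ is transversal to $\mathbb P(T^*_{X_{\rm reg}}M)$;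 (c) $\mathbb P(T^*_{X_{\rm reg}}M)\cap p^{-1}(\mathbb P(\check H))$ is dense in $\mathbb P(T^*_XM)\cap p^{-1}(\mathbb P(\check H))$; (d) for each stratum $S\in\mathcal S$ with $\dim S<n$, $\dim\bigl(\mathbb P(T^*_XM)\cap\mathbb P(T^*_{\bar S}M)\cap p^{-1}(\mathbb P(\check H))\bigr)<m-1$, the empty set having dimension $-\infty$. (T) If $K\subset\mathbb C^N$ is the common kernel of the forms in $\check H$, then $\mathbb P(K)\subset H^\infty$ is transversal inside $H^\infty$ to all strata of $\hat{\mathcal S}$ contained in $H^\infty$. Let $0\le k\le n$. Then the subspaces satisfying (P), and likewise those satisfying (T), contain a Zariski-open dense subset of the Grassmannian of $(k+1)$-dimensional subspaces of $\check{\mathbb C}^N$. Moreover, let $\omega=(\omega_1,\dots,\omega_{k+1})$ be linearly independent linear forms whose span satisfies (P) and (T) and, if $k>0$, such that the span of $\omega'=(\omega_1,\dots,\omega_k)$ also satisfies (P) and (T). Let $$P_k(X,\omega)=\overline{\{x\in X_{\rm reg}:\ \omega_1|_{T_xX},\dots,\omega_{k+1}|_{T_xX}\text{ are linearly dependent}\}}$$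 be the polar locus. Then the projection $(\omega_1,\dots,\omega_k):P_k(X,\omega)\to\mathbb C^k$ has a well-defined finite number $\gamma_k(X)$ of points in its general fibre, the degree of the polar cycle (for $k=0$, $\gamma_0(X)=\#P_0(X,\omega)$). Furthermore, for all $t=(t_1,\dots,t_k)$ in some nonempty Zariski-open subset of $\mathbb C^k$: (i) the plane $L_t=\{\omega_1=t_1,\dots,\omega_k=t_k\}$ is transversal to all strata of $\mathcal S$, and $\gamma_k(X)$ is the number of critical points of the restriction of $\omega_{k+1}$ to $X_{\rm reg}\cap L_t$; (ii) all these critical points are complex stratified Morse points of $\omega_{k+1}$ on $X\cap L_t$ with the induced stratification $\{S\cap L_t\}_{S\in\mathcal S}$: such a point $x$ is a nondegenerate critical point of the restriction of $\omega_{k+1}$ to the stratum $S\cap L_t$ containing it, and $d\omega_{k+1}$ does not vanish on any limit of tangent spaces of another stratum $S'\cap L_t$ at points converging to $x$. -/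

import Mathlib

open Filter Topology

namespace AffinePolar

noncomputable section

/-! ### Algebraic subsets of complex affine space -/

section Algebraic

variable {σ : Type} [Fintype σ]

/-- The Zariski closure of a subset of complex affine space. -/
def zariskiClosure (A : Set (σ → ℂ)) : Set (σ → ℂ) :=
  MvPolynomial.zeroLocus ℂ (MvPolynomial.vanishingIdeal ℂ A)

/-- Algebraic subsets of affine space. -/
def IsZariskiClosed (A : Set (σ → ℂ)) : Prop :=
  ∃ I : Ideal (MvPolynomial σ ℂ), A = MvPolynomial.zeroLocus ℂ I

/-- Nonempty Zariski-open subsets of affine space, given as open and Zariski dense. -/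
def IsZariskiOpenDense (A : Set (σ → ℂ)) : Prop :=
  IsZariskiClosed Aᶜ ∧ zariskiClosure A = Set.univ

/-- Intersections of a Zariski-closed and a Zariski-open set. -/
def IsZariskiLocallyClosed (A : Set (σ → ℂ)) : Prop :=
  ∃ B C : Set (σ → ℂ), IsZariskiClosed B ∧ IsZariskiClosed C ∧ A = B \ C

/-- The dimension of (the Zariski closure of) `A`; it is `⊥` for the empty set. -/
def algDim (A : Set (σ → ℂ)) : WithBot ℕ∞ :=
  ringKrullDim (MvPolynomial σ ℂ ⧸ MvPolynomial.vanishingIdeal ℂ A)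

/-- `A` is of pure dimension `d`: all irreducible components of (the Zariski closure of) `A` have
dimension `d`. The empty set is of pure dimension `d` for all `d`. -/
def IsPureDim (A : Set (σ → ℂ)) (d : ℕ) : Prop :=
  ∀ P ∈ (MvPolynomial.vanishingIdeal ℂ A).minimalPrimes,
    ringKrullDim (MvPolynomial σ ℂ ⧸ P) = (d : WithBot ℕ∞)

/-- The Zariski tangent space at `x` of (the Zariski closure of) `A`. -/
def tangentSpace (A : Set (σ → ℂ)) (x : σ → ℂ) : Submodule ℂ (σ → ℂ) where
  carrier := {v | ∀ p ∈ MvPolynomial.vanishingIdeal ℂ A,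
    ∑ i, MvPolynomial.eval x (MvPolynomial.pderiv i p) * v i = 0}
  zero_mem' := by intro p _; simp
  add_mem' := by
    intro v w hv hw p hp
    simp only [Pi.add_apply, mul_add, Finset.sum_add_distrib, hv p hp, hw p hp, add_zero]
  smul_mem' := by
    intro c v hv p hp
    have h : ∀ i, MvPolynomial.eval x (MvPolynomial.pderiv i p) * (c • v) i
        = c * (MvPolynomial.eval x (MvPolynomial.pderiv i p) * v i) := by
      intro i; simp only [Pi.smul_apply, smul_eq_mul]; ring
    simp only [h, ← Finset.mul_sum, hv p hp, mul_zero]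

/-- `S` is a nonsingular locally closed algebraic subset of pure dimension `d`. -/
def IsSmoothOfDim (S : Set (σ → ℂ)) (d : ℕ) : Prop :=
  IsZariskiLocallyClosed S ∧ IsPureDim S d ∧
    ∀ x ∈ S, Module.finrank ℂ (tangentSpace S x) = d

/-- The regular locus of an algebraic set `X` of pure dimension `n`. -/
def regularLocus (X : Set (σ → ℂ)) (n : ℕ) : Set (σ → ℂ) :=
  {x | x ∈ X ∧ Module.finrank ℂ (tangentSpace X x) = n}

/-! ### Whitney stratifications -/

/-- Convergence in the Grassmannian: all `T i` have the dimension of `τ`, and each vector of `τ`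
is a limit of vectors of the `T i`. -/
def GrassmannTendsto (T : ℕ → Submodule ℂ (σ → ℂ)) (τ : Submodule ℂ (σ → ℂ)) : Prop :=
  (∀ i, Module.finrank ℂ (T i) = Module.finrank ℂ τ) ∧
    ∀ v ∈ τ, ∃ w : ℕ → σ → ℂ, (∀ i, w i ∈ T i) ∧ Tendsto w atTop (𝓝 v)

/-- Condition (a) of Whitney for the pair `(S, R)`: limits of tangent spaces of `S` at a point of
`R` contain the tangent space of `R`. -/
def WhitneyA (S R : Set (σ → ℂ)) : Prop :=
  ∀ (x : ℕ → σ → ℂ) (y : σ → ℂ) (τ : Submodule ℂ (σ → ℂ)), (∀ i, x i ∈ S) → y ∈ R →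
    Tendsto x atTop (𝓝 y) → GrassmannTendsto (fun i => tangentSpace S (x i)) τ →
    tangentSpace R y ≤ τ

/-- Condition (b) of Whitney for the pair `(S, R)`: limits of secant lines between points of `S`
and points of `R` are contained in the limits of the tangent spaces of `S`. -/
def WhitneyB (S R : Set (σ → ℂ)) : Prop :=
  ∀ (x y : ℕ → σ → ℂ) (z : σ → ℂ) (τ ℓ : Submodule ℂ (σ → ℂ)),
    (∀ i, x i ∈ S) → (∀ i, y i ∈ R) → (∀ i, x i ≠ y i) → z ∈ R →
    Tendsto x atTop (𝓝 z) → Tendsto y atTop (𝓝 z) →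
    GrassmannTendsto (fun i => tangentSpace S (x i)) τ →
    GrassmannTendsto (fun i => Submodule.span ℂ {x i - y i}) ℓ → ℓ ≤ τ

/-- A (finite) algebraic Whitney stratification of `A` with connected strata. -/
structure IsWhitneyStratification (A : Set (σ → ℂ)) (strata : Set (Set (σ → ℂ))) : Prop where
  finite : strata.Finite
  sUnion_eq : ⋃₀ strata = A
  disjoint : strata.PairwiseDisjoint id
  connected : ∀ S ∈ strata, IsConnected S
  smooth : ∀ S ∈ strata, ∃ d, IsSmoothOfDim S d
  frontier : ∀ R ∈ strata, ∀ S ∈ strata, (R ∩ closure S).Nonempty → R ⊆ closure S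
  whitneyA : ∀ R ∈ strata, ∀ S ∈ strata, S ≠ R → WhitneyA S R
  whitneyB : ∀ R ∈ strata, ∀ S ∈ strata, S ≠ R → WhitneyB S R

/-! ### Stratified Morse points -/

/-- `x` is a nondegenerate (Morse) critical point of the restriction of `f` to `Y`, where `Y` is a
complex submanifold near `x`: in a local holomorphic parametrization `φ` of `Y` at `x`,
the first derivative of `f ∘ φ` vanishes and the second one is a nondegenerate bilinear form. -/
def IsMorsePoint (Y : Set (σ → ℂ)) (f : (σ → ℂ) → ℂ) (x : σ → ℂ) : Prop :=
  ∃ (d : ℕ) (φ : (Fin d → ℂ) → (σ → ℂ)),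
    AnalyticAt ℂ φ 0 ∧ φ 0 = x ∧ Function.Injective (fderiv ℂ φ 0) ∧
    Filter.map φ (𝓝 0) = 𝓝[Y] x ∧
    fderiv ℂ (f ∘ φ) 0 = 0 ∧
    ∀ v, (∀ w, fderiv ℂ (fderiv ℂ (f ∘ φ)) 0 v w = 0) → v = 0

/-- `x` is a complex stratified Morse point of `f` with respect to a family of strata:
it is a nondegenerate critical point of the restriction of `f` to the stratum `S` of `x`, and
the differential of `f` at `x` does not vanish on any generalized tangent space, that is, on any
limit of tangent spaces of another stratum at points converging to `x`. -/
def IsStratifiedMorsePoint (strata : Set (Set (σ → ℂ))) (f : (σ → ℂ) → ℂ) (x : σ → ℂ) : Prop :=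
  ∃ S ∈ strata, x ∈ S ∧ IsMorsePoint S f x ∧
    ∀ S' ∈ strata, S' ≠ S → ∀ (y : ℕ → σ → ℂ) (τ : Submodule ℂ (σ → ℂ)),
      (∀ i, y i ∈ S') → Tendsto y atTop (𝓝 x) →
      GrassmannTendsto (fun i => tangentSpace S' (y i)) τ →
      ∃ v ∈ τ, fderiv ℂ f x v ≠ 0

end Algebraic

/-! ### Stratifications of the projective closure

Subsets of projective space `ℙ^N` are described by their cones in `ℂ^(N+1) ∖ {0}`; the hyperplane
at infinity is `z 0 = 0` and `x ∈ ℂ^N` corresponds to the line through `(1, x)`. As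
`ℂ^(N+1) ∖ {0} → ℙ^N` is a submersion with connected fibres, the Whitney stratifications of a
projective set correspond to the conic Whitney stratifications of its cone without the vertex. -/

section Projective

variable {N : ℕ}

/-- The cone, without its vertex, over the projective closure of `X`. -/
def projCone (X : Set (Fin N → ℂ)) : Set (Fin (N + 1) → ℂ) :=
  zariskiClosure {z | z 0 ≠ 0 ∧ (fun i : Fin N => z i.succ / z 0) ∈ X} \ {0}

/-- The part in `ℂ^N` of a subset of `ℙ^N` with cone `T`. -/
def affinePart (T : Set (Fin (N + 1) → ℂ)) : Set (Fin N → ℂ) :=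
  {x | (Fin.cons 1 x : Fin (N + 1) → ℂ) ∈ T}

/-- `hatStrata` is the family of cones over the strata of a Whitney stratification of the
projective closure of `X`, such that the part at infinity is a union of strata and such that the
restriction to `X` is the stratification `strata`. -/
structure IsProjectiveExtension (X : Set (Fin N → ℂ)) (strata : Set (Set (Fin N → ℂ)))
    (hatStrata : Set (Set (Fin (N + 1) → ℂ))) : Prop where
  whitney : IsWhitneyStratification (projCone X) hatStrata
  conic : ∀ T ∈ hatStrata, ∀ z ∈ T, ∀ c : ℂ, c ≠ 0 → c • z ∈ T
  infinity : ∀ T ∈ hatStrata, (∀ z ∈ T, z 0 = 0) ∨ (∀ z ∈ T, z 0 ≠ 0)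
  restrict : ∀ S, S ∈ strata ↔ S.Nonempty ∧ ∃ T ∈ hatStrata, affinePart T = S

end Projective

/-! ### Covectors, conormal spaces and genericity -/

section Polar

variable {N : ℕ}

/-- The linear form on `ℂ^N` with coefficient vector `ξ`. Linear forms are identified with their
coefficient vectors throughout. -/
def form (ξ : Fin N → ℂ) : (Fin N → ℂ) →ₗ[ℂ] ℂ := dotProductBilin ℂ ℂ ξ

/-- The common kernel of the linear forms in `H`. -/
def commonKer (H : Submodule ℂ (Fin N → ℂ)) : Submodule ℂ (Fin N → ℂ) :=
  ⨅ ξ ∈ H, LinearMap.ker (form ξ)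

/-- The conormal space over `U ⊆ X`: pairs (point `x` of `U`, linear form vanishing on the tangent
space of `X` at `x`), as a subset of `ℂ^N × ℂ^N = ℂ^(N+N)`. -/
def conormal (X U : Set (Fin N → ℂ)) : Set (Fin N ⊕ Fin N → ℂ) :=
  {q | q ∘ Sum.inl ∈ U ∧ ∀ v ∈ tangentSpace X (q ∘ Sum.inl), form (q ∘ Sum.inr) v = 0}

/-- The pairs `(x, ξ)` with `ξ ∈ H`, `ξ ≠ 0`: the cone over `ℂ^N × ℙ(H)`. -/
def overH (H : Submodule ℂ (Fin N → ℂ)) : Set (Fin N ⊕ Fin N → ℂ) :=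
  {q | q ∘ Sum.inr ∈ H ∧ q ∘ Sum.inr ≠ 0}

/-- The linear subspace `ℂ^N × H` of `ℂ^N × ℂ^N`. -/
def prodH (H : Submodule ℂ (Fin N → ℂ)) : Submodule ℂ (Fin N ⊕ Fin N → ℂ) :=
  H.comap (LinearMap.funLeft ℂ ℂ (Sum.inr : Fin N → Fin N ⊕ Fin N))

/-- Genericity of a subspace `H` of linear forms with respect to the (projectivized) conormal
space of `X`. All sets are replaced by the cones over them, so that dimensions go up by one. Here
`U` is the regular locus of `X`, and the additional subsets of smaller dimension are the
intersections with the conormal spaces of the strata of dimension less than `n = dim X`. -/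
structure PolarGeneric (X : Set (Fin N → ℂ)) (n : ℕ) (strata : Set (Set (Fin N → ℂ)))
    (H : Submodule ℂ (Fin N → ℂ)) : Prop where
  /-- The intersection of the conormal space with `ℙ(H)` has pure dimension `dim ℙ(H)`. -/
  pureDim : IsPureDim (zariskiClosure (conormal X (regularLocus X n)) ∩ overH H)
    (Module.finrank ℂ H)
  /-- The intersection over the regular locus is transverse. -/
  transverse : ∀ q ∈ conormal X (regularLocus X n) ∩ overH H,
    tangentSpace (conormal X (regularLocus X n)) q ⊔ prodH H = ⊤
  /-- The intersection over the regular locus is dense in the whole intersection. -/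
  dense : zariskiClosure (conormal X (regularLocus X n)) ∩ overH H ⊆
    zariskiClosure (conormal X (regularLocus X n) ∩ overH H)
  /-- The intersection meets the conormal spaces of small strata in a smaller dimension. -/
  small : ∀ S ∈ strata, algDim S < n →
    algDim (zariskiClosure (conormal X (regularLocus X n)) ∩ zariskiClosure (conormal S S) ∩
      overH H) < Module.finrank ℂ H

/-- Genericity of a subspace `H` of linear forms at infinity: the projectivization of the common
kernel of `H` is transversal, inside the hyperplane at infinity, to all strata at infinity. -/
def TransGeneric (hatStrata : Set (Set (Fin (N + 1) → ℂ))) (H : Submodule ℂ (Fin N → ℂ)) : Prop :=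
  ∀ T ∈ hatStrata, (∀ z ∈ T, z 0 = 0) → ∀ z ∈ T, (fun i : Fin N => z i.succ) ∈ commonKer H →
    (tangentSpace T z).map (LinearMap.funLeft ℂ ℂ (Fin.succ : Fin N → Fin (N + 1))) ⊔
      commonKer H = ⊤

/-- `Ω` is a Zariski-open dense subset of the Grassmannian of `m`-dimensional subspaces of `ℂ^N`.
The Grassmannian carries the quotient topology of the set of bases. -/
def IsZariskiOpenDenseGr (m : ℕ) (Ω : Set (Submodule ℂ (Fin N → ℂ))) : Prop :=
  (∀ H ∈ Ω, Module.finrank ℂ H = m) ∧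
    IsZariskiOpenDense {b : Fin m × Fin N → ℂ |
      LinearIndependent ℂ (fun j i => b (j, i)) ∧
        Submodule.span ℂ (Set.range fun j i => b (j, i)) ∈ Ω}

/-! ### Polar loci, slices and degrees -/

/-- The points of the regular locus of `X` at which the restrictions of the forms `ω` to the
tangent space are linearly dependent. -/
def crit {m : ℕ} (X : Set (Fin N → ℂ)) (n : ℕ) (ω : Fin m → Fin N → ℂ) : Set (Fin N → ℂ) :=
  {x | x ∈ regularLocus X n ∧
    ¬ LinearIndependent ℂ (fun j => (form (ω j)).domRestrict (tangentSpace X x))}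

/-- The polar locus `P_k(X, ω)`, for `ω = (ω_1, …, ω_{k+1})`. -/
def polarLocus {k : ℕ} (X : Set (Fin N → ℂ)) (n : ℕ) (ω : Fin (k + 1) → Fin N → ℂ) :
    Set (Fin N → ℂ) :=
  zariskiClosure (crit X n ω)

/-- The forms `ω' = (ω_1, …, ω_k)`. -/
def initForms {k : ℕ} (ω : Fin (k + 1) → Fin N → ℂ) : Fin k → Fin N → ℂ :=
  fun j => ω j.castSucc

/-- The affine subspace `ω_1 = t_1, …, ω_k = t_k`, which is the whole space for `k = 0`. -/
def slicePlane {k : ℕ} (ω : Fin (k + 1) → Fin N → ℂ) (t : Fin k → ℂ) : Set (Fin N → ℂ) :=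
  {x | ∀ j, form (initForms ω j) x = t j}

/-- The projection `(ω_1, …, ω_k)` restricted to `P` has `d` points in the general fibre. -/
def HasDegree {k : ℕ} (P : Set (Fin N → ℂ)) (ω : Fin (k + 1) → Fin N → ℂ) (d : ℕ) : Prop :=
  ∃ V : Set (Fin k → ℂ), IsZariskiOpenDense V ∧ ∀ t ∈ V, (P ∩ slicePlane ω t).encard = d

/-- The degree `γ_k(X)`: the number of points in the general fibre of the projection
`(ω_1, …, ω_k) : P_k(X, ω) → ℂ^k` (junk value `0` if this number does not exist). For `k = 0` it
is the number of points of `P_0(X, ω)`. -/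
def polarDegree {k : ℕ} (X : Set (Fin N → ℂ)) (n : ℕ) (ω : Fin (k + 1) → Fin N → ℂ) : ℕ :=
  sInf {d | HasDegree (polarLocus X n ω) ω d}

/-- The critical points of the restriction of a linear form `ξ` to a smooth algebraic set `Y`. -/
def critPoints (Y : Set (Fin N → ℂ)) (ξ : Fin N → ℂ) : Set (Fin N → ℂ) :=
  {x | x ∈ Y ∧ ∀ v ∈ tangentSpace Y x, form ξ v = 0}

/-- The strata of `X` intersected with a plane `L`. -/
def sliceStrata (strata : Set (Set (Fin N → ℂ))) (L : Set (Fin N → ℂ)) :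
    Set (Set (Fin N → ℂ)) :=
  (fun S => S ∩ L) '' strata

end Polar

end

end AffinePolar

namespace AffinePolar

/-! ### Dimension theory of affine domains over ℂ. -/

section Dimension

/-! All genericity statements rest on an algebraic Sard theorem, `thin_image_of_critical`: in
characteristic zero a dominant polynomial map is submersive at a generic point of some component, so
a set on which it is nowhere submersive has a non-dense ("thin") image. Applied to incidence sets
over the space of bases of a subspace H, it gives transversality in the style of Kleiman
(`thin_not_transverse`, `thin_not_transverse_at_infinity`), the latter being condition (T).

The conormal space of X has pure dimension N (`isPureDim_conormal`). Near a regular point it is cut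
out of ℂ^(2N) by N equations, and its tangent spaces lie in graphs of Hessians over the tangent
spaces of X. For generic H the cone W of conormal vectors with nonzero covector in H therefore has
pure dimension dim H. The part over the singular locus, and the intersections with conormal spaces
of small strata, have dimension less than N, so they meet ℂ^N × H in dimension less than dim H. This
is condition (P).

Now let H be the span of ω. The critical set is the projection of the regular part of W. Since W is
a cone in the covector, one dimension is lost and the polar locus has dimension at most k. Its
projection to ℂ^k is thus generically finite, and Chevalley's theorem makes the number of points
generically constant (`exists_generic_fibre_card`).

For t outside a thin set, L_t is transversal to X and to the strata, and the polar locus meets L_t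
only in points of the critical set. By Lagrange multipliers these are the critical points of the
last form on the slice (`critPoints_slice_eq`). By (P)(d) none of them lies in a stratum of
dimension less than n: a cone dominating ℂ^k through its base has dimension at least k + 1. The
stratum of a critical point is therefore all of X nearby, and no other stratum comes close, which
settles the condition on limits of tangent spaces.

Nondegeneracy is `eq_zero_of_hess_eq_zero`. A null vector u of the Hessian on the slice extends to a
vector (u, η) tangent to the conormal space, with η in H, which the first k forms kill. Inside a
space of dimension at most k + 1 that maps onto ℂ^k, the vectors so killed form the line of the
Euler vector. That vector has base component 0, so u = 0. -/

theorem ringKrullDim_eq_of_integral {B R : Type*} [CommRing B] [CommRing R] [IsDomain B]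
    [IsDomain R] [Algebra B R] [FaithfulSMul B R] [Algebra.IsIntegral B R] [IsIntegrallyClosed B] :
    ringKrullDim R = ringKrullDim B := by
  apply le_antisymm
  -- Incomparability: strict inclusions of primes of `R` stay strict in `B`.
  · refine Order.krullDim_le_of_strictMono (PrimeSpectrum.comap (algebraMap B R)) ?_
    intro p q hpq
    exact Ideal.IsIntegral.comap_lt_comap (A := R) (I := p.asIdeal) (J := q.asIdeal) hpq
  -- Lying over lifts the top of a chain, and going down, available because `B` is integrally
  -- closed, lifts the rest.
  · refine iSup_le fun l => ?_
    obtain ⟨Q, hQp, hQ, hQl⟩ := Ideal.exists_ideal_over_prime_of_isIntegral (S := R)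
      l.last.asIdeal (⊥ : Ideal R) (by
        rw [show Ideal.comap (algebraMap B R) ⊥ = ⊥ from
          (RingHom.injective_iff_ker_eq_bot _).1 (FaithfulSMul.algebraMap_injective B R)]
        exact bot_le)
    have : Q.LiesOver l.last.asIdeal := ⟨hQl.symm⟩
    obtain ⟨L, hL, -⟩ := Ideal.exists_ltSeries_of_hasGoingDown (S := R) l Q
    rw [← hL]
    exact Order.LTSeries.length_le_krullDim L

/-- Noether normalization: the extension is integral over a polynomial ring in `s` variables, which
has dimension `s`, and the variables become a transcendence basis. -/
theorem exists_ringKrullDim_eq_trdeg (k : Type) (R : Type) [Field k] [CommRing R] [IsDomain R]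
    [Algebra k R] [Algebra.FiniteType k R] :
    ∃ s : ℕ, ringKrullDim R = s ∧ Algebra.trdeg k R = s := by
  obtain ⟨s, g, hg, hfin⟩ := exists_finite_inj_algHom_of_fg k R
  refine ⟨s, ?_, ?_⟩
  · let := g.toRingHom.toAlgebra
    have : FaithfulSMul (MvPolynomial (Fin s) k) R :=
      (faithfulSMul_iff_algebraMap_injective _ _).2 hg
    have : Module.Finite (MvPolynomial (Fin s) k) R := hfin
    rw [ringKrullDim_eq_of_integral (B := MvPolynomial (Fin s) k),
      MvPolynomial.ringKrullDim_of_isNoetherianRing]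
    simp
  · have hx : AlgebraicIndependent k (fun i => g (MvPolynomial.X i)) :=
      (MvPolynomial.algebraicIndependent_X (Fin s) k).map' hg
    have htb : IsTranscendenceBasis k (fun i => g (MvPolynomial.X i)) := by
      rw [hx.isTranscendenceBasis_iff_isAlgebraic]
      constructor
      intro r
      have h1 : g.toRingHom.IsIntegralElem r := hfin.to_isIntegral r
      have h2 : IsIntegral (Algebra.adjoin k (Set.range fun i => g (MvPolynomial.X i))) r := by
        obtain ⟨p, hp, hp0⟩ := h1
        have hmem : ∀ c, g c ∈ Algebra.adjoin k (Set.range fun i => g (MvPolynomial.X i)) := by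
          intro c
          rw [Algebra.adjoin_range_eq_range_aeval]
          refine ⟨c, ?_⟩
          rw [AlgHom.toRingHom_eq_coe, RingHom.coe_coe]
          congr 1
          ext i
          simp
        refine ⟨p.map (g.toRingHom.codRestrict _ hmem), hp.map _, ?_⟩
        rw [Polynomial.eval₂_map]
        exact hp0
      exact h2.isAlgebraic
    have := htb.lift_cardinalMk_eq_trdeg
    simpa using this.symm

theorem card_le_ringKrullDim {R : Type} [CommRing R] [IsDomain R] [Algebra ℂ R]
    [Algebra.FiniteType ℂ R] {ι : Type} [Fintype ι] {y : ι → R} (h : AlgebraicIndependent ℂ y) :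
    (Fintype.card ι : WithBot ℕ∞) ≤ ringKrullDim R := by
  obtain ⟨t, ht, ht'⟩ := exists_ringKrullDim_eq_trdeg ℂ R
  have := h.cardinalMk_le_trdeg
  rw [ht', Cardinal.mk_fintype, Nat.cast_le] at this
  rw [ht]
  exact_mod_cast this

-- A relation among the other variables would be a multiple of `π` of degree 0 in `X i`, whereas `π`
-- has positive degree in it. Hence a hypersurface in `s`-space has dimension at least `s - 1`.
open MvPolynomial in
theorem algebraicIndependent_mk_span_singleton {s : ℕ} {π : MvPolynomial (Fin s) ℂ} {i : Fin s}
    (hi : i ∈ π.vars) :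
    AlgebraicIndependent ℂ
      (fun j : {j : Fin s // j ≠ i} => Ideal.Quotient.mk (Ideal.span {π}) (X j.1)) := by
  rw [algebraicIndependent_iff]
  intro F hF
  have h1 : aeval (fun j : {j : Fin s // j ≠ i} => Ideal.Quotient.mk (Ideal.span {π}) (X j.1)) F
      = Ideal.Quotient.mk (Ideal.span {π}) (rename (fun j : {j : Fin s // j ≠ i} => j.1) F) := by
    rw [← Ideal.Quotient.mkₐ_eq_mk ℂ, ← AlgHom.comp_apply]
    congr 1
    ext j
    simp
  rw [h1, Ideal.Quotient.eq_zero_iff_mem, Ideal.mem_span_singleton] at hF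
  obtain ⟨c, hc⟩ := hF
  have hnot : i ∉ (rename (fun j : {j : Fin s // j ≠ i} => j.1) F).vars := by
    classical
    intro h
    obtain ⟨j, -, hj⟩ := Finset.mem_image.1 (vars_rename _ _ h)
    exact j.2 hj
  by_contra hne
  have hne' : rename (fun j : {j : Fin s // j ≠ i} => j.1) F ≠ 0 := fun h0 =>
    hne (rename_injective _ Subtype.val_injective (by rw [h0, map_zero]))
  have hπ0 : π ≠ 0 := by rintro rfl; exact hne' (by rw [hc, zero_mul])
  have hc0 : c ≠ 0 := by rintro rfl; exact hne' (by rw [hc, mul_zero])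
  have hdeg := degreeOf_mul_eq (n := i) hπ0 hc0
  rw [← hc] at hdeg
  have h2 : degreeOf i (rename (fun j : {j : Fin s // j ≠ i} => j.1) F) = 0 := by
    rw [← Nat.le_zero, degreeOf_le_iff]
    intro m hm
    by_contra h0
    exact hnot ((mem_vars_iff_mem_support i).2 ⟨m, hm, Finsupp.mem_support_iff.2 (by omega)⟩)
  have h3 : degreeOf i π ≠ 0 := by
    intro h0
    rw [← Nat.le_zero, degreeOf_le_iff] at h0
    obtain ⟨m, hm, hmi⟩ := (mem_vars_iff_mem_support i).1 hi
    exact (Finsupp.mem_support_iff.1 hmi) (Nat.le_zero.1 (h0 m hm))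
  omega

/-- Krull's principal ideal theorem in terms of dimensions, for affine domains. -/
theorem ringKrullDim_le_of_mem_minimalPrimes_span_singleton {R : Type} [CommRing R] [IsDomain R]
    [Algebra ℂ R] [Algebra.FiniteType ℂ R] (f : R) (q : Ideal R)
    (hq : q ∈ (Ideal.span {f}).minimalPrimes) : ringKrullDim R ≤ ringKrullDim (R ⧸ q) + 1 := by
  have : IsNoetherianRing R := Algebra.FiniteType.isNoetherianRing ℂ R
  have hqp : q.IsPrime := hq.1.1
  have hht := Ideal.height_le_one_of_isPrincipal_of_mem_minimalPrimes _ q hq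
  obtain ⟨s, g, hg, hfin⟩ := exists_finite_inj_algHom_of_fg ℂ R
  let : Algebra (MvPolynomial (Fin s) ℂ) R := g.toRingHom.toAlgebra
  have : FaithfulSMul (MvPolynomial (Fin s) ℂ) R :=
    (faithfulSMul_iff_algebraMap_injective _ _).2 hg
  have : Module.Finite (MvPolynomial (Fin s) ℂ) R := hfin
  have hdim : ringKrullDim R = s := by
    rw [ringKrullDim_eq_of_integral (B := MvPolynomial (Fin s) ℂ),
      MvPolynomial.ringKrullDim_of_isNoetherianRing]
    simp
  -- By going down the contraction has height at most 1. It is thus zero or generated by one prime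
  -- polynomial, and in both cases the subring of `R ⧸ q` coming from the polynomial ring contains
  -- enough independent elements.
  set p := q.under (MvPolynomial (Fin s) ℂ) with hp
  have hover : q.LiesOver p := ⟨hp⟩
  have hpht : p.height ≤ 1 := by
    refine le_trans ?_ hht
    rw [Ideal.height_eq_height_add_of_liesOver_of_hasGoingDown p q]
    exact le_self_add
  have hinj : ∀ F : MvPolynomial (Fin s) ℂ, Ideal.Quotient.mk q (g F) = 0 → F ∈ p := by
    intro F hF
    have h0 : g F ∈ q := Ideal.Quotient.eq_zero_iff_mem.1 hF
    exact h0
  let gq : MvPolynomial (Fin s) ℂ →ₐ[ℂ] R ⧸ q := (Ideal.Quotient.mkₐ ℂ q).comp g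
  by_cases hbot : p = ⊥
  · have hgq : Function.Injective gq := by
      rw [injective_iff_map_eq_zero]
      intro F hF
      simpa [hbot] using hinj F hF
    have := card_le_ringKrullDim
      ((MvPolynomial.algebraicIndependent_X (Fin s) ℂ).map' hgq)
    rw [hdim]
    refine le_trans ?_ (le_trans this ?_)
    · simp
    · exact le_add_of_nonneg_right zero_le_one
  · obtain ⟨π, hπ, hπp⟩ := Ideal.IsPrime.exists_mem_prime_of_ne_bot (I := p) inferInstance hbot
    have hp1 : p.height = 1 := by
      refine le_antisymm hpht ?_
      rw [Order.one_le_iff_pos, pos_iff_ne_zero]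
      exact fun h => hbot (Ideal.height_eq_zero_iff_eq_bot.1 h)
    have hpspan := Ideal.eq_span_singleton_of_height_eq_one hp1 hπ hπp
    obtain ⟨i, hi⟩ : ∃ i, i ∈ π.vars := by
      by_contra hno
      push Not at hno
      have hempty : π.vars = ∅ := Finset.eq_empty_of_forall_notMem hno
      obtain ⟨c, hc⟩ : ∃ c, π = MvPolynomial.C c :=
        ⟨_, ((MvPolynomial.vars_eq_empty_iff_eq_C).1 hempty)⟩
      have hc0 : c ≠ 0 := by
        rintro rfl
        exact hπp.ne_zero (by rw [hc, map_zero])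
      exact hπp.not_isUnit (hc ▸ (IsUnit.mk0 c hc0).map MvPolynomial.C)
    let e : (MvPolynomial (Fin s) ℂ ⧸ Ideal.span {π}) →ₐ[ℂ] R ⧸ q :=
      Ideal.Quotient.liftₐ _ gq (by
        intro a ha
        have : a ∈ p := hpspan ▸ ha
        exact Ideal.Quotient.eq_zero_iff_mem.2 this)
    have he : Function.Injective e := by
      rw [injective_iff_map_eq_zero]
      intro a ha
      obtain ⟨F, rfl⟩ := Ideal.Quotient.mk_surjective a
      rw [Ideal.Quotient.eq_zero_iff_mem, ← hpspan]
      exact hinj F ha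
    have := card_le_ringKrullDim ((algebraicIndependent_mk_span_singleton hi).map' he)
    rw [hdim]
    have hcard : Fintype.card {j : Fin s // j ≠ i} + 1 = s := by
      have : 0 < s := i.pos
      simp [Fintype.card_subtype_compl]
      omega
    calc (s : WithBot ℕ∞) = (Fintype.card {j : Fin s // j ≠ i} : WithBot ℕ∞) + 1 := by
          exact_mod_cast hcard.symm
      _ ≤ _ := by gcongr

/-- Krull's height theorem in terms of dimensions, for affine varieties. -/
theorem ringKrullDim_le_of_mem_minimalPrimes_sup_span {σ : Type} [Finite σ]
    (P : Ideal (MvPolynomial σ ℂ)) [P.IsPrime] (S : Finset (MvPolynomial σ ℂ))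
    (Q : Ideal (MvPolynomial σ ℂ)) (hQ : Q ∈ (P ⊔ Ideal.span (S : Set _)).minimalPrimes) :
    ringKrullDim (MvPolynomial σ ℂ ⧸ P) ≤ ringKrullDim (MvPolynomial σ ℂ ⧸ Q) + S.card := by
  classical
  induction S using Finset.induction_on generalizing Q with
  | empty =>
    have hQP : Q = P := by
      simp only [Finset.coe_empty, Ideal.span_empty, bot_le, sup_of_le_left] at hQ
      rwa [Ideal.minimalPrimes_eq_subsingleton_self, Set.mem_singleton_iff] at hQ
    rw [hQP]
    simp
  | insert a S ha ih =>
    have hQp : Q.IsPrime := hQ.1.1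
    have hle : P ⊔ Ideal.span (S : Set _) ≤ Q :=
      le_trans (sup_le_sup_left (Ideal.span_mono (by simp)) _) hQ.1.2
    -- `Q'` is a component for the smaller family inside `Q`. In the domain modulo `Q'` the prime
    -- `Q` is minimal over the single element `a`.
    obtain ⟨Q', hQ', hQ'Q⟩ := Ideal.exists_minimalPrimes_le hle
    have hQ'p : Q'.IsPrime := hQ'.1.1
    have haQ : a ∈ Q := hQ.1.2 (Ideal.mem_sup_right (Ideal.subset_span (by simp)))
    have h1 := ringKrullDim_le_of_mem_minimalPrimes_span_singleton (Ideal.Quotient.mk Q' a)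
      (Q.map (Ideal.Quotient.mk Q')) (by
        have hcm : Ideal.comap (Ideal.Quotient.mk Q') (Q.map (Ideal.Quotient.mk Q')) = Q := by
          rw [Ideal.comap_map_of_surjective _ Ideal.Quotient.mk_surjective, ← RingHom.ker_eq_comap_bot,
            Ideal.mk_ker, sup_eq_left.2 hQ'Q]
        refine ⟨⟨Ideal.map_isPrime_of_surjective Ideal.Quotient.mk_surjective (by
          rwa [Ideal.mk_ker]), ?_⟩, ?_⟩
        · rw [Ideal.span_singleton_le_iff_mem]
          exact Ideal.mem_map_of_mem _ haQ
        · rintro T ⟨hTp, hT⟩ hTQ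
          rw [Ideal.map_le_iff_le_comap]
          refine hQ.2 ⟨Ideal.comap_isPrime _ _, ?_⟩ ?_
          · have hQ'T : Q' ≤ Ideal.comap (Ideal.Quotient.mk Q') T := by
              intro x hx
              rw [Ideal.mem_comap, Ideal.Quotient.eq_zero_iff_mem.2 hx]
              exact T.zero_mem
            refine sup_le (le_trans (le_trans le_sup_left hQ'.1.2) hQ'T) ?_
            rw [Finset.coe_insert, Ideal.span_insert]
            refine sup_le ?_ (le_trans (le_trans le_sup_right hQ'.1.2) hQ'T)
            rw [Ideal.span_singleton_le_iff_mem, Ideal.mem_comap]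
            exact hT (Ideal.mem_span_singleton_self _)
          · exact le_trans (Ideal.comap_mono hTQ) hcm.le)
    have h2 : ringKrullDim ((MvPolynomial σ ℂ ⧸ Q') ⧸ Q.map (Ideal.Quotient.mk Q'))
        = ringKrullDim (MvPolynomial σ ℂ ⧸ Q) :=
      ringKrullDim_eq_of_ringEquiv (DoubleQuot.quotQuotEquivQuotOfLE hQ'Q)
    rw [h2] at h1
    refine (ih Q' hQ').trans ?_
    rw [Finset.card_insert_of_notMem ha]
    calc _ ≤ ringKrullDim (MvPolynomial σ ℂ ⧸ Q) + 1 + S.card := by gcongr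
      _ = _ := by push_cast; rw [add_assoc, add_comm (1 : WithBot ℕ∞)]

/-- Dimensions of primes drop strictly. -/
theorem ringKrullDim_add_one_le_of_lt {R : Type*} [CommRing R] {P Q : Ideal R} [P.IsPrime]
    (h : P < Q) : ringKrullDim (R ⧸ Q) + 1 ≤ ringKrullDim (R ⧸ P) := by
  obtain ⟨a, haQ, haP⟩ := Set.exists_of_ssubset h
  refine ringKrullDim_succ_le_of_surjective (Ideal.Quotient.factor h.le)
    (Ideal.Quotient.factor_surjective h.le) (r := Ideal.Quotient.mk P a) ?_ ?_
  · exact mem_nonZeroDivisors_of_ne_zero (fun h0 => haP (Ideal.Quotient.eq_zero_iff_mem.1 h0))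
  · simpa [Ideal.Quotient.eq_zero_iff_mem] using haQ

/-- Every chain of primes above `I` starts above some minimal prime, so the dimension is the
supremum over the components. -/
theorem ringKrullDim_quotient_le_iff {R : Type*} [CommRing R] (I : Ideal R) (d : WithBot ℕ∞) :
    ringKrullDim (R ⧸ I) ≤ d ↔ ∀ Q ∈ I.minimalPrimes, ringKrullDim (R ⧸ Q) ≤ d := by
  constructor
  · intro h Q hQ
    exact (ringKrullDim_le_of_surjective (Ideal.Quotient.factor hQ.1.2)
      (Ideal.Quotient.factor_surjective hQ.1.2)).trans h
  · intro h
    refine iSup_le fun l => ?_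
    have hp := l.head.isPrime
    have hle : I ≤ l.head.asIdeal.comap (Ideal.Quotient.mk I) := by
      intro x hx
      rw [Ideal.mem_comap, Ideal.Quotient.eq_zero_iff_mem.2 hx]
      exact Ideal.zero_mem _
    obtain ⟨Q, hQ, hQl⟩ := Ideal.exists_minimalPrimes_le hle
    refine le_trans ?_ (h Q hQ)
    rw [ringKrullDim_quotient]
    let f : PrimeSpectrum (R ⧸ I) → PrimeSpectrum R := PrimeSpectrum.comap (Ideal.Quotient.mk I)
    have hf : StrictMono f := RingHom.strictMono_comap_of_surjective Ideal.Quotient.mk_surjective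
    let l' : LTSeries (PrimeSpectrum.zeroLocus (Q : Set R)) :=
      { length := l.length
        toFun := fun i => ⟨f (l i), fun x hx => hf.monotone (l.head_le i) (hQl hx)⟩
        step := fun i => hf (l.step i) }
    exact Order.LTSeries.length_le_krullDim l'

theorem ringKrullDim_quotient_lt_iff {R : Type*} [CommRing R] (I : Ideal R) (d : ℕ) :
    ringKrullDim (R ⧸ I) < d ↔ ∀ Q ∈ I.minimalPrimes, ringKrullDim (R ⧸ Q) < d := by
  cases d with
  -- The only dimension below 0 is `⊥`, that of the empty set; otherwise strict bounds turn into
  -- weak ones for `d`.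
  | zero =>
    have key : ∀ x : WithBot ℕ∞, x < ((0 : ℕ) : WithBot ℕ∞) ↔ x ≤ ⊥ := by
      intro x
      induction x with
      | bot => simp
      | coe a => simp
    simp_rw [key]
    exact ringKrullDim_quotient_le_iff I ⊥
  | succ d =>
    have key : ∀ x : WithBot ℕ∞, x < ((d + 1 : ℕ) : WithBot ℕ∞) ↔ x ≤ ((d : ℕ) : WithBot ℕ∞) := by
      intro x
      induction x with
      | bot => simp
      | coe a =>
        induction a with
        | top =>
          refine iff_of_false (fun h => absurd h (not_lt.2 ?_)) (fun h => absurd h (not_le.2 ?_))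
          · exact le_top
          · exact WithBot.coe_lt_coe.2 (ENat.natCast_lt_top d)
        | coe a => norm_cast; omega
    simp_rw [key]
    exact ringKrullDim_quotient_le_iff I d

theorem exists_ringKrullDim_quotient_eq {σ : Type} [Finite σ] (P : Ideal (MvPolynomial σ ℂ))
    [P.IsPrime] : ∃ s : ℕ, ringKrullDim (MvPolynomial σ ℂ ⧸ P) = s :=
  let ⟨s, hs, _⟩ := exists_ringKrullDim_eq_trdeg ℂ (MvPolynomial σ ℂ ⧸ P)
  ⟨s, hs⟩

/-- A prime ideal of maximal dimension is determined by any prime containing it. -/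
theorem eq_of_le_of_ringKrullDim_le {σ : Type} [Finite σ] {P Q : Ideal (MvPolynomial σ ℂ)}
    [P.IsPrime] (h : P ≤ Q) (hQ : Q.IsPrime)
    (hd : ringKrullDim (MvPolynomial σ ℂ ⧸ P) ≤ ringKrullDim (MvPolynomial σ ℂ ⧸ Q)) : P = Q := by
  by_contra hne
  have h1 := (ringKrullDim_add_one_le_of_lt (lt_of_le_of_ne h hne)).trans hd
  obtain ⟨s, hs⟩ := exists_ringKrullDim_quotient_eq Q
  rw [hs] at h1
  have : s + 1 ≤ s := by exact_mod_cast h1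
  omega

end Dimension

/-! ### Extension of derivations and separable equations. -/

section Derivations

/-- Derivations extend along formally smooth maps. -/
theorem exists_derivation_of_formallySmooth {B K : Type} [CommRing B] [CommRing K] [Algebra ℂ B]
    [Algebra ℂ K] [Algebra B K] [IsScalarTower ℂ B K] [Algebra.FormallySmooth B K]
    (d : Derivation ℂ B K) : ∃ D : Derivation ℂ K K, ∀ b, D (algebraMap B K b) = d b := by
  -- The derivation is encoded as the ring map b ↦ b + d(b)ε to the dual numbers over `K`. Formal
  -- smoothness lifts the identity of `K` through the square-zero ideal, and the ε-part of the lift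
  -- is the extension.
  let φ : B →+* TrivSqZeroExt K K :=
    { toFun := fun b => TrivSqZeroExt.inl (algebraMap B K b) + TrivSqZeroExt.inr (d b)
      map_one' := by ext <;> simp
      map_zero' := by ext <;> simp
      map_add' := fun a b => by ext <;> simp
      map_mul' := fun a b => by
        ext
        · simp
        · simp only [TrivSqZeroExt.snd_mul, TrivSqZeroExt.snd_add, TrivSqZeroExt.snd_inl,
            TrivSqZeroExt.snd_inr, zero_add, TrivSqZeroExt.fst_add, TrivSqZeroExt.fst_inl,
            TrivSqZeroExt.fst_inr, add_zero, op_smul_eq_smul, d.leibniz, smul_eq_mul,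
            algebra_compatible_smul K] }
  have hφ1 : ∀ b, (φ b).fst = algebraMap B K b := fun b => by simp [φ]
  have hφ2 : ∀ b, (φ b).snd = d b := fun b => by simp [φ]
  let : Algebra B (TrivSqZeroExt K K) := φ.toAlgebra
  let g : TrivSqZeroExt K K →ₐ[B] K :=
    { (TrivSqZeroExt.fstHom ℂ K K).toRingHom with
      commutes' := hφ1 }
  have hker : IsNilpotent (RingHom.ker (g : TrivSqZeroExt K K →+* K)) := by
    have h : RingHom.ker (g : TrivSqZeroExt K K →+* K) = TrivSqZeroExt.kerIdeal K K := rfl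
    exact ⟨2, h ▸ TrivSqZeroExt.kerIdeal_sq K K⟩
  let L : K →ₐ[B] TrivSqZeroExt K K := Algebra.FormallySmooth.liftOfSurjective (AlgHom.id B K) g
    (fun x => ⟨TrivSqZeroExt.inl x, rfl⟩) hker
  have hL : ∀ x, (L x).fst = x := fun x =>
    Algebra.FormallySmooth.liftOfSurjective_apply (AlgHom.id B K) g _ hker x
  have hLB : ∀ b : B, (L (algebraMap B K b)).snd = d b := fun b =>
    (congrArg TrivSqZeroExt.snd (L.commutes b)).trans (hφ2 b)
  have hmul : ∀ a b, (L (a * b)).snd = a * (L b).snd + b * (L a).snd := by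
    intro a b
    rw [map_mul, TrivSqZeroExt.snd_mul, hL, hL, op_smul_eq_smul, smul_eq_mul, smul_eq_mul]
  have hC : ∀ c : ℂ, (L (algebraMap ℂ K c)).snd = 0 := by
    intro c
    rw [IsScalarTower.algebraMap_apply ℂ B K, hLB, d.map_algebraMap]
  let D0 : K →ₗ[ℂ] K :=
    { toFun := fun r => (L r).snd
      map_add' := fun a b => by rw [map_add, TrivSqZeroExt.snd_add]
      map_smul' := fun c a => by
        rw [Algebra.smul_def, hmul, hC, mul_zero, add_zero, RingHom.id_apply, Algebra.smul_def] }
  exact ⟨Derivation.mk' D0 hmul, hLB⟩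

/-- In characteristic zero, an algebraically independent family has dual derivations of the
fraction field. -/
theorem exists_derivation_of_algebraicIndependent {R : Type} [CommRing R] [IsDomain R]
    [Algebra ℂ R] [Algebra.FiniteType ℂ R] {ι : Type} [Finite ι] [DecidableEq ι] {f : ι → R}
    (hf : AlgebraicIndependent ℂ f) (i : ι) :
    ∃ D : Derivation ℂ R (FractionRing R), ∀ j, D (f j) = if j = i then 1 else 0 := by
  let K := FractionRing R
  let B := MvPolynomial ι ℂ
  let fK : ι → K := fun j => algebraMap R K (f j)
  have hinj : Function.Injective (MvPolynomial.aeval fK : B →ₐ[ℂ] K) := by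
    have h1 : (MvPolynomial.aeval fK : B →ₐ[ℂ] K) =
        (IsScalarTower.toAlgHom ℂ R K).comp (MvPolynomial.aeval f) := by
      ext j; simp [fK]
    rw [h1]
    exact (IsFractionRing.injective R K).comp hf
  let : Algebra B K := (MvPolynomial.aeval fK : B →ₐ[ℂ] K).toRingHom.toAlgebra
  have : IsScalarTower ℂ B K := IsScalarTower.of_algebraMap_eq' (by
    ext c
    exact ((MvPolynomial.aeval fK : B →ₐ[ℂ] K).commutes c).symm)
  have : FaithfulSMul B K := (faithfulSMul_iff_algebraMap_injective _ _).2 hinj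
  let : Algebra (FractionRing B) K := FractionRing.liftAlgebra B K
  have : IsScalarTower B (FractionRing B) K := inferInstance
  have : IsScalarTower ℂ (FractionRing B) K := IsScalarTower.of_algebraMap_eq' (by
    rw [IsScalarTower.algebraMap_eq ℂ B (FractionRing B), ← RingHom.comp_assoc,
      ← IsScalarTower.algebraMap_eq B (FractionRing B) K, ← IsScalarTower.algebraMap_eq ℂ B K])
  have : Algebra.EssFiniteType (FractionRing B) K := Algebra.EssFiniteType.of_comp ℂ _ _
  -- The polynomial ring maps formally smoothly to its fraction field as a localization, and that
  -- field to `K` as a finitely generated field extension in characteristic zero. So ∂/∂X_i extends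
  -- to `K`.
  have : Algebra.FormallySmooth B (FractionRing B) :=
    Algebra.FormallySmooth.of_isLocalization (nonZeroDivisors B)
  have : Algebra.FormallySmooth (FractionRing B) K := inferInstance
  have hsm : Algebra.FormallySmooth B K := Algebra.FormallySmooth.comp B (FractionRing B) K
  obtain ⟨D, hD⟩ := exists_derivation_of_formallySmooth
    (MvPolynomial.mkDerivation ℂ (fun j : ι => if j = i then (1 : K) else 0))
  refine ⟨(D.compAlgebraMap R : Derivation ℂ R K), fun j => ?_⟩
  have h1 : algebraMap R K (f j) = algebraMap B K (MvPolynomial.X j) := by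
    change _ = MvPolynomial.aeval fK (MvPolynomial.X j)
    rw [MvPolynomial.aeval_X]
  change D (algebraMap R K (f j)) = _
  rw [h1, hD, MvPolynomial.mkDerivation_X]

/-- An algebraic element over a subring of a domain of characteristic zero is a simple root of
some polynomial. -/
theorem exists_aeval_eq_zero_derivative_ne_zero {B R : Type*} [CommRing B] [CommRing R]
    [IsDomain R] [Algebra B R] [FaithfulSMul B R] [CharZero B] [IsDomain B] {r : R}
    (hr : IsAlgebraic B r) :
    ∃ F : Polynomial B, Polynomial.aeval r F = 0 ∧ Polynomial.aeval r F.derivative ≠ 0 := by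
  classical
  -- For a nonzero annihilating polynomial of least degree, the derivative is nonzero of smaller
  -- degree and cannot annihilate.
  have hex : ∃ d : ℕ, ∃ F : Polynomial B, F ≠ 0 ∧ Polynomial.aeval r F = 0 ∧ F.natDegree = d := by
    obtain ⟨F, hF, hF0⟩ := hr
    exact ⟨_, F, hF, hF0, rfl⟩
  obtain ⟨F, hF, hF0, hFd⟩ := Nat.find_spec hex
  refine ⟨F, hF0, fun h => ?_⟩
  have hd : F.natDegree ≠ 0 := by
    intro h0
    rw [Polynomial.eq_C_of_natDegree_eq_zero h0] at hF0 hF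
    rw [Polynomial.aeval_C] at hF0
    have := (FaithfulSMul.algebraMap_injective B R) (hF0.trans (map_zero _).symm)
    exact hF (by rw [this, map_zero])
  have hlt : F.derivative.natDegree < F.natDegree := Polynomial.natDegree_derivative_lt hd
  have hne : F.derivative ≠ 0 := by
    intro h0
    exact hd (Polynomial.derivative_eq_zero.1 h0)
  rw [hFd] at hlt
  exact Nat.find_min hex hlt ⟨_, hne, h, rfl⟩

end Derivations

end AffinePolar

namespace AffinePolar

open MvPolynomial

/-! ### Differentials of polynomials and Zariski tangent spaces. -/

section Differential

variable {σ κ : Type} [Fintype σ] [Fintype κ]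

/-- The differential at `x` of a polynomial function. -/
noncomputable def dpoly (p : MvPolynomial σ ℂ) (x : σ → ℂ) : (σ → ℂ) →ₗ[ℂ] ℂ :=
  ∑ i, eval x (pderiv i p) • LinearMap.proj i

theorem dpoly_apply (p : MvPolynomial σ ℂ) (x v : σ → ℂ) :
    dpoly p x v = ∑ i, eval x (pderiv i p) * v i := by
  simp [dpoly]

theorem dpoly_add (p q : MvPolynomial σ ℂ) (x v : σ → ℂ) :
    dpoly (p + q) x v = dpoly p x v + dpoly q x v := by
  simp [dpoly_apply, add_mul, Finset.sum_add_distrib]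

theorem dpoly_sub (p q : MvPolynomial σ ℂ) (x v : σ → ℂ) :
    dpoly (p - q) x v = dpoly p x v - dpoly q x v := by
  simp [dpoly_apply, sub_mul, Finset.sum_sub_distrib]

theorem dpoly_mul (p q : MvPolynomial σ ℂ) (x v : σ → ℂ) :
    dpoly (p * q) x v = eval x p * dpoly q x v + eval x q * dpoly p x v := by
  simp only [dpoly_apply, Derivation.leibniz, smul_eq_mul, map_add, map_mul, add_mul,
    Finset.sum_add_distrib, Finset.mul_sum, mul_assoc]

@[simp] theorem dpoly_C (c : ℂ) (x v : σ → ℂ) : dpoly (C c) x v = 0 := by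
  simp [dpoly_apply]

@[simp] theorem dpoly_X (i : σ) (x v : σ → ℂ) : dpoly (X i) x v = v i := by
  classical
  simp [dpoly_apply, pderiv_X, Pi.single_apply]

theorem dpoly_C_mul (c : ℂ) (p : MvPolynomial σ ℂ) (x v : σ → ℂ) :
    dpoly (C c * p) x v = c * dpoly p x v := by
  simp [dpoly_mul]

theorem dpoly_sum {ι : Type*} (s : Finset ι) (p : ι → MvPolynomial σ ℂ) (x v : σ → ℂ) :
    dpoly (∑ i ∈ s, p i) x v = ∑ i ∈ s, dpoly (p i) x v := by
  classical
  induction s using Finset.induction_on with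
  | empty => simpa using dpoly_C 0 x v
  | insert a s ha ih => rw [Finset.sum_insert ha, Finset.sum_insert ha, dpoly_add, ih]

theorem mem_tangentSpace {A : Set (σ → ℂ)} {x v : σ → ℂ} :
    v ∈ tangentSpace A x ↔ ∀ p ∈ vanishingIdeal ℂ A, dpoly p x v = 0 := by
  simp only [dpoly_apply]
  rfl

theorem tangentSpace_mono {A B : Set (σ → ℂ)} (h : A ⊆ B) (x : σ → ℂ) :
    tangentSpace A x ≤ tangentSpace B x := by
  intro v hv
  rw [mem_tangentSpace] at hv ⊢
  exact fun p hp => hv p (vanishingIdeal_anti_mono h hp)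

/-- The polynomial map with components `f`. -/
noncomputable def evalMap (f : κ → MvPolynomial σ ℂ) (x : σ → ℂ) : κ → ℂ := fun j => eval x (f j)

omit [Fintype σ] [Fintype κ] in
@[simp] theorem evalMap_apply (f : κ → MvPolynomial σ ℂ) (x : σ → ℂ) (j : κ) :
    evalMap f x j = eval x (f j) := rfl

/-- The differential of the polynomial map with components `f`. -/
noncomputable def dmap (f : κ → MvPolynomial σ ℂ) (x : σ → ℂ) : (σ → ℂ) →ₗ[ℂ] (κ → ℂ) :=
  LinearMap.pi fun j => dpoly (f j) x

omit [Fintype κ] in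
@[simp] theorem dmap_apply (f : κ → MvPolynomial σ ℂ) (x v : σ → ℂ) (j : κ) :
    dmap f x v j = dpoly (f j) x v := rfl

omit [Fintype σ] [Fintype κ] in
theorem eval_bind₁ (f : κ → MvPolynomial σ ℂ) (p : MvPolynomial κ ℂ) (x : σ → ℂ) :
    eval x (bind₁ f p) = eval (evalMap f x) p := by
  rw [← coe_aeval_eq_eval, ← coe_aeval_eq_eval, RingHom.coe_coe, RingHom.coe_coe, aeval_bind₁]
  rfl

theorem dpoly_bind₁ (f : κ → MvPolynomial σ ℂ) (p : MvPolynomial κ ℂ) (x v : σ → ℂ) :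
    dpoly (bind₁ f p) x v = dpoly p (evalMap f x) (dmap f x v) := by
  induction p using MvPolynomial.induction_on with
  | C a => simp
  | add p q hp hq => simp [dpoly_add, hp, hq]
  | mul_X p i hp =>
    rw [map_mul, dpoly_mul, dpoly_mul, hp, eval_bind₁, bind₁_X_right, dpoly_X, dmap_apply, eval_X,
      evalMap_apply]

/-- Polynomial maps induce maps of Zariski tangent spaces. -/
theorem dmap_mem_tangentSpace {f : κ → MvPolynomial σ ℂ} {A : Set (σ → ℂ)} {B : Set (κ → ℂ)}
    (h : ∀ x ∈ A, evalMap f x ∈ B) {x v : σ → ℂ} (hv : v ∈ tangentSpace A x) :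
    dmap f x v ∈ tangentSpace B (evalMap f x) := by
  rw [mem_tangentSpace] at hv ⊢
  intro p hp
  rw [← dpoly_bind₁]
  refine hv _ fun y hy => ?_
  have := hp _ (h y hy)
  rw [aeval_eq_eval, eval_bind₁]
  rwa [aeval_eq_eval] at this

end Differential

/-! ### Thin sets and dominance. -/

section Thin

variable {σ κ : Type} [Fintype σ] [Fintype κ]

omit [Fintype κ] in
theorem mem_vanishingIdeal' {A : Set (κ → ℂ)} {p : MvPolynomial κ ℂ} :
    p ∈ vanishingIdeal ℂ A ↔ ∀ x ∈ A, eval x p = 0 := by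
  simp [aeval_eq_eval]

omit [Fintype κ] in
theorem mem_zeroLocus' {I : Ideal (MvPolynomial κ ℂ)} {x : κ → ℂ} :
    x ∈ zeroLocus ℂ I ↔ ∀ p ∈ I, eval x p = 0 := by
  simp [aeval_eq_eval]

/-- A subset of affine space is thin if it is not Zariski dense. -/
def Thin (B : Set (κ → ℂ)) : Prop := ∃ F : MvPolynomial κ ℂ, F ≠ 0 ∧ ∀ b ∈ B, eval b F = 0

omit [Fintype κ] in
theorem Thin.mono {B B' : Set (κ → ℂ)} (h : Thin B') (hB : B ⊆ B') : Thin B :=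
  let ⟨F, hF, hF'⟩ := h
  ⟨F, hF, fun b hb => hF' b (hB hb)⟩

omit [Fintype κ] in
theorem thin_empty : Thin (∅ : Set (κ → ℂ)) := ⟨1, one_ne_zero, by simp⟩

omit [Fintype κ] in
theorem Thin.union {B B' : Set (κ → ℂ)} (h : Thin B) (h' : Thin B') : Thin (B ∪ B') := by
  obtain ⟨F, hF, hFB⟩ := h
  obtain ⟨F', hF', hFB'⟩ := h'
  refine ⟨F * F', mul_ne_zero hF hF', ?_⟩
  rintro b (hb | hb)
  · rw [map_mul, hFB b hb, zero_mul]
  · rw [map_mul, hFB' b hb, mul_zero]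

omit [Fintype κ] in
theorem thin_biUnion {ι : Type*} {s : Set ι} (hs : s.Finite) {B : ι → Set (κ → ℂ)}
    (h : ∀ i ∈ s, Thin (B i)) : Thin (⋃ i ∈ s, B i) := by
  induction s, hs using Set.Finite.induction_on with
  | empty => simpa using thin_empty
  | insert _ _ ih =>
    rw [Set.biUnion_insert]
    exact (h _ (Set.mem_insert _ _)).union (ih fun i hi => h i (Set.mem_insert_of_mem _ hi))

omit [Fintype κ] in
theorem isZariskiOpenDense_ne_zero [Fintype κ] {F : MvPolynomial κ ℂ} (hF : F ≠ 0) :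
    IsZariskiOpenDense {t : κ → ℂ | eval t F ≠ 0} := by
  constructor
  · refine ⟨Ideal.span {F}, ?_⟩
    ext t
    simp [zeroLocus_span, aeval_eq_eval]
  · rw [zariskiClosure, Set.eq_univ_iff_forall]
    intro x p hp
    have : p * F = 0 := by
      apply MvPolynomial.funext
      intro t
      by_cases ht : eval t F = 0
      · rw [map_mul, ht, mul_zero, map_zero]
      · rw [map_mul, map_zero, mem_vanishingIdeal'.1 hp t ht, zero_mul]
    rw [(mul_eq_zero.1 this).resolve_right hF, map_zero]

/-- A property holding outside a thin set holds on a nonempty Zariski-open set. -/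
theorem Thin.exists_open {B : Set (κ → ℂ)} (h : Thin B) :
    ∃ V : Set (κ → ℂ), IsZariskiOpenDense V ∧ ∀ t ∈ V, t ∉ B :=
  let ⟨_, hF, hFB⟩ := h
  ⟨_, isZariskiOpenDense_ne_zero hF, fun _ ht hB => ht (hFB _ hB)⟩

theorem isRadical_vanishingIdeal (A : Set (σ → ℂ)) : (vanishingIdeal ℂ A).radical = vanishingIdeal ℂ A := by
  refine le_antisymm ?_ Ideal.le_radical
  rintro p ⟨n, hn⟩
  rw [mem_vanishingIdeal'] at hn ⊢
  intro x hx
  have := hn x hx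
  rw [map_pow] at this
  by_contra h0
  exact pow_ne_zero n h0 this

theorem mem_vanishingIdeal_of_forall_minimalPrimes {A : Set (σ → ℂ)} {p : MvPolynomial σ ℂ}
    (h : ∀ Q ∈ (vanishingIdeal ℂ A).minimalPrimes, p ∈ Q) : p ∈ vanishingIdeal ℂ A := by
  rw [← isRadical_vanishingIdeal A, ← Ideal.sInf_minimalPrimes, Ideal.mem_sInf]
  exact fun {Q} hQ => h Q hQ

/-- If the functions satisfied a relation on each of the finitely many components, the product of
these relations would vanish on the image. -/
theorem exists_algebraicIndependent_of_not_thin {A : Set (σ → ℂ)} {f : κ → MvPolynomial σ ℂ}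
    (h : ¬ Thin (evalMap f '' A)) : ∃ Q ∈ (vanishingIdeal ℂ A).minimalPrimes,
      AlgebraicIndependent ℂ fun j => Ideal.Quotient.mk Q (f j) := by
  by_contra hno
  push Not at hno
  have hex : ∀ Q ∈ (vanishingIdeal ℂ A).minimalPrimes, ∃ F : MvPolynomial κ ℂ, F ≠ 0 ∧
      bind₁ f F ∈ Q := by
    intro Q hQ
    have := hno Q hQ
    rw [algebraicIndependent_iff] at this
    push Not at this
    obtain ⟨F, hF, hF0⟩ := this
    refine ⟨F, hF0, ?_⟩
    rw [← Ideal.Quotient.eq_zero_iff_mem, ← hF, ← Ideal.Quotient.mkₐ_eq_mk ℂ, ← AlgHom.comp_apply]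
    congr 1
    ext j
    simp
  choose! F hF hFQ using hex
  have hfin := (vanishingIdeal ℂ A).finite_minimalPrimes_of_isNoetherianRing (MvPolynomial σ ℂ)
  apply h
  refine ⟨∏ Q ∈ hfin.toFinset, F Q, Finset.prod_ne_zero_iff.2 fun Q hQ =>
    hF Q (hfin.mem_toFinset.1 hQ), ?_⟩
  rintro _ ⟨x, hx, rfl⟩
  have hmem : bind₁ f (∏ Q ∈ hfin.toFinset, F Q) ∈ vanishingIdeal ℂ A := by
    refine mem_vanishingIdeal_of_forall_minimalPrimes fun Q hQ => ?_
    rw [map_prod]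
    exact Ideal.mem_of_dvd _ (Finset.dvd_prod_of_mem _ (hfin.mem_toFinset.2 hQ)) (hFQ Q hQ)
  rw [← eval_bind₁]
  exact mem_vanishingIdeal'.1 hmem x hx

end Thin

/-! ### Generic smoothness and the algebraic Sard theorem. -/

section Generic

variable {σ κ : Type} [Fintype σ] [Fintype κ]

theorem derivation_eq_sum_pderiv {M : Type*} [AddCommGroup M] [Module ℂ M]
    [Module (MvPolynomial σ ℂ) M] [IsScalarTower ℂ (MvPolynomial σ ℂ) M]
    (D : Derivation ℂ (MvPolynomial σ ℂ) M) (p : MvPolynomial σ ℂ) :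
    D p = ∑ l, pderiv l p • D (X l) := by
  classical
  induction p using MvPolynomial.induction_on with
  | C a => simp [derivation_C]
  | add p q hp hq => simp [hp, hq, add_smul, Finset.sum_add_distrib]
  | mul_X p i hp =>
    rw [D.leibniz, hp]
    simp [pderiv_X, add_smul, Finset.sum_add_distrib, mul_smul, Finset.smul_sum, Pi.single_apply]

/-- Generic smoothness: algebraically independent functions on an irreducible variety are
generically submersive. -/
theorem exists_submersive_of_algebraicIndependent (P : Ideal (MvPolynomial σ ℂ)) [P.IsPrime]
    {f : κ → MvPolynomial σ ℂ} (hf : AlgebraicIndependent ℂ fun j => Ideal.Quotient.mk P (f j)) :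
    ∃ g ∉ P, ∀ x ∈ zeroLocus ℂ P, eval x g ≠ 0 →
      ∀ w : κ → ℂ, ∃ v ∈ tangentSpace (zeroLocus ℂ P) x, dmap f x v = w := by
  classical
  -- The derivation dual to `f i`, cleared of denominators by `g`, is a polynomial vector field `a`
  -- tangent to the variety, with df_j(a) = g δ_ij modulo `P`.
  have key : ∀ i : κ, ∃ g ∉ P, ∃ a : σ → MvPolynomial σ ℂ,
      (∀ p ∈ P, ∑ l, pderiv l p * a l ∈ P) ∧
      ∀ j, (∑ l, pderiv l (f j) * a l) - (if j = i then g else 0) ∈ P := by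
    intro i
    obtain ⟨D, hD⟩ := exists_derivation_of_algebraicIndependent hf i
    let R := MvPolynomial σ ℂ ⧸ P
    obtain ⟨⟨b, hb⟩, hint⟩ := IsLocalization.exist_integer_multiples_of_finite (nonZeroDivisors R)
      (fun l : σ => D (Ideal.Quotient.mk P (X l)))
    choose a' ha' using hint
    obtain ⟨g, rfl⟩ := Ideal.Quotient.mk_surjective b
    choose a ha using fun l => Ideal.Quotient.mk_surjective (a' l)
    have hDp : ∀ p : MvPolynomial σ ℂ,
        algebraMap R (FractionRing R) (Ideal.Quotient.mk P (∑ l, pderiv l p * a l)) =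
        algebraMap R (FractionRing R) (Ideal.Quotient.mk P g) * D (Ideal.Quotient.mk P p) := by
      intro p
      have h1 := derivation_eq_sum_pderiv (D.compAlgebraMap (MvPolynomial σ ℂ)) p
      have h2 : D (Ideal.Quotient.mk P p) = ∑ l, algebraMap R (FractionRing R)
          (Ideal.Quotient.mk P (pderiv l p)) * D (Ideal.Quotient.mk P (X l)) := by
        refine h1.trans (Finset.sum_congr rfl fun l _ => ?_)
        rw [← algebraMap_smul R, ← algebraMap_smul (FractionRing R), smul_eq_mul]
        rfl
      rw [h2, Finset.mul_sum, map_sum, map_sum]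
      refine Finset.sum_congr rfl fun l _ => ?_
      rw [map_mul, map_mul, ha, ha']
      simp only [Algebra.smul_def]
      ring
    have hinj := IsFractionRing.injective R (FractionRing R)
    refine ⟨g, fun hg => ?_, a, fun p hp => ?_, fun j => ?_⟩
    · rw [Ideal.Quotient.eq_zero_iff_mem.2 hg] at hb
      exact zero_notMem_nonZeroDivisors hb
    · rw [← Ideal.Quotient.eq_zero_iff_mem]
      apply hinj
      rw [hDp, Ideal.Quotient.eq_zero_iff_mem.2 hp, map_zero, map_zero, mul_zero]
    · rw [← Ideal.Quotient.eq_zero_iff_mem, map_sub, sub_eq_zero]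
      apply hinj
      rw [hDp, hD]
      split_ifs <;> simp
  choose g hg a ha hfa using key
  refine ⟨∏ i, g i, fun h => ?_, fun x hx hgx w => ?_⟩
  · obtain ⟨i, -, hi⟩ := (Ideal.IsPrime.prod_mem_iff).1 h
    exact hg i hi
  · rw [map_prod, Finset.prod_ne_zero_iff] at hgx
    refine ⟨∑ i, (w i / eval x (g i)) • fun l => eval x (a i l), ?_, ?_⟩
    · refine Submodule.sum_mem _ fun i _ => Submodule.smul_mem _ _ ?_
      rw [mem_tangentSpace, IsPrime.vanishingIdeal_zeroLocus]
      intro p hp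
      have := mem_zeroLocus'.1 hx _ (ha i p hp)
      simpa [dpoly_apply] using this
    · ext j
      rw [dmap_apply, map_sum, Finset.sum_eq_single j]
      · have := mem_zeroLocus'.1 hx _ (hfa j j)
        rw [if_pos rfl, map_sub, sub_eq_zero] at this
        rw [map_smul, dpoly_apply, smul_eq_mul]
        have h2 : ∑ l, eval x (pderiv l (f j)) * eval x (a j l) = eval x (g j) := by
          simpa using this
        rw [h2, div_mul_cancel₀ _ (hgx j (Finset.mem_univ _))]
      · intro i _ hij
        have := mem_zeroLocus'.1 hx _ (hfa i j)
        rw [if_neg hij.symm, sub_zero] at this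
        rw [map_smul, dpoly_apply]
        have h2 : ∑ l, eval x (pderiv l (f j)) * eval x (a i l) = 0 := by
          simpa using this
        rw [h2, smul_zero]
      · simp

/-- The coefficients of `F` are functions of `y` and have zero derivative along `v`; only the
derivative in the main variable survives. -/
theorem dpoly_eval₂_eq {B : Type} [Fintype B] (y : B → MvPolynomial σ ℂ)
    (F : Polynomial (MvPolynomial B ℂ)) (r : MvPolynomial σ ℂ) (x v : σ → ℂ)
    (hv : dmap y x v = 0) :
    dpoly (F.eval₂ (bind₁ y : MvPolynomial B ℂ →+* MvPolynomial σ ℂ) r) x v =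
      eval x (F.derivative.eval₂ (bind₁ y : MvPolynomial B ℂ →+* MvPolynomial σ ℂ) r)
        * dpoly r x v := by
  induction F using Polynomial.induction_on' with
  | add p q hp hq => simp [Polynomial.eval₂_add, dpoly_add, hp, hq, add_mul]
  | monomial n c =>
    have hc : dpoly (bind₁ y c) x v = 0 := by rw [dpoly_bind₁, hv, map_zero]
    have hpow : ∀ m : ℕ, dpoly (r ^ m) x v = m * eval x r ^ (m - 1) * dpoly r x v := by
      intro m
      simp only [dpoly_apply, Derivation.leibniz_pow, smul_eq_mul, nsmul_eq_mul, map_mul, map_pow,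
        map_natCast, Finset.mul_sum]
      exact Finset.sum_congr rfl fun i _ => by ring
    rw [Polynomial.derivative_monomial, Polynomial.eval₂_monomial, Polynomial.eval₂_monomial,
      dpoly_mul, RingHom.coe_coe, hc, hpow]
    simp only [map_mul, map_pow, map_natCast]
    ring

theorem exists_noether_normalization (R : Type) [CommRing R] [IsDomain R] [Algebra ℂ R]
    [Algebra.FiniteType ℂ R] : ∃ s : ℕ, ringKrullDim R = s ∧
      ∃ g : MvPolynomial (Fin s) ℂ →ₐ[ℂ] R, Function.Injective g ∧
        ∀ r : R, ∃ F : Polynomial (MvPolynomial (Fin s) ℂ),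
          F.eval₂ (g : _ →+* R) r = 0 ∧ F.derivative.eval₂ (g : _ →+* R) r ≠ 0 := by
  obtain ⟨s, g, hg, hfin⟩ := exists_finite_inj_algHom_of_fg ℂ R
  let : Algebra (MvPolynomial (Fin s) ℂ) R := g.toRingHom.toAlgebra
  have : FaithfulSMul (MvPolynomial (Fin s) ℂ) R :=
    (faithfulSMul_iff_algebraMap_injective _ _).2 hg
  have : Module.Finite (MvPolynomial (Fin s) ℂ) R := hfin
  refine ⟨s, ?_, g, hg, fun r => ?_⟩
  · rw [ringKrullDim_eq_of_integral (B := MvPolynomial (Fin s) ℂ),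
      MvPolynomial.ringKrullDim_of_isNoetherianRing]
    simp
  · exact exists_aeval_eq_zero_derivative_ne_zero (B := MvPolynomial (Fin s) ℂ)
      (Algebra.IsIntegral.isIntegral r).isAlgebraic

/-- The generic tangent space of an irreducible variety has the dimension of the variety. -/
theorem exists_finrank_tangentSpace_eq (P : Ideal (MvPolynomial σ ℂ)) [P.IsPrime] :
    ∃ g ∉ P, ∀ x ∈ zeroLocus ℂ P, eval x g ≠ 0 →
      (Module.finrank ℂ (tangentSpace (zeroLocus ℂ P) x) : WithBot ℕ∞) =
        ringKrullDim (MvPolynomial σ ℂ ⧸ P) := by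
  classical
  obtain ⟨s, hdim, g, hg, hroot⟩ := exists_noether_normalization (MvPolynomial σ ℂ ⧸ P)
  choose y hy using fun i : Fin s => Ideal.Quotient.mk_surjective (g (X i))
  have hgy : ∀ b, Ideal.Quotient.mk P (bind₁ y b) = g b := by
    intro b
    rw [← Ideal.Quotient.mkₐ_eq_mk ℂ, ← AlgHom.comp_apply]
    congr 1
    ext i
    simp [hy]
  have hyind : AlgebraicIndependent ℂ fun j => Ideal.Quotient.mk P (y j) := by
    simp_rw [hy]
    exact (algebraicIndependent_X (Fin s) ℂ).map' hg
  obtain ⟨g₁, hg₁, hsub⟩ := exists_submersive_of_algebraicIndependent P hyind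
  have hF : ∀ l : σ, ∃ F : Polynomial (MvPolynomial (Fin s) ℂ),
      F.eval₂ (bind₁ y : _ →+* MvPolynomial σ ℂ) (X l) ∈ P ∧
      F.derivative.eval₂ (bind₁ y : _ →+* MvPolynomial σ ℂ) (X l) ∉ P := by
    intro l
    obtain ⟨F, hF0, hF1⟩ := hroot (Ideal.Quotient.mk P (X l))
    have hev : ∀ G : Polynomial (MvPolynomial (Fin s) ℂ),
        Ideal.Quotient.mk P (G.eval₂ (bind₁ y : _ →+* MvPolynomial σ ℂ) (X l)) =
        G.eval₂ (g : _ →+* MvPolynomial σ ℂ ⧸ P) (Ideal.Quotient.mk P (X l)) := by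
      intro G
      rw [Polynomial.hom_eval₂]
      congr 1
      exact RingHom.ext hgy
    refine ⟨F, ?_, ?_⟩
    · rw [← Ideal.Quotient.eq_zero_iff_mem, hev, hF0]
    · rw [← Ideal.Quotient.eq_zero_iff_mem, hev]
      exact hF1
  choose F hFP hFP' using hF
  refine ⟨g₁ * ∏ l, (F l).derivative.eval₂ (bind₁ y : _ →+* MvPolynomial σ ℂ) (X l), ?_, ?_⟩
  · intro h
    rcases Ideal.IsPrime.mem_or_mem inferInstance h with h | h
    · exact hg₁ h
    · obtain ⟨l, -, hl⟩ := (Ideal.IsPrime.prod_mem_iff).1 h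
      exact hFP' l hl
  · intro x hx hgx
    rw [map_mul, map_prod, mul_ne_zero_iff, Finset.prod_ne_zero_iff] at hgx
    rw [hdim, Nat.cast_inj]
    -- At a generic point the differential of the normalization is bijective on the tangent space:
    -- onto by generic submersivity, and injective since every coordinate is a simple root of an
    -- equation over `y`.
    let φ := (dmap y x).domRestrict (tangentSpace (zeroLocus ℂ P) x)
    have hφs : Function.Surjective φ := by
      intro w
      obtain ⟨v, hv, hvw⟩ := hsub x hx hgx.1 w
      exact ⟨⟨v, hv⟩, hvw⟩
    have hφi : Function.Injective φ := by
      rw [injective_iff_map_eq_zero]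
      rintro ⟨v, hv⟩ hv0
      have hv0' : dmap y x v = 0 := hv0
      ext l
      rw [mem_tangentSpace, IsPrime.vanishingIdeal_zeroLocus] at hv
      have := hv _ (hFP l)
      rw [dpoly_eval₂_eq y _ _ _ _ hv0', dpoly_X] at this
      exact (mul_eq_zero.1 this).resolve_left (hgx.2 l (Finset.mem_univ _))
    rw [(LinearEquiv.ofBijective φ ⟨hφi, hφs⟩).finrank_eq]
    simp

/-- Away from the other components, a set has the same tangent spaces as a component of its
closure. -/
theorem exists_tangentSpace_eq_of_mem_minimalPrimes {A : Set (σ → ℂ)}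
    {Q : Ideal (MvPolynomial σ ℂ)} (hQ : Q ∈ (vanishingIdeal ℂ A).minimalPrimes) :
    ∃ h ∉ Q, ∀ q ∈ A, eval q h ≠ 0 → q ∈ zeroLocus ℂ Q ∧
      tangentSpace A q = tangentSpace (zeroLocus ℂ Q) q := by
  classical
  have hQp : Q.IsPrime := hQ.1.1
  have hfin := (vanishingIdeal ℂ A).finite_minimalPrimes_of_isNoetherianRing (MvPolynomial σ ℂ)
  have hex : ∀ Q' ∈ hfin.toFinset.erase Q, ∃ h ∈ Q', h ∉ Q := by
    intro Q' hQ'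
    rw [Finset.mem_erase, hfin.mem_toFinset] at hQ'
    by_contra hno
    push Not at hno
    exact hQ'.1 (le_antisymm hno (hQ.2 hQ'.2.1 hno))
  choose! h hh hhQ using hex
  refine ⟨∏ Q' ∈ hfin.toFinset.erase Q, h Q', fun hmem => ?_, fun q hq hne => ?_⟩
  · obtain ⟨Q', hQ', h'⟩ := (Ideal.IsPrime.prod_mem_iff).1 hmem
    exact hhQ Q' hQ' h'
  · set H := ∏ Q' ∈ hfin.toFinset.erase Q, h Q' with hH
    -- `H` vanishes on all other components. Where `H` is nonzero, the product rule therefore gives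
    -- the equations of `Q` and those of `A` the same tangent space.
    have hmul : ∀ p ∈ Q, H * p ∈ vanishingIdeal ℂ A := by
      intro p hp
      refine mem_vanishingIdeal_of_forall_minimalPrimes fun Q' hQ' => ?_
      by_cases hQQ : Q' = Q
      · rw [hQQ]; exact Ideal.mul_mem_left _ _ hp
      · have hmem : Q' ∈ hfin.toFinset.erase Q :=
          Finset.mem_erase.2 ⟨hQQ, hfin.mem_toFinset.2 hQ'⟩
        exact Ideal.mul_mem_right _ _
          (Ideal.mem_of_dvd _ (Finset.dvd_prod_of_mem _ hmem) (hh Q' hmem))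
    have hzero : ∀ p ∈ Q, eval q p = 0 := by
      intro p hp
      have := mem_vanishingIdeal'.1 (hmul p hp) q hq
      rw [map_mul] at this
      exact (mul_eq_zero.1 this).resolve_left hne
    refine ⟨mem_zeroLocus'.2 hzero, le_antisymm ?_ ?_⟩
    · intro v hv
      rw [mem_tangentSpace] at hv ⊢
      rw [IsPrime.vanishingIdeal_zeroLocus]
      intro p hp
      have := hv _ (hmul p hp)
      rw [dpoly_mul, hzero p hp, zero_mul, add_zero] at this
      exact (mul_eq_zero.1 this).resolve_left hne
    · intro v hv
      rw [mem_tangentSpace, IsPrime.vanishingIdeal_zeroLocus] at hv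
      rw [mem_tangentSpace]
      exact fun p hp => hv p (hQ.1.2 hp)

/-- The generic point of a component of the closure of a set. -/
theorem exists_generic_point {A : Set (σ → ℂ)} {Q : Ideal (MvPolynomial σ ℂ)}
    (hQ : Q ∈ (vanishingIdeal ℂ A).minimalPrimes) {f : κ → MvPolynomial σ ℂ}
    (hf : AlgebraicIndependent ℂ fun j => Ideal.Quotient.mk Q (f j))
    {u : MvPolynomial σ ℂ} (hu : u ∉ Q) :
    ∃ q ∈ A, eval q u ≠ 0 ∧ q ∈ zeroLocus ℂ Q ∧
      tangentSpace A q = tangentSpace (zeroLocus ℂ Q) q ∧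
      (Module.finrank ℂ (tangentSpace A q) : WithBot ℕ∞) = ringKrullDim (MvPolynomial σ ℂ ⧸ Q) ∧
      ∀ w : κ → ℂ, ∃ v ∈ tangentSpace A q, dmap f q v = w := by
  have hQp : Q.IsPrime := hQ.1.1
  obtain ⟨h, hh, hh'⟩ := exists_tangentSpace_eq_of_mem_minimalPrimes hQ
  obtain ⟨g₁, hg₁, hg₁'⟩ := exists_finrank_tangentSpace_eq Q
  obtain ⟨g₂, hg₂, hg₂'⟩ := exists_submersive_of_algebraicIndependent Q hf
  have hmem : u * h * (g₁ * g₂) ∉ Q := by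
    intro hmem
    rcases hQp.mem_or_mem hmem with h1 | h1 <;> rcases hQp.mem_or_mem h1 with h2 | h2
    exacts [hu h2, hh h2, hg₁ h2, hg₂ h2]
  have hnot : u * h * (g₁ * g₂) ∉ vanishingIdeal ℂ A := fun h => hmem (hQ.1.2 h)
  rw [mem_vanishingIdeal'] at hnot
  push Not at hnot
  obtain ⟨q, hqA, hq⟩ := hnot
  simp only [map_mul, mul_ne_zero_iff] at hq
  obtain ⟨hqQ, hT⟩ := hh' q hqA hq.1.2
  refine ⟨q, hqA, hq.1.1, hqQ, hT, ?_, ?_⟩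
  · rw [hT]; exact hg₁' q hqQ hq.2.1
  · rw [hT]; exact hg₂' q hqQ hq.2.2

theorem exists_generic_point' {A : Set (σ → ℂ)} {Q : Ideal (MvPolynomial σ ℂ)}
    (hQ : Q ∈ (vanishingIdeal ℂ A).minimalPrimes) {u : MvPolynomial σ ℂ} (hu : u ∉ Q) :
    ∃ q ∈ A, eval q u ≠ 0 ∧ q ∈ zeroLocus ℂ Q ∧
      tangentSpace A q = tangentSpace (zeroLocus ℂ Q) q ∧
      (Module.finrank ℂ (tangentSpace A q) : WithBot ℕ∞) = ringKrullDim (MvPolynomial σ ℂ ⧸ Q) := by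
  have hQp : Q.IsPrime := hQ.1.1
  obtain ⟨q, h1, h2, h3, h4, h5, -⟩ := exists_generic_point (κ := Empty) hQ
    (f := fun e => e.elim) (algebraicIndependent_empty_type_iff.2
      (algebraMap ℂ _).injective) hu
  exact ⟨q, h1, h2, h3, h4, h5⟩

/-- A dominant polynomial map is generically submersive. -/
theorem exists_submersive_point {A : Set (σ → ℂ)} {f : κ → MvPolynomial σ ℂ}
    (h : ¬ Thin (evalMap f '' A)) :
    ∃ Q ∈ (vanishingIdeal ℂ A).minimalPrimes, ∃ q ∈ A,
      (Module.finrank ℂ (tangentSpace A q) : WithBot ℕ∞) = ringKrullDim (MvPolynomial σ ℂ ⧸ Q) ∧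
      ∀ w : κ → ℂ, ∃ v ∈ tangentSpace A q, dmap f q v = w := by
  obtain ⟨Q, hQ, hf⟩ := exists_algebraicIndependent_of_not_thin h
  obtain ⟨q, hq, -, -, -, h5, h6⟩ := exists_generic_point hQ hf
    (u := 1) (fun h1 => hQ.1.1.ne_top ((Ideal.eq_top_iff_one _).2 h1))
  exact ⟨Q, hQ, q, hq, h5, h6⟩

/-- An algebraic version of Sard's theorem: the image of the critical points is thin. -/
theorem thin_image_of_critical {A : Set (σ → ℂ)} {f : κ → MvPolynomial σ ℂ}
    (h : ∀ q ∈ A, ∃ w : κ → ℂ, ∀ v ∈ tangentSpace A q, dmap f q v ≠ w) :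
    Thin (evalMap f '' A) := by
  by_contra hno
  obtain ⟨Q, -, q, hq, -, hw⟩ := exists_submersive_point hno
  obtain ⟨w, hw'⟩ := h q hq
  obtain ⟨v, hv, hvw⟩ := hw w
  exact hw' v hv hvw

end Generic

end AffinePolar

namespace AffinePolar

open MvPolynomial

/-! ### Polynomial frames adapted to a tangent space. -/

section Frame

variable {σ α β : Type} [Fintype σ] [Fintype α] [Fintype β] [DecidableEq α] [DecidableEq β]

/-- The Jacobian matrix of a system of polynomials, with columns indexed through `e`. -/
noncomputable def jacMatrix (e : α ⊕ β ≃ σ) (G : α ⊕ β → MvPolynomial σ ℂ) :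
    Matrix (α ⊕ β) (α ⊕ β) (MvPolynomial σ ℂ) :=
  Matrix.of fun a b => pderiv (e b) (G a)

/-- The Jacobian determinant. -/
noncomputable def jacDet (e : α ⊕ β ≃ σ) (G : α ⊕ β → MvPolynomial σ ℂ) : MvPolynomial σ ℂ :=
  (jacMatrix e G).det

/-- Polynomial vector fields annihilating `G (inl j)` for all `j`. -/
noncomputable def frameField (e : α ⊕ β ≃ σ) (G : α ⊕ β → MvPolynomial σ ℂ) (i : β) (l : σ) :
    MvPolynomial σ ℂ :=
  (jacMatrix e G).adjugate (e.symm l) (Sum.inr i)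

/-- This is J · adj J = det J · 1. The adjugate keeps the dual vector fields polynomial, at the cost
of the factor det J. -/
theorem sum_pderiv_mul_frameField (e : α ⊕ β ≃ σ) (G : α ⊕ β → MvPolynomial σ ℂ) (a : α ⊕ β)
    (i : β) : ∑ l, pderiv l (G a) * frameField e G i l =
      if a = Sum.inr i then jacDet e G else 0 := by
  have h := congrFun (congrFun (Matrix.mul_adjugate (jacMatrix e G)) a) (Sum.inr i)
  rw [Matrix.mul_apply, Matrix.smul_apply, Matrix.one_apply] at h
  rw [← Equiv.sum_comp e]
  simp only [frameField, Equiv.symm_apply_apply]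
  refine Eq.trans ?_ (h.trans ?_)
  · rfl
  · rw [smul_eq_mul, mul_ite, mul_one, mul_zero]
    rfl

theorem dpoly_frameField (e : α ⊕ β ≃ σ) (G : α ⊕ β → MvPolynomial σ ℂ) (a : α ⊕ β)
    (i : β) (y : σ → ℂ) : dpoly (G a) y (evalMap (frameField e G i) y) =
      if a = Sum.inr i then eval y (jacDet e G) else 0 := by
  have h := congrArg (eval y) (sum_pderiv_mul_frameField e G a i)
  rw [dpoly_apply]
  simp only [map_sum, map_mul] at h
  rw [show (∑ l, eval y (pderiv l (G a)) * evalMap (frameField e G i) y l) = _ from h]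
  split_ifs <;> simp

theorem mulVec_jacMatrix (e : α ⊕ β ≃ σ) (G : α ⊕ β → MvPolynomial σ ℂ) (y v : σ → ℂ) :
    dmap G y v = ((jacMatrix e G).map (eval y)).mulVec (v ∘ e) := by
  ext a
  rw [dmap_apply, dpoly_apply, ← Equiv.sum_comp e]
  rfl

theorem det_map_jacMatrix (e : α ⊕ β ≃ σ) (G : α ⊕ β → MvPolynomial σ ℂ) (y : σ → ℂ) :
    ((jacMatrix e G).map (eval y)).det = eval y (jacDet e G) := by
  rw [jacDet, RingHom.map_det]
  rfl

theorem eval_jacDet_ne_zero_iff (e : α ⊕ β ≃ σ) (G : α ⊕ β → MvPolynomial σ ℂ) (y : σ → ℂ) :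
    eval y (jacDet e G) ≠ 0 ↔ Function.Injective (dmap G y) := by
  rw [← det_map_jacMatrix, ← isUnit_iff_ne_zero, ← Matrix.isUnit_iff_isUnit_det,
    ← Matrix.mulVec_injective_iff_isUnit]
  constructor
  · intro h v w hvw
    rw [mulVec_jacMatrix e, mulVec_jacMatrix e] at hvw
    have := h hvw
    ext l
    simpa using congrFun this (e.symm l)
  · intro h v w hvw
    have := @h (v ∘ e.symm) (w ∘ e.symm) (by
      rw [mulVec_jacMatrix e, mulVec_jacMatrix e]
      simpa [Function.comp_assoc] using hvw)
    ext a
    simpa using congrFun this (e a)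

theorem bijective_dmap (e : α ⊕ β ≃ σ) {G : α ⊕ β → MvPolynomial σ ℂ} {y : σ → ℂ}
    (hy : eval y (jacDet e G) ≠ 0) : Function.Bijective (dmap G y) := by
  have hinj := (eval_jacDet_ne_zero_iff e G y).1 hy
  refine ⟨hinj, ?_⟩
  have hcard : Module.finrank ℂ (σ → ℂ) = Module.finrank ℂ (α ⊕ β → ℂ) := by
    rw [Module.finrank_fintype_fun_eq_card, Module.finrank_fintype_fun_eq_card,
      Fintype.card_congr e]
  exact (LinearMap.injective_iff_surjective_of_finrank_eq_finrank hcard).1 hinj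

/-- The kernel of the differentials of the equations `G (inl j)`. -/
noncomputable def frameKer (G : α ⊕ β → MvPolynomial σ ℂ) (y : σ → ℂ) : Submodule ℂ (σ → ℂ) :=
  LinearMap.ker (dmap (G ∘ Sum.inl) y)

theorem mem_frameKer {G : α ⊕ β → MvPolynomial σ ℂ} {y v : σ → ℂ} :
    v ∈ frameKer G y ↔ ∀ j, dpoly (G (Sum.inl j)) y v = 0 := by
  rw [frameKer, LinearMap.mem_ker, funext_iff]
  rfl

theorem frameField_mem_frameKer (e : α ⊕ β ≃ σ) (G : α ⊕ β → MvPolynomial σ ℂ) (i : β)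
    (y : σ → ℂ) : evalMap (frameField e G i) y ∈ frameKer G y := by
  rw [mem_frameKer]
  intro j
  rw [dpoly_frameField, if_neg (by simp)]

/-- Both sides have the same image under the injective differential of `G`. -/
theorem eq_sum_frameField (e : α ⊕ β ≃ σ) {G : α ⊕ β → MvPolynomial σ ℂ} {y : σ → ℂ}
    (hy : eval y (jacDet e G) ≠ 0) {v : σ → ℂ} (hv : v ∈ frameKer G y) :
    v = ∑ i, (dpoly (G (Sum.inr i)) y v / eval y (jacDet e G)) • evalMap (frameField e G i) y := by
  apply (bijective_dmap e hy).1
  ext a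
  rw [dmap_apply, dmap_apply, map_sum]
  simp only [map_smul, dpoly_frameField, smul_eq_mul]
  rcases a with j | i
  · rw [mem_frameKer.1 hv j]
    simp
  · simp only [Sum.inr.injEq, mul_ite, mul_zero]
    rw [Finset.sum_ite_eq, if_pos (Finset.mem_univ _), div_mul_cancel₀ _ hy]

theorem finrank_frameKer (e : α ⊕ β ≃ σ) {G : α ⊕ β → MvPolynomial σ ℂ} {y : σ → ℂ}
    (hy : eval y (jacDet e G) ≠ 0) : Module.finrank ℂ (frameKer G y) = Fintype.card β := by
  let φ : frameKer G y →ₗ[ℂ] (β → ℂ) := (dmap (G ∘ Sum.inr) y).domRestrict _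
  have hφ : Function.Bijective φ := by
    constructor
    · rw [injective_iff_map_eq_zero]
      rintro ⟨v, hv⟩ h0
      have h0' : dmap (G ∘ Sum.inr) y v = 0 := h0
      rw [Subtype.ext_iff]
      apply (bijective_dmap e hy).1
      ext a
      rcases a with j | i
      · simpa using mem_frameKer.1 hv j
      · simpa using congrFun h0' i
    · intro w
      obtain ⟨v, hv⟩ := (bijective_dmap e hy).2 (Sum.elim 0 w)
      refine ⟨⟨v, mem_frameKer.2 fun j => congrFun hv (Sum.inl j)⟩, ?_⟩
      ext i
      exact congrFun hv (Sum.inr i)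
  rw [(LinearEquiv.ofBijective φ hφ).finrank_eq]
  simp

theorem span_frameField (e : α ⊕ β ≃ σ) {G : α ⊕ β → MvPolynomial σ ℂ} {y : σ → ℂ}
    (hy : eval y (jacDet e G) ≠ 0) :
    Submodule.span ℂ (Set.range fun i => evalMap (frameField e G i) y) = frameKer G y := by
  apply le_antisymm
  · rw [Submodule.span_le]
    rintro _ ⟨i, rfl⟩
    exact frameField_mem_frameKer e G i y
  · intro v hv
    rw [eq_sum_frameField e hy hv]
    exact Submodule.sum_mem _ fun i _ =>
      Submodule.smul_mem _ _ (Submodule.subset_span ⟨i, rfl⟩)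

theorem tangentSpace_le_frameKer {A : Set (σ → ℂ)} {G : α ⊕ β → MvPolynomial σ ℂ}
    (hG : ∀ j, G (Sum.inl j) ∈ vanishingIdeal ℂ A) (y : σ → ℂ) :
    tangentSpace A y ≤ frameKer G y := fun _ hv =>
  mem_frameKer.2 fun j => mem_tangentSpace.1 hv _ (hG j)

omit [DecidableEq α] [DecidableEq β] [Fintype α] [Fintype β] in
/-- At every point there is a frame adapted to the Zariski tangent space. -/
theorem exists_frame (A : Set (σ → ℂ)) (x : σ → ℂ) {n : ℕ}
    (hn : Module.finrank ℂ (tangentSpace A x) = n) :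
    ∃ (r : ℕ) (e : Fin r ⊕ Fin n ≃ σ) (G : Fin r ⊕ Fin n → MvPolynomial σ ℂ),
      (∀ j, G (Sum.inl j) ∈ vanishingIdeal ℂ A) ∧ (∀ i, eval x (G (Sum.inr i)) = 0) ∧
      eval x (jacDet e G) ≠ 0 := by
  classical
  let D : MvPolynomial σ ℂ →ₗ[ℂ] Module.Dual ℂ (σ → ℂ) :=
    { toFun := fun p => dpoly p x
      map_add' := fun p q => LinearMap.ext fun v => dpoly_add p q x v
      map_smul' := fun c p => LinearMap.ext fun v => by
        rw [MvPolynomial.smul_eq_C_mul, dpoly_C_mul]; rfl }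
  -- `W` consists of the differentials at `x` of the equations of `A`; its annihilator is the
  -- tangent space. A basis of `W` is lifted to equations, and a basis of a complement to affine
  -- linear functions vanishing at `x`.
  let W : Submodule ℂ (Module.Dual ℂ (σ → ℂ)) :=
    ((vanishingIdeal ℂ A).restrictScalars ℂ).map D
  have hWT : W.dualCoannihilator = tangentSpace A x := by
    ext v
    rw [Submodule.mem_dualCoannihilator, mem_tangentSpace]
    constructor
    · intro h p hp
      exact h _ ⟨p, hp, rfl⟩
    · rintro h _ ⟨p, hp, rfl⟩
      exact h p hp
  obtain ⟨W', hW'⟩ := Submodule.exists_isCompl W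
  have hrank : Module.finrank ℂ W + n = Fintype.card σ := by
    have h1 := Subspace.finrank_add_finrank_dualCoannihilator_eq W
    rw [hWT, hn, Module.finrank_fintype_fun_eq_card] at h1
    exact h1
  have hrank' : Module.finrank ℂ W' = n := by
    have h1 := Submodule.finrank_add_eq_of_isCompl hW'
    rw [Subspace.dual_finrank_eq, Module.finrank_fintype_fun_eq_card] at h1
    omega
  let b := Module.finBasis ℂ W
  let b' := Module.finBasisOfFinrankEq ℂ W' hrank'
  have hb : ∀ j, ∃ p ∈ vanishingIdeal ℂ A, D p = (b j : Module.Dual ℂ (σ → ℂ)) := fun j => (b j).2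
  choose g hgA hgb using hb
  let ℓ : Fin n → MvPolynomial σ ℂ := fun i =>
    ∑ l, C ((b' i : Module.Dual ℂ (σ → ℂ)) (Pi.single l 1)) * (X l - C (x l))
  have hℓ : ∀ i v, dpoly (ℓ i) x v = (b' i : Module.Dual ℂ (σ → ℂ)) v := by
    intro i v
    simp only [ℓ, dpoly_sum, dpoly_C_mul, dpoly_sub, dpoly_X, dpoly_C, sub_zero]
    conv_rhs => rw [← Finset.univ_sum_single v, map_sum]
    refine Finset.sum_congr rfl fun l _ => ?_
    rw [show (Pi.single l (v l) : σ → ℂ) = v l • Pi.single l 1 by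
      rw [← Pi.single_smul, smul_eq_mul, mul_one], map_smul, smul_eq_mul, mul_comm]
  let e : Fin (Module.finrank ℂ W) ⊕ Fin n ≃ σ := Fintype.equivOfCardEq (by simp [hrank])
  refine ⟨Module.finrank ℂ W, e, Sum.elim g ℓ, hgA, fun i => ?_, ?_⟩
  · simp [ℓ]
  · rw [eval_jacDet_ne_zero_iff, injective_iff_map_eq_zero]
    intro v hv
    rw [← Module.forall_dual_apply_eq_zero_iff ℂ]
    intro φ
    have hW0 : ∀ φ ∈ W, φ v = 0 := by
      intro φ hφ
      have : (⟨φ, hφ⟩ : W) ∈ Submodule.span ℂ (Set.range b) := by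
        rw [b.span_eq]; trivial
      have h2 : ∀ ψ : W, (ψ : Module.Dual ℂ (σ → ℂ)) v = 0 := by
        intro ψ
        rw [← b.sum_repr ψ]
        simp only [AddSubmonoidClass.coe_finset_sum, LinearMap.coe_sum, Finset.sum_apply,
          Submodule.coe_smul, LinearMap.smul_apply]
        refine Finset.sum_eq_zero fun j _ => ?_
        have := congrFun hv (Sum.inl j)
        rw [← hgb j]
        have h3 : dpoly (g j) x v = 0 := this
        change _ • dpoly (g j) x v = 0
        rw [h3, smul_zero]
      exact h2 ⟨φ, hφ⟩
    have hW'0 : ∀ φ ∈ W', φ v = 0 := by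
      intro φ hφ
      have h2 : ∀ ψ : W', (ψ : Module.Dual ℂ (σ → ℂ)) v = 0 := by
        intro ψ
        rw [← b'.sum_repr ψ]
        simp only [AddSubmonoidClass.coe_finset_sum, LinearMap.coe_sum, Finset.sum_apply,
          Submodule.coe_smul, LinearMap.smul_apply]
        refine Finset.sum_eq_zero fun j _ => ?_
        have h3 : dpoly (ℓ j) x v = 0 := congrFun hv (Sum.inr j)
        rw [← hℓ, h3, smul_zero]
      exact h2 ⟨φ, hφ⟩
    have hmem : φ ∈ W ⊔ W' := by rw [hW'.sup_eq_top]; trivial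
    obtain ⟨a, ha, c, hc, rfl⟩ := Submodule.mem_sup.1 hmem
    rw [LinearMap.add_apply, hW0 a ha, hW'0 c hc, add_zero]

theorem exists_minimalPrimes_le_of_mem {A : Set (σ → ℂ)} {x : σ → ℂ} (hx : x ∈ A) :
    ∃ P ∈ (vanishingIdeal ℂ A).minimalPrimes, x ∈ zeroLocus ℂ P := by
  have hle : vanishingIdeal ℂ A ≤ vanishingIdeal ℂ {x} :=
    vanishingIdeal_anti_mono (Set.singleton_subset_iff.2 hx)
  obtain ⟨P, hP, hPx⟩ := Ideal.exists_minimalPrimes_le hle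
  exact ⟨P, hP, mem_zeroLocus'.2 fun p hp => mem_vanishingIdeal'.1 (hPx hp) x rfl⟩

/-- Semicontinuity: a frame at `x` remains one at a generic point of a component through `x`. There
the tangent space has dimension `n` and lies in a frame kernel of the dimension of the tangent space
at `x`. -/
theorem le_finrank_tangentSpace {A : Set (σ → ℂ)} {n : ℕ} (hA : IsPureDim A n) {x : σ → ℂ}
    (hx : x ∈ A) : n ≤ Module.finrank ℂ (tangentSpace A x) := by
  obtain ⟨r, e, G, hGA, -, hdet⟩ := exists_frame A x rfl
  obtain ⟨P, hP, hxP⟩ := exists_minimalPrimes_le_of_mem hx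
  have hdP : jacDet e G ∉ P := fun h => hdet (mem_zeroLocus'.1 hxP _ h)
  obtain ⟨q, -, hq, -, -, hfin⟩ := exists_generic_point' hP hdP
  rw [hA P hP, Nat.cast_inj] at hfin
  rw [← hfin]
  refine (Submodule.finrank_mono (tangentSpace_le_frameKer hGA q)).trans ?_
  rw [finrank_frameKer e hq, Fintype.card_fin]

/-- Near a regular point the tangent spaces are the kernels of the frame equations. -/
theorem tangentSpace_eq_frameKer {A : Set (σ → ℂ)} {n r : ℕ} (hA : IsPureDim A n)
    {e : Fin r ⊕ Fin n ≃ σ} {G : Fin r ⊕ Fin n → MvPolynomial σ ℂ}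
    (hG : ∀ j, G (Sum.inl j) ∈ vanishingIdeal ℂ A) {y : σ → ℂ} (hy : y ∈ A)
    (hdet : eval y (jacDet e G) ≠ 0) : tangentSpace A y = frameKer G y := by
  refine Submodule.eq_of_le_of_finrank_le (tangentSpace_le_frameKer hG y) ?_
  rw [finrank_frameKer e hdet, Fintype.card_fin]
  exact le_finrank_tangentSpace hA hy

end Frame

end AffinePolar

namespace AffinePolar

open MvPolynomial

/-! ### Local holomorphic parametrizations. -/

section Parametrization

variable {σ : Type} [Fintype σ]

theorem analyticAt_eval (p : MvPolynomial σ ℂ) (x : σ → ℂ) :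
    AnalyticAt ℂ (fun y : σ → ℂ => eval y p) x :=
  AnalyticOnNhd.eval_mvPolynomial p x (Set.mem_univ _)

theorem hasFDerivAt_eval (p : MvPolynomial σ ℂ) (x : σ → ℂ) :
    HasFDerivAt (fun y : σ → ℂ => eval y p) (LinearMap.toContinuousLinearMap (dpoly p x)) x := by
  induction p using MvPolynomial.induction_on with
  | C a =>
    simp only [eval_C]
    refine (hasFDerivAt_const a x).congr_fderiv (ContinuousLinearMap.ext fun v => ?_)
    exact (dpoly_C a x v).symm
  | add p q hp hq =>
    simp only [eval_add]
    refine (hp.add hq).congr_fderiv (ContinuousLinearMap.ext fun v => ?_)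
    exact (dpoly_add p q x v).symm
  | mul_X p i hp =>
    simp only [eval_mul, eval_X]
    refine (hp.mul (hasFDerivAt_apply i x)).congr_fderiv (ContinuousLinearMap.ext fun v => ?_)
    refine Eq.trans ?_ (dpoly_mul p (X i) x v).symm
    rw [dpoly_X, eval_X]
    rfl

theorem hasFDerivAt_eval_comp {E : Type*} [NormedAddCommGroup E] [NormedSpace ℂ E]
    (p : MvPolynomial σ ℂ) {φ : E → σ → ℂ} {u : E} (hφ : DifferentiableAt ℂ φ u) :
    HasFDerivAt (fun u => eval (φ u) p)
      ((LinearMap.toContinuousLinearMap (dpoly p (φ u))).comp (fderiv ℂ φ u)) u :=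
  (hasFDerivAt_eval p (φ u)).comp u hφ.hasFDerivAt

variable {α β : Type} [Fintype α] [Fintype β] [DecidableEq α] [DecidableEq β]

/-- The inverse function theorem for the map `G`, with the inverse restricted to the subspace where
the first group of coordinates is zero. The equality of filters says that `φ` sweeps out a full
neighbourhood of `x` in the zero set. -/
theorem exists_param (e : α ⊕ β ≃ σ) {G : α ⊕ β → MvPolynomial σ ℂ} {x : σ → ℂ}
    (h0 : ∀ a, eval x (G a) = 0) (hdet : eval x (jacDet e G) ≠ 0) :
    ∃ φ : (β → ℂ) → (σ → ℂ), AnalyticAt ℂ φ 0 ∧ φ 0 = x ∧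
      (∀ᶠ u in 𝓝 0, ∀ a, eval (φ u) (G a) = (Sum.elim 0 u : α ⊕ β → ℂ) a) ∧
      Filter.map φ (𝓝 0) = 𝓝[{y | ∀ j, eval y (G (Sum.inl j)) = 0}] x := by
  have hx0 : evalMap G x = 0 := funext h0
  let L : (σ → ℂ) ≃L[ℂ] (α ⊕ β → ℂ) :=
    (LinearEquiv.ofBijective (dmap G x) (bijective_dmap e hdet)).toContinuousLinearEquiv
  have hd : HasFDerivAt (evalMap G) (L : (σ → ℂ) →L[ℂ] (α ⊕ β → ℂ)) x := by
    rw [hasFDerivAt_pi']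
    intro a
    exact hasFDerivAt_eval (G a) x
  have hc : ContDiffAt ℂ ⊤ (evalMap G) x := by
    rw [contDiffAt_pi]
    intro a
    exact (analyticAt_eval (G a) x).contDiffAt
  have hne : (⊤ : WithTop ℕ∞) ≠ 0 := by simp
  let Ψ := hc.toOpenPartialHomeomorph _ hd hne
  have hxs : x ∈ Ψ.source := hc.mem_toOpenPartialHomeomorph_source hd hne
  have hΨ : ∀ y, Ψ y = evalMap G y := fun y => rfl
  have h0t : (0 : α ⊕ β → ℂ) ∈ Ψ.target := by
    rw [← hx0]; exact Ψ.map_source hxs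
  have hs0 : Ψ.symm 0 = x := by
    rw [← hx0]; exact Ψ.left_inv hxs
  have hsymm : ContDiffAt ℂ ⊤ Ψ.symm 0 := by
    have := hc.to_localInverse hd hne
    rw [hx0] at this
    exact this
  let ι : (β → ℂ) → (α ⊕ β → ℂ) := fun u => Sum.elim 0 u
  have hι : IsInducing ι := by
    refine Topology.IsInducing.of_comp (f := ι) (g := fun w : α ⊕ β → ℂ => w ∘ Sum.inr) ?_ ?_ ?_
    · refine continuous_pi fun a => ?_
      rcases a with j | i
      · exact continuous_const
      · exact continuous_apply i
    · fun_prop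
    · exact IsInducing.id
  have hι0 : ι 0 = 0 := by
    ext a; rcases a with j | i <;> rfl
  have hιa : AnalyticAt ℂ ι 0 := by
    rw [analyticAt_pi_iff]
    intro a
    rcases a with j | i
    · exact analyticAt_const
    · exact (ContinuousLinearMap.proj (R := ℂ) (φ := fun _ : β => ℂ) i).analyticAt 0
  refine ⟨Ψ.symm ∘ ι, ?_, ?_, ?_, ?_⟩
  · refine AnalyticAt.comp ?_ hιa
    rw [hι0]
    exact hsymm.analyticAt
  · simp [hι0, hs0]
  · have : ∀ᶠ u in 𝓝 (0 : β → ℂ), ι u ∈ Ψ.target := by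
      apply hι.continuous.continuousAt.eventually
      rw [hι0]
      exact Ψ.open_target.mem_nhds h0t
    filter_upwards [this] with u hu a
    exact congrFun (Ψ.right_inv hu) a
  · rw [← Filter.map_map, hι.map_nhds_eq, hι0]
    have := Ψ.symm.map_nhdsWithin_preimage_eq (x := 0) h0t
      {y | ∀ j, eval y (G (Sum.inl j)) = 0}
    rw [hs0] at this
    rw [← this]
    congr 1
    -- Inside the target, the range of `ι` is exactly the set of points whose preimages satisfy the
    -- equations.
    rw [← Ψ.symm.nhdsWithin_source_inter h0t (Set.range ι),
      ← Ψ.symm.nhdsWithin_source_inter h0t (Ψ.symm ⁻¹' _)]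
    congr 1
    ext w
    simp only [Set.mem_inter_iff, and_congr_right_iff]
    intro hw
    have hr : evalMap G (Ψ.symm w) = w := Ψ.right_inv hw
    constructor
    · rintro ⟨u, rfl⟩ j
      exact congrFun hr (Sum.inl j)
    · intro h
      refine ⟨w ∘ Sum.inr, ?_⟩
      ext a
      rcases a with j | i
      · have := h j
        change _ = 0 at this
        change (0 : ℂ) = _
        rw [← this]
        exact congrFun hr (Sum.inl j)
      · rfl

/-- The derivative of a parametrization, in the coordinates of the frame. -/
theorem dmap_fderiv_param {G : α ⊕ β → MvPolynomial σ ℂ} {φ : (β → ℂ) → (σ → ℂ)}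
    {u : β → ℂ} (hφ : DifferentiableAt ℂ φ u)
    (h : ∀ᶠ u in 𝓝 u, ∀ a, eval (φ u) (G a) = (Sum.elim 0 u : α ⊕ β → ℂ) a) (v : β → ℂ) :
    dmap G (φ u) (fderiv ℂ φ u v) = (Sum.elim 0 v : α ⊕ β → ℂ) := by
  ext a
  have h1 := hasFDerivAt_eval_comp (G a) hφ
  rcases a with j | i
  · have h2 : HasFDerivAt (fun u => eval (φ u) (G (Sum.inl j)))
        (0 : (β → ℂ) →L[ℂ] ℂ) u :=
      (hasFDerivAt_const (0 : ℂ) u).congr_of_eventuallyEq (h.mono fun u hu => hu (Sum.inl j))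
    exact congrArg (fun L : (β → ℂ) →L[ℂ] ℂ => L v) (h1.unique h2)
  · have h2 : HasFDerivAt (fun u => eval (φ u) (G (Sum.inr i)))
        (ContinuousLinearMap.proj i : (β → ℂ) →L[ℂ] ℂ) u :=
      (hasFDerivAt_apply i u).congr_of_eventuallyEq (h.mono fun u hu => hu (Sum.inr i))
    exact congrArg (fun L : (β → ℂ) →L[ℂ] ℂ => L v) (h1.unique h2)

theorem injective_fderiv_param {G : α ⊕ β → MvPolynomial σ ℂ} {φ : (β → ℂ) → (σ → ℂ)}
    {u : β → ℂ} (hφ : DifferentiableAt ℂ φ u)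
    (h : ∀ᶠ u in 𝓝 u, ∀ a, eval (φ u) (G a) = (Sum.elim 0 u : α ⊕ β → ℂ) a) :
    Function.Injective (fderiv ℂ φ u) := by
  intro v w hvw
  have h1 := dmap_fderiv_param hφ h v
  rw [hvw, dmap_fderiv_param hφ h w] at h1
  ext i
  exact (congrFun h1 (Sum.inr i)).symm

theorem range_fderiv_param (e : α ⊕ β ≃ σ) {G : α ⊕ β → MvPolynomial σ ℂ}
    {φ : (β → ℂ) → (σ → ℂ)} {u : β → ℂ} (hφ : DifferentiableAt ℂ φ u)
    (h : ∀ᶠ u in 𝓝 u, ∀ a, eval (φ u) (G a) = (Sum.elim 0 u : α ⊕ β → ℂ) a)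
    (hdet : eval (φ u) (jacDet e G) ≠ 0) :
    LinearMap.range (fderiv ℂ φ u : (β → ℂ) →ₗ[ℂ] (σ → ℂ)) = frameKer G (φ u) := by
  apply le_antisymm
  · rintro _ ⟨v, rfl⟩
    rw [mem_frameKer]
    intro j
    exact congrFun (dmap_fderiv_param hφ h v) (Sum.inl j)
  · intro w hw
    refine ⟨dmap (G ∘ Sum.inr) (φ u) w, ?_⟩
    apply (bijective_dmap e hdet).1
    refine (dmap_fderiv_param hφ h _).trans ?_
    ext a
    rcases a with j | i
    · exact (mem_frameKer.1 hw j).symm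
    · rfl

end Parametrization

end AffinePolar

namespace AffinePolar

open MvPolynomial

/-! ### Frame equations define a pure-dimensional set locally. -/

section Germ

variable {σ β : Type} [Fintype σ] [Fintype β]

/-- A product of germs of analytic functions vanishes only if one of the factors does. -/
theorem eventually_eq_zero_of_mul {E : Type*} [NormedAddCommGroup E] [NormedSpace ℂ E]
    {f g : E → ℂ} {x : E} (hf : AnalyticAt ℂ f x) (hg : AnalyticAt ℂ g x)
    (h : ∀ᶠ u in 𝓝 x, f u * g u = 0) : (∀ᶠ u in 𝓝 x, f u = 0) ∨ ∀ᶠ u in 𝓝 x, g u = 0 := by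
  rw [or_iff_not_imp_left]
  intro hnf
  obtain ⟨ε, hε, hball⟩ := Metric.eventually_nhds_iff_ball.1
    (h.and (hf.eventually_analyticAt.and hg.eventually_analyticAt))
  have hfr : ∃ᶠ u in 𝓝 x, f u ≠ 0 := not_eventually.1 hnf
  obtain ⟨z, hz, hzB⟩ := (hfr.and_eventually (Metric.ball_mem_nhds x hε)).exists
  -- Near a point `z` of the ball with `f z ≠ 0` the factor `g` is zero, and the identity theorem
  -- spreads this over the ball.
  have hgB : AnalyticOnNhd ℂ g (Metric.ball x ε) := fun y hy => (hball y hy).2.2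
  have hz0 : g =ᶠ[𝓝 z] 0 := by
    filter_upwards [(hball z hzB).2.1.continuousAt.eventually_ne hz,
      Metric.isOpen_ball.mem_nhds hzB] with y hy hyB
    exact (mul_eq_zero.1 (hball y hyB).1).resolve_left hy
  have := hgB.eqOn_zero_of_preconnected_of_eventuallyEq_zero
    (convex_ball x ε).isPreconnected hzB hz0
  filter_upwards [Metric.ball_mem_nhds x hε] with y hy using this hy

/-- The polynomials vanishing along the germ of a parametrization. -/
noncomputable def germIdeal (φ : (β → ℂ) → (σ → ℂ)) : Ideal (MvPolynomial σ ℂ) where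
  carrier := {p | ∀ᶠ u in 𝓝 0, eval (φ u) p = 0}
  zero_mem' := by simp
  add_mem' := by
    intro p q hp hq
    filter_upwards [hp, hq] with u h1 h2
    rw [eval_add, h1, h2, add_zero]
  smul_mem' := by
    intro c p hp
    filter_upwards [hp] with u h1
    rw [smul_eq_mul, eval_mul, h1, mul_zero]

theorem mem_germIdeal {φ : (β → ℂ) → (σ → ℂ)} {p : MvPolynomial σ ℂ} :
    p ∈ germIdeal φ ↔ ∀ᶠ u in 𝓝 0, eval (φ u) p = 0 := Iff.rfl

theorem analyticAt_eval_comp {φ : (β → ℂ) → (σ → ℂ)} {u : β → ℂ} (hφ : AnalyticAt ℂ φ u)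
    (p : MvPolynomial σ ℂ) : AnalyticAt ℂ (fun u => eval (φ u) p) u :=
  (analyticAt_eval p (φ u)).comp hφ

theorem isPrime_germIdeal {φ : (β → ℂ) → (σ → ℂ)} (hφ : AnalyticAt ℂ φ 0) :
    (germIdeal φ).IsPrime := by
  refine ⟨fun h => ?_, fun {p q} h => ?_⟩
  · rw [Ideal.eq_top_iff_one, mem_germIdeal] at h
    simpa using h.self_of_nhds
  · refine eventually_eq_zero_of_mul (analyticAt_eval_comp hφ p) (analyticAt_eval_comp hφ q) ?_
    filter_upwards [mem_germIdeal.1 h] with u hu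
    rw [← eval_mul, hu]

theorem sub_taylor_mem (x : σ → ℂ) (r : MvPolynomial σ ℂ) :
    r - (C (eval x r) + ∑ l, C (eval x (pderiv l r)) * (X l - C (x l))) ∈
      (vanishingIdeal ℂ {x}) ^ 2 := by
  classical
  have hX : ∀ l, (X l - C (x l) : MvPolynomial σ ℂ) ∈ vanishingIdeal ℂ {x} := by
    intro l
    rw [mem_vanishingIdeal']
    rintro _ rfl
    simp
  induction r using MvPolynomial.induction_on with
  | C a => simp
  | add p q hp hq =>
    convert add_mem hp hq using 1
    simp only [map_add, add_mul, Finset.sum_add_distrib]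
    ring
  | mul_X p i hp =>
    have h1 := Ideal.mul_mem_right (X i) _ hp
    have h2 : (∑ l, C (eval x (pderiv l p)) * (X l - C (x l))) * (X i - C (x i)) ∈
        (vanishingIdeal ℂ {x}) ^ 2 := by
      rw [pow_two]
      exact Ideal.mul_mem_mul (Ideal.sum_mem _ fun l _ => Ideal.mul_mem_left _ _ (hX l)) (hX i)
    convert add_mem h1 h2 using 1
    have h3 : ∀ l, eval x (pderiv l (p * X i)) =
        eval x (pderiv l p) * x i + if i = l then eval x p else 0 := by
      intro l
      rw [Derivation.leibniz, pderiv_X]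
      simp only [smul_eq_mul, map_add, map_mul, eval_X, Pi.single_apply]
      split_ifs <;> simp <;> ring
    simp only [h3, map_add, add_mul, Finset.sum_add_distrib, eval_X, map_mul]
    have h4 : ∑ l, C (if i = l then eval x p else 0) * (X l - C (x l)) =
        C (eval x p) * (X i - C (x i)) := by
      rw [Finset.sum_eq_single i]
      · simp
      · intro l _ hl; simp [hl.symm]
      · simp
    have h5 : ∑ l, C (eval x (pderiv l p)) * C (x i) * (X l - C (x l)) =
        C (x i) * ∑ l, C (eval x (pderiv l p)) * (X l - C (x l)) := by
      rw [Finset.mul_sum]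
      exact Finset.sum_congr rfl fun l _ => by ring
    rw [h4, h5]
    ring

theorem mem_vanishingIdeal_sq {x : σ → ℂ} {r : MvPolynomial σ ℂ} (h0 : eval x r = 0)
    (h1 : dpoly r x = 0) : r ∈ (vanishingIdeal ℂ {x}) ^ 2 := by
  classical
  have h2 : ∀ l, eval x (pderiv l r) = 0 := by
    intro l
    have := congrArg (fun L : (σ → ℂ) →ₗ[ℂ] ℂ => L (Pi.single l 1)) h1
    simpa [dpoly_apply, Pi.single_apply] using this
  have := sub_taylor_mem x r
  simpa [h0, h2] using this

theorem isBigO_of_mem_vanishingIdeal_pow {x : σ → ℂ} (k : ℕ) {p : MvPolynomial σ ℂ}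
    (hp : p ∈ (vanishingIdeal ℂ {x}) ^ k) :
    (fun y => eval y p) =O[𝓝 x] fun y => ‖y - x‖ ^ k := by
  induction k generalizing p with
  | zero =>
    simp only [pow_zero]
    exact ((analyticAt_eval p x).continuousAt.tendsto).isBigO_one ℝ
  | succ k ih =>
    rw [pow_succ] at hp
    refine Submodule.mul_induction_on hp ?_ ?_
    · intro a ha b hb
      have hb' : (fun y => eval y b) =O[𝓝 x] fun y => ‖y - x‖ := by
        have := (hasFDerivAt_eval b x).isBigO_sub
        rw [mem_vanishingIdeal'.1 hb x rfl] at this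
        simpa using this.norm_right
      simp only [eval_mul, pow_succ]
      exact (ih ha).mul hb'
    · intro a b ha hb
      simp only [eval_add]
      exact ha.add hb

theorem eval_smul_of_isHomogeneous {H : MvPolynomial β ℂ} {k : ℕ} (hH : H.IsHomogeneous k)
    (s : ℂ) (u : β → ℂ) : eval (s • u) H = s ^ k * eval u H := by
  rw [eval_eq', eval_eq', Finset.mul_sum]
  refine Finset.sum_congr rfl fun d hd => ?_
  have hdeg : ∑ i, d i = k := by
    rw [← hH (mem_support_iff.1 hd), Finsupp.weight_apply, Finsupp.sum_fintype _ _ (by simp)]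
    simp
  simp only [Pi.smul_apply, smul_eq_mul, mul_pow, Finset.prod_mul_distrib,
    Finset.prod_pow_eq_pow_sum, hdeg]
  ring

variable {α : Type} [Fintype α] [DecidableEq α] [DecidableEq β]

/-- The differentials of all the `G a` form a basis of the cotangent space at `x`. Modulo the
equations, the leading term of a function of order `k` is thus a form of degree `k` in the remaining
coordinates; products reduce this to degree one. -/
theorem exists_homogeneous_sub_mem (e : α ⊕ β ≃ σ) {G : α ⊕ β → MvPolynomial σ ℂ} {x : σ → ℂ}
    (h0 : ∀ a, eval x (G a) = 0) (hdet : eval x (jacDet e G) ≠ 0) (k : ℕ) {p : MvPolynomial σ ℂ}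
    (hp : p ∈ (vanishingIdeal ℂ {x}) ^ k) :
    ∃ H : MvPolynomial β ℂ, H.IsHomogeneous k ∧ p - bind₁ (G ∘ Sum.inr) H ∈
      Ideal.span (Set.range (G ∘ Sum.inl)) ⊔ (vanishingIdeal ℂ {x}) ^ (k + 1) := by
  set J := Ideal.span (Set.range (G ∘ Sum.inl)) with hJ
  set m := vanishingIdeal ℂ ({x} : Set (σ → ℂ)) with hm
  have hGm : ∀ a, G a ∈ m := fun a => mem_vanishingIdeal'.2 (by rintro _ rfl; exact h0 a)
  have base : ∀ b ∈ m, ∃ ℓ : MvPolynomial β ℂ, ℓ.IsHomogeneous 1 ∧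
      b - bind₁ (G ∘ Sum.inr) ℓ ∈ J ⊔ m ^ 2 ∧ bind₁ (G ∘ Sum.inr) ℓ ∈ m := by
    intro b hb
    let L : (σ → ℂ) ≃ₗ[ℂ] (α ⊕ β → ℂ) := LinearEquiv.ofBijective (dmap G x) (bijective_dmap e hdet)
    let c : α ⊕ β → ℂ := fun a => dpoly b x (L.symm (Pi.single a 1))
    have hc : ∀ v, dpoly b x v = ∑ a, c a * dpoly (G a) x v := by
      intro v
      have h1 : v = L.symm (∑ a, dmap G x v a • Pi.single a 1) := by
        rw [LinearEquiv.eq_symm_apply]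
        ext a
        simp [L, Finset.sum_apply, Pi.single_apply]
      conv_lhs => rw [h1]
      simp only [map_sum, map_smul, smul_eq_mul, dmap_apply, c]
      exact Finset.sum_congr rfl fun a _ => mul_comm _ _
    refine ⟨∑ i, C (c (Sum.inr i)) * X i, ?_, ?_, ?_⟩
    · exact IsHomogeneous.sum _ _ _ fun i _ => isHomogeneous_C_mul_X _ _
    · have h2 : b - ∑ a, C (c a) * G a ∈ m ^ 2 := by
        apply mem_vanishingIdeal_sq
        · simp [h0, mem_vanishingIdeal'.1 hb x rfl]
        · ext v
          simp only [dpoly_sub, dpoly_sum, dpoly_C_mul, hc, sub_self, LinearMap.zero_apply]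
      have h3 : ∑ j, C (c (Sum.inl j)) * G (Sum.inl j) ∈ J :=
        Ideal.sum_mem _ fun j _ => Ideal.mul_mem_left _ _ (Ideal.subset_span ⟨j, rfl⟩)
      convert Submodule.add_mem_sup h3 h2 using 1
      simp only [map_sum, map_mul, bind₁_X_right, bind₁_C_right, Fintype.sum_sum_type,
        Function.comp_apply]
      ring
    · simp only [map_sum, map_mul, bind₁_X_right, bind₁_C_right]
      exact Ideal.sum_mem _ fun i _ => Ideal.mul_mem_left _ _ (hGm _)
  induction k generalizing p with
  | zero =>
    refine ⟨C (eval x p), isHomogeneous_C _ _, Ideal.mem_sup_right ?_⟩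
    rw [zero_add, pow_one, bind₁_C_right, hm, mem_vanishingIdeal']
    rintro _ rfl
    simp
  | succ k ih =>
    rw [pow_succ] at hp
    refine Submodule.mul_induction_on hp ?_ ?_
    · intro a ha b hb
      obtain ⟨H, hH, hHm⟩ := ih ha
      obtain ⟨ℓ, hℓ, hℓb, hℓm⟩ := base b hb
      refine ⟨H * ℓ, hH.mul hℓ, ?_⟩
      have h1 : a * (b - bind₁ (G ∘ Sum.inr) ℓ) ∈ J ⊔ m ^ (k + 1 + 1) := by
        obtain ⟨j, hj, c, hc, hjc⟩ := Submodule.mem_sup.1 hℓb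
        rw [← hjc, mul_add]
        refine Submodule.add_mem_sup (Ideal.mul_mem_left _ _ hj) ?_
        rw [add_assoc, pow_add]
        exact Ideal.mul_mem_mul ha hc
      have h2 : (a - bind₁ (G ∘ Sum.inr) H) * bind₁ (G ∘ Sum.inr) ℓ ∈ J ⊔ m ^ (k + 1 + 1) := by
        obtain ⟨j, hj, c, hc, hjc⟩ := Submodule.mem_sup.1 hHm
        rw [← hjc, add_mul]
        refine Submodule.add_mem_sup (Ideal.mul_mem_right _ _ hj) ?_
        rw [pow_succ m (k + 1)]
        exact Ideal.mul_mem_mul hc hℓm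
      convert add_mem h1 h2 using 1
      rw [map_mul]
      ring
    · rintro a b ⟨H, hH, hHm⟩ ⟨H', hH', hHm'⟩
      refine ⟨H + H', hH.add hH', ?_⟩
      convert add_mem hHm hHm' using 1
      rw [map_add]
      ring

/-- Induction on the order `k`: modulo the equations the leading form of `p` can be read off along
the parametrization, where `p` is zero, so this form vanishes and the order goes up. -/
theorem mem_sup_pow_of_mem_germIdeal (e : α ⊕ β ≃ σ) {G : α ⊕ β → MvPolynomial σ ℂ} {x : σ → ℂ}
    (h0 : ∀ a, eval x (G a) = 0) (hdet : eval x (jacDet e G) ≠ 0) {φ : (β → ℂ) → (σ → ℂ)}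
    (hφ : AnalyticAt ℂ φ 0) (hφ0 : φ 0 = x)
    (hG : ∀ᶠ u in 𝓝 0, ∀ a, eval (φ u) (G a) = (Sum.elim 0 u : α ⊕ β → ℂ) a)
    {p : MvPolynomial σ ℂ} (hp : p ∈ germIdeal φ) (k : ℕ) :
    p ∈ Ideal.span (Set.range (G ∘ Sum.inl)) ⊔ (vanishingIdeal ℂ {x}) ^ k := by
  set J := Ideal.span (Set.range (G ∘ Sum.inl)) with hJ
  set m := vanishingIdeal ℂ ({x} : Set (σ → ℂ)) with hm
  have hJφ : J ≤ germIdeal φ := by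
    rw [hJ, Ideal.span_le]
    rintro _ ⟨j, rfl⟩
    exact hG.mono fun u hu => hu (Sum.inl j)
  induction k with
  | zero => simp
  | succ k ih =>
    obtain ⟨j, hj, c, hc, hjc⟩ := Submodule.mem_sup.1 ih
    obtain ⟨H, hH, hHm⟩ := exists_homogeneous_sub_mem e h0 hdet k hc
    have hcφ : c ∈ germIdeal φ := by
      have : c = p - j := by rw [← hjc]; ring
      rw [this]
      exact sub_mem hp (hJφ hj)
    suffices hH0 : H = 0 by
      rw [hH0, map_zero, sub_zero] at hHm
      rw [← hjc]
      exact add_mem (Ideal.mem_sup_left hj) hHm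
    obtain ⟨j', hj', d, hd, hjd⟩ := Submodule.mem_sup.1 hHm
    -- Along the ray s ↦ φ(s u) the remainder is O(s^(k+1)) and also equals -s^k H(u), which forces
    -- H(u) = 0.
    have hbig := isBigO_of_mem_vanishingIdeal_pow (k + 1) hd
    apply MvPolynomial.funext
    intro u
    rw [map_zero]
    have hs : Tendsto (fun s : ℂ => s • u) (𝓝 0) (𝓝 0) := by
      have : Continuous fun s : ℂ => s • u := by fun_prop
      simpa using this.tendsto 0
    have hφs : Tendsto (fun s : ℂ => φ (s • u)) (𝓝 0) (𝓝 x) := by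
      rw [← hφ0]
      exact hφ.continuousAt.tendsto.comp hs
    have hO : (fun s : ℂ => φ (s • u) - x) =O[𝓝 0] fun s => s := by
      have h1 := hφ.differentiableAt.hasFDerivAt.isBigO_sub.comp_tendsto hs
      rw [hφ0] at h1
      refine h1.trans ?_
      refine Asymptotics.IsBigO.of_bound ‖u‖ (Eventually.of_forall fun s => ?_)
      simp [norm_smul, mul_comm]
    have h2 : (fun s : ℂ => eval (φ (s • u)) d) =O[𝓝 0] fun s => s ^ (k + 1) := by
      refine (hbig.comp_tendsto hφs).trans ?_
      exact (hO.norm_left).pow (k + 1)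
    have h3 : ∀ᶠ s : ℂ in 𝓝 0, eval (φ (s • u)) d = -(s ^ k * eval u H) := by
      filter_upwards [hs.eventually hG, hs.eventually (mem_germIdeal.1 hcφ),
        hs.eventually (mem_germIdeal.1 (hJφ hj'))] with s hs1 hs2 hs3
      have : d = c - bind₁ (G ∘ Sum.inr) H - j' := by rw [← hjd]; ring
      rw [this, eval_sub, eval_sub, hs2, hs3, eval_bind₁]
      have h4 : evalMap (G ∘ Sum.inr) (φ (s • u)) = s • u := by
        ext i
        exact hs1 (Sum.inr i)
      rw [h4]
      have h5 : eval (s • u) H = s ^ k * eval u H :=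
        eval_smul_of_isHomogeneous hH s u
      rw [h5]
      ring
    have h4 : (fun s : ℂ => s ^ k * eval u H) =O[𝓝 0] fun s => s ^ (k + 1) := by
      rw [← Asymptotics.isBigO_neg_left]
      exact h2.congr' (h3.mono fun s hs => hs) (EventuallyEq.refl _ _)
    by_contra hne
    have h5 : (fun s : ℂ => s ^ k) =O[𝓝 0] fun s => s ^ (k + 1) := by
      have := h4.const_mul_left (eval u H)⁻¹
      refine this.congr_left fun s => ?_
      field_simp
    have h6 : (fun s : ℂ => s ^ (k + 1)) =o[𝓝 0] fun s => s ^ k :=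
      Asymptotics.isLittleO_pow_pow (Nat.lt_succ_self k)
    have h7 := h5.trans_isLittleO h6
    refine Asymptotics.isLittleO_irrefl ?_ h7
    have h8 : ∃ᶠ s : ℂ in 𝓝 0, s ≠ 0 :=
      (frequently_nhdsWithin_iff.1 (Eventually.frequently (f := 𝓝[≠] (0:ℂ)) (p := fun s => s ≠ 0) self_mem_nhdsWithin)).mono fun _ h => h.1
    exact h8.mono fun s hs => pow_ne_zero _ hs

/-- Krull's intersection theorem modulo the equations: an element lying in all powers of the maximal
ideal of `x` is killed by some `1 - r`, with `r` in that ideal. So the equations generate the germ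
ideal locally at `x`. -/
theorem exists_mul_mem_of_mem_germIdeal (e : α ⊕ β ≃ σ) {G : α ⊕ β → MvPolynomial σ ℂ}
    {x : σ → ℂ} (h0 : ∀ a, eval x (G a) = 0) (hdet : eval x (jacDet e G) ≠ 0)
    {φ : (β → ℂ) → (σ → ℂ)} (hφ : AnalyticAt ℂ φ 0) (hφ0 : φ 0 = x)
    (hG : ∀ᶠ u in 𝓝 0, ∀ a, eval (φ u) (G a) = (Sum.elim 0 u : α ⊕ β → ℂ) a)
    {p : MvPolynomial σ ℂ} (hp : p ∈ germIdeal φ) :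
    ∃ h, eval x h ≠ 0 ∧ h * p ∈ Ideal.span (Set.range (G ∘ Sum.inl)) := by
  set J := Ideal.span (Set.range (G ∘ Sum.inl)) with hJ
  set m := vanishingIdeal ℂ ({x} : Set (σ → ℂ)) with hm
  have hmem : (Ideal.Quotient.mk J p) ∈
      (⨅ i : ℕ, m ^ i • ⊤ : Submodule (MvPolynomial σ ℂ) (MvPolynomial σ ℂ ⧸ J)) := by
    rw [Submodule.mem_iInf]
    intro k
    obtain ⟨j, hj, d, hd, hjd⟩ := Submodule.mem_sup.1
      (mem_sup_pow_of_mem_germIdeal e h0 hdet hφ hφ0 hG hp k)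
    have : Ideal.Quotient.mk J p = d • (1 : MvPolynomial σ ℂ ⧸ J) := by
      rw [← hjd, map_add, Ideal.Quotient.eq_zero_iff_mem.2 hj, zero_add]
      exact (congrArg (Ideal.Quotient.mk J) (mul_one d)).symm
    rw [this]
    exact Submodule.smul_mem_smul hd trivial
  obtain ⟨⟨r, hr⟩, hrp⟩ := (Ideal.mem_iInf_smul_pow_eq_bot_iff m _).1 hmem
  refine ⟨1 - r, ?_, ?_⟩
  · rw [map_sub, map_one, mem_vanishingIdeal'.1 hr x rfl]
    simp
  · rw [← Ideal.Quotient.eq_zero_iff_mem, sub_mul, one_mul, map_sub, sub_eq_zero, map_mul]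
    exact hrp.symm.trans (map_mul (Ideal.Quotient.mk J) r p)

/-- Near a point with a frame, a set of pure dimension is defined by the equations of the frame. -/
theorem exists_mem_zariskiClosure_of_frame {r n : ℕ} (e : Fin r ⊕ Fin n ≃ σ)
    {G : Fin r ⊕ Fin n → MvPolynomial σ ℂ} {S : Set (σ → ℂ)} (hS : IsPureDim S n)
    (hGS : ∀ j, G (Sum.inl j) ∈ vanishingIdeal ℂ S) {x : σ → ℂ} (hx : x ∈ S)
    (h0 : ∀ i, eval x (G (Sum.inr i)) = 0) (hdet : eval x (jacDet e G) ≠ 0) :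
    ∃ h, eval x h ≠ 0 ∧ ∀ y, eval y h ≠ 0 → (∀ j, eval y (G (Sum.inl j)) = 0) →
      y ∈ zariskiClosure S := by
  have h0' : ∀ a, eval x (G a) = 0 := by
    rintro (j | i)
    · exact mem_vanishingIdeal'.1 (hGS j) x hx
    · exact h0 i
  obtain ⟨φ, hφ, hφ0, hφG, -⟩ := exists_param e h0' hdet
  obtain ⟨P, hP, hxP⟩ := exists_minimalPrimes_le_of_mem hx
  have hPp : P.IsPrime := hP.1.1
  have hQp := isPrime_germIdeal hφ
  set Q := germIdeal φ with hQ
  have hJP : Ideal.span (Set.range (G ∘ Sum.inl)) ≤ P := by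
    rw [Ideal.span_le]
    rintro _ ⟨j, rfl⟩
    exact hP.1.2 (hGS j)
  -- Locally at `x` the germ ideal `Q` is generated by frame equations, which belong to the
  -- component `P` through `x`.
  have hQP : Q ≤ P := by
    intro p hp
    obtain ⟨h, hh, hhp⟩ := exists_mul_mem_of_mem_germIdeal e h0' hdet hφ hφ0 hφG hp
    exact (hPp.mem_or_mem (hJP hhp)).resolve_left fun hhP => hh (mem_zeroLocus'.1 hxP _ hhP)
  have hdQ : jacDet e G ∉ Q := by
    intro h
    have := (mem_germIdeal.1 h).self_of_nhds
    rw [hφ0] at this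
    exact hdet this
  have hvan : vanishingIdeal ℂ (zeroLocus ℂ Q) = Q := by
    rw [vanishingIdeal_zeroLocus_eq_radical, hQp.radical]
  -- The frame bounds the generic tangent spaces of `Q` by `n`, the dimension of `P`; with `Q ≤ P`
  -- the two primes coincide.
  have hdim : ringKrullDim (MvPolynomial σ ℂ ⧸ Q) ≤ ringKrullDim (MvPolynomial σ ℂ ⧸ P) := by
    have hQm : Q ∈ (vanishingIdeal ℂ (zeroLocus ℂ Q)).minimalPrimes := by
      rw [hvan, Ideal.minimalPrimes_eq_subsingleton_self]
      rfl
    obtain ⟨q, -, hq, -, -, hfin⟩ := exists_generic_point' hQm hdQ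
    rw [← hfin, hS P hP, Nat.cast_le]
    refine (Submodule.finrank_mono (tangentSpace_le_frameKer (G := G) (fun j => ?_) q)).trans ?_
    · rw [hvan]
      exact hφG.mono fun u hu => hu (Sum.inl j)
    · rw [finrank_frameKer e hq, Fintype.card_fin]
  have hPQ : Q = P := eq_of_le_of_ringKrullDim_le hQP hPp hdim
  -- The product of the multipliers for finitely many generators of `Q` defines one neighbourhood
  -- that serves all equations.
  obtain ⟨s, hs⟩ := (isNoetherianRing_iff_ideal_fg _).1 inferInstance Q
  have hsQ : ∀ p ∈ s, p ∈ Q := fun p hp => by rw [← hs]; exact Ideal.subset_span hp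
  choose! h hh hhp using fun p (hp : p ∈ s) =>
    exists_mul_mem_of_mem_germIdeal e h0' hdet hφ hφ0 hφG (hsQ p hp)
  refine ⟨∏ p ∈ s, h p, ?_, fun y hy hyG => ?_⟩
  · rw [map_prod]
    exact Finset.prod_ne_zero_iff.2 hh
  · rw [map_prod, Finset.prod_ne_zero_iff] at hy
    have hyQ : ∀ p ∈ Q, eval y p = 0 := by
      have : Q ≤ vanishingIdeal ℂ ({y} : Set (σ → ℂ)) := by
        rw [← hs, Ideal.span_le]
        intro p hp
        refine mem_vanishingIdeal'.2 fun z hz => ?_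
        rw [Set.mem_singleton_iff.1 hz]
        have hJy : Ideal.span (Set.range (G ∘ Sum.inl)) ≤ vanishingIdeal ℂ ({y} : Set (σ → ℂ)) := by
          rw [Ideal.span_le]
          rintro _ ⟨j, rfl⟩
          refine mem_vanishingIdeal'.2 fun z hz => ?_
          rw [Set.mem_singleton_iff.1 hz]
          exact hyG j
        have h1 := mem_vanishingIdeal'.1 (hJy (hhp p hp)) y rfl
        rw [eval_mul] at h1
        exact (mul_eq_zero.1 h1).resolve_left (hy p hp)
      exact fun p hp => mem_vanishingIdeal'.1 (this hp) y rfl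
    exact mem_zeroLocus'.2 fun p hp => hyQ p (hPQ ▸ hP.1.2 hp)

end Germ

end AffinePolar

namespace AffinePolar

open MvPolynomial

/-! ### Linear algebra of pairs (tangent vector, covector). -/

section Lift

variable {σ τ : Type} [Fintype σ] [Fintype τ]

theorem dpoly_rename (f : σ → τ) (p : MvPolynomial σ ℂ) (q v : τ → ℂ) :
    dpoly (rename f p) q v = dpoly p (q ∘ f) (v ∘ f) := by
  have h : rename f p = bind₁ (fun i => X (f i)) p :=
    AlgHom.congr_fun (MvPolynomial.algHom_ext (f := rename f) (g := bind₁ fun i => X (f i))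
      fun i => by simp) p
  rw [h, dpoly_bind₁]
  congr 2
  · congr 1
    ext i
    simp [evalMap_apply]
  · ext i
    simp [dmap_apply, dpoly_X]

/-- The pairing of the cotangent variable with a polynomial vector field. -/
noncomputable def pairPoly (V : σ → MvPolynomial σ ℂ) : MvPolynomial (σ ⊕ σ) ℂ :=
  ∑ l, X (Sum.inr l) * rename Sum.inl (V l)

theorem eval_pairPoly (V : σ → MvPolynomial σ ℂ) (q : σ ⊕ σ → ℂ) :
    eval q (pairPoly V) = ∑ l, q (Sum.inr l) * eval (q ∘ Sum.inl) (V l) := by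
  simp [pairPoly, eval_rename]

theorem dpoly_pairPoly (V : σ → MvPolynomial σ ℂ) (q v : σ ⊕ σ → ℂ) :
    dpoly (pairPoly V) q v = ∑ l, v (Sum.inr l) * eval (q ∘ Sum.inl) (V l) +
      ∑ l, q (Sum.inr l) * dpoly (V l) (q ∘ Sum.inl) (v ∘ Sum.inl) := by
  simp only [pairPoly, dpoly_sum, dpoly_mul, dpoly_X, dpoly_rename, eval_X, eval_rename]
  rw [Finset.sum_add_distrib, add_comm]
  congr 1
  exact Finset.sum_congr rfl fun l _ => mul_comm _ _

/-- The Hessian of a polynomial. -/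
noncomputable def hess (p : MvPolynomial σ ℂ) (x : σ → ℂ) : (σ → ℂ) →ₗ[ℂ] (σ → ℂ) →ₗ[ℂ] ℂ :=
  ∑ l, (dpoly (pderiv l p) x).smulRight (LinearMap.proj l : (σ → ℂ) →ₗ[ℂ] ℂ)

theorem hess_apply (p : MvPolynomial σ ℂ) (x v w : σ → ℂ) :
    hess p x v w = ∑ l, dpoly (pderiv l p) x v * w l := by
  simp [hess, LinearMap.sum_apply]

/-- Pairs `(v, η)` with `v ∈ T` such that `η = -B v` on `T`. -/
noncomputable def graphOver (T : Submodule ℂ (σ → ℂ)) (B : (σ → ℂ) →ₗ[ℂ] (σ → ℂ) →ₗ[ℂ] ℂ) :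
    Submodule ℂ (σ ⊕ σ → ℂ) where
  carrier := {v | v ∘ Sum.inl ∈ T ∧ ∀ w ∈ T, ∑ l, v (Sum.inr l) * w l + B (v ∘ Sum.inl) w = 0}
  zero_mem' := by
    refine ⟨T.zero_mem, fun w _ => ?_⟩
    have : (0 : σ ⊕ σ → ℂ) ∘ Sum.inl = 0 := rfl
    simp [this]
  add_mem' := by
    rintro a b ⟨ha, ha'⟩ ⟨hb, hb'⟩
    refine ⟨T.add_mem ha hb, fun w hw => ?_⟩
    have h1 := ha' w hw
    have h2 := hb' w hw
    have : (a + b) ∘ Sum.inl = a ∘ Sum.inl + b ∘ Sum.inl := rfl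
    simp only [this, map_add, LinearMap.add_apply, Pi.add_apply, add_mul, Finset.sum_add_distrib]
    linear_combination h1 + h2
  smul_mem' := by
    rintro c a ⟨ha, ha'⟩
    refine ⟨T.smul_mem c ha, fun w hw => ?_⟩
    have h1 := ha' w hw
    have : (c • a) ∘ Sum.inl = c • (a ∘ Sum.inl) := rfl
    simp only [this, map_smul, LinearMap.smul_apply, Pi.smul_apply, smul_eq_mul, mul_assoc,
      ← Finset.mul_sum]
    linear_combination c * h1

theorem mem_graphOver {T : Submodule ℂ (σ → ℂ)} {B : (σ → ℂ) →ₗ[ℂ] (σ → ℂ) →ₗ[ℂ] ℂ}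
    {v : σ ⊕ σ → ℂ} : v ∈ graphOver T B ↔
      v ∘ Sum.inl ∈ T ∧ ∀ w ∈ T, ∑ l, v (Sum.inr l) * w l + B (v ∘ Sum.inl) w = 0 := Iff.rfl

/-- Rank-nullity for the projection to the first factor: the image lies in `T'`, and the kernel
embeds into the annihilator of `T`. -/
theorem finrank_le_of_fiber {E : Submodule ℂ (σ ⊕ σ → ℂ)} {T T' : Submodule ℂ (σ → ℂ)}
    (h1 : ∀ v ∈ E, v ∘ Sum.inl ∈ T')
    (h2 : ∀ v ∈ E, v ∘ Sum.inl = 0 → ∀ w ∈ T, ∑ l, v (Sum.inr l) * w l = 0) :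
    Module.finrank ℂ E + Module.finrank ℂ T ≤ Module.finrank ℂ T' + Fintype.card σ := by
  classical
  let π : E →ₗ[ℂ] T' := LinearMap.codRestrict T'
    ((LinearMap.funLeft ℂ ℂ (Sum.inl : σ → σ ⊕ σ)).domRestrict E) fun v => h1 v v.2
  have hπ : ∀ v : LinearMap.ker π, (v : σ ⊕ σ → ℂ) ∘ Sum.inl = 0 := by
    intro v
    have := congrArg Subtype.val (LinearMap.mem_ker.1 v.2)
    exact this
  let dd : (σ → ℂ) →ₗ[ℂ] Module.Dual ℂ (σ → ℂ) := dotProductBilin ℂ ℂ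
  have hdd : ∀ a b, dd a b = ∑ l, a l * b l := fun a b => rfl
  let κ : LinearMap.ker π →ₗ[ℂ] T.dualAnnihilator := LinearMap.codRestrict _
    (dd ∘ₗ (LinearMap.funLeft ℂ ℂ (Sum.inr : σ → σ ⊕ σ)) ∘ₗ E.subtype ∘ₗ
      (LinearMap.ker π).subtype) (by
      intro v
      rw [Submodule.mem_dualAnnihilator]
      intro w hw
      exact h2 v v.1.2 (hπ v) w hw)
  have hκ : Function.Injective κ := by
    rw [injective_iff_map_eq_zero]
    intro v hv
    have h0 : dd ((v : σ ⊕ σ → ℂ) ∘ Sum.inr) = 0 := congrArg Subtype.val hv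
    have h3 : ∀ l, (v : σ ⊕ σ → ℂ) (Sum.inr l) = 0 := by
      intro l
      have := congrArg (fun φ : Module.Dual ℂ (σ → ℂ) => φ (Pi.single l 1)) h0
      simpa [hdd, Pi.single_apply] using this
    apply Subtype.ext
    apply Subtype.ext
    ext (l | l)
    · exact congrFun (hπ v) l
    · exact h3 l
  have hk := LinearMap.finrank_le_finrank_of_injective hκ
  have hr := LinearMap.finrank_range_add_finrank_ker π
  have hr' := Submodule.finrank_le (LinearMap.range π)
  have ha := Subspace.finrank_add_finrank_dualAnnihilator_eq T
  rw [Module.finrank_fintype_fun_eq_card] at ha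
  omega

theorem finrank_graphOver_le (T : Submodule ℂ (σ → ℂ)) (B : (σ → ℂ) →ₗ[ℂ] (σ → ℂ) →ₗ[ℂ] ℂ) :
    Module.finrank ℂ (graphOver T B) ≤ Fintype.card σ := by
  have := finrank_le_of_fiber (E := graphOver T B) (T := T) (T' := T) (fun v hv => hv.1)
    (fun v hv h0 w hw => by simpa [h0] using hv.2 w hw)
  omega

end Lift

/-! ### Charts of an algebraic set at regular points. -/

section Chart

variable {N n : ℕ}

theorem form_apply (ξ v : Fin N → ℂ) : form ξ v = ∑ l, ξ l * v l := rfl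

theorem IsZariskiClosed.zariskiClosure_eq {σ : Type} [Fintype σ] {A : Set (σ → ℂ)}
    (hA : IsZariskiClosed A) : zariskiClosure A = A := by
  obtain ⟨I, rfl⟩ := hA
  apply Set.Subset.antisymm
  · intro y hy
    refine mem_zeroLocus'.2 fun p hp => mem_zeroLocus'.1 hy p (mem_vanishingIdeal'.2 fun z hz => ?_)
    exact mem_zeroLocus'.1 hz p hp
  · intro y hy
    exact mem_zeroLocus'.2 fun p hp => mem_vanishingIdeal'.1 hp y hy

/-- Near a regular point, an algebraic set is defined by the equations of a frame. -/
theorem exists_chart {X : Set (Fin N → ℂ)} (hX : IsZariskiClosed X) (hdim : IsPureDim X n)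
    {x : Fin N → ℂ} (hx : x ∈ regularLocus X n) :
    ∃ (r : ℕ) (e : Fin r ⊕ Fin n ≃ Fin N) (G : Fin r ⊕ Fin n → MvPolynomial (Fin N) ℂ)
      (d : MvPolynomial (Fin N) ℂ), (∀ j, G (Sum.inl j) ∈ vanishingIdeal ℂ X) ∧
      (∀ i, eval x (G (Sum.inr i)) = 0) ∧ eval x d ≠ 0 ∧
      (∀ y, eval y d ≠ 0 → eval y (jacDet e G) ≠ 0) ∧
      ∀ y, eval y d ≠ 0 → (∀ j, eval y (G (Sum.inl j)) = 0) → y ∈ X := by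
  obtain ⟨r, e, G, hG, h0, hdet⟩ := exists_frame X x hx.2
  obtain ⟨h, hh, hloc⟩ := exists_mem_zariskiClosure_of_frame e hdim hG hx.1 h0 hdet
  refine ⟨r, e, G, jacDet e G * h, hG, h0, ?_, fun y hy => ?_, fun y hy hyG => ?_⟩
  · rw [eval_mul]
    exact mul_ne_zero hdet hh
  · rw [eval_mul] at hy
    exact left_ne_zero_of_mul hy
  · rw [eval_mul] at hy
    rw [← hX.zariskiClosure_eq]
    exact hloc y (right_ne_zero_of_mul hy) hyG

theorem mem_regularLocus_of_frame {X : Set (Fin N → ℂ)} (hdim : IsPureDim X n) {r : ℕ}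
    {e : Fin r ⊕ Fin n ≃ Fin N} {G : Fin r ⊕ Fin n → MvPolynomial (Fin N) ℂ}
    (hG : ∀ j, G (Sum.inl j) ∈ vanishingIdeal ℂ X) {y : Fin N → ℂ} (hy : y ∈ X)
    (hdet : eval y (jacDet e G) ≠ 0) : y ∈ regularLocus X n := by
  refine ⟨hy, ?_⟩
  rw [tangentSpace_eq_frameKer hdim hG hy hdet, finrank_frameKer e hdet, Fintype.card_fin]

/-- The singular locus is cut out in `X` by polynomials. -/
theorem exists_eval_ne_zero_of_mem_regularLocus {X : Set (Fin N → ℂ)}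
    (hdim : IsPureDim X n) {x : Fin N → ℂ} (hx : x ∈ regularLocus X n) :
    ∃ d : MvPolynomial (Fin N) ℂ, eval x d ≠ 0 ∧
      ∀ y ∈ X, eval y d ≠ 0 → y ∈ regularLocus X n := by
  obtain ⟨r, e, G, hG, -, hdet⟩ := exists_frame X x hx.2
  exact ⟨jacDet e G, hdet, fun y hy hyd => mem_regularLocus_of_frame hdim hG hy hyd⟩

end Chart

/-! ### Equations and tangent spaces of the conormal space. -/

section Conormal

variable {N n : ℕ} {X : Set (Fin N → ℂ)}

/-- The frame fields span the tangent space, so conormality becomes `n` polynomial equations. -/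
theorem forall_form_eq_zero_iff {r : ℕ} {e : Fin r ⊕ Fin n ≃ Fin N}
    {G : Fin r ⊕ Fin n → MvPolynomial (Fin N) ℂ} (hdim : IsPureDim X n)
    (hG : ∀ j, G (Sum.inl j) ∈ vanishingIdeal ℂ X) {q : Fin N ⊕ Fin N → ℂ}
    (hq : q ∘ Sum.inl ∈ X) (hdet : eval (q ∘ Sum.inl) (jacDet e G) ≠ 0) :
    (∀ v ∈ tangentSpace X (q ∘ Sum.inl), form (q ∘ Sum.inr) v = 0) ↔
      ∀ i, eval q (pairPoly (frameField e G i)) = 0 := by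
  rw [tangentSpace_eq_frameKer hdim hG hq hdet]
  constructor
  · intro h i
    rw [eval_pairPoly]
    exact h _ (frameField_mem_frameKer e G i _)
  · intro h v hv
    have : frameKer G (q ∘ Sum.inl) ≤ LinearMap.ker (form (q ∘ Sum.inr)) := by
      rw [← span_frameField e hdet, Submodule.span_le]
      rintro _ ⟨i, rfl⟩
      rw [SetLike.mem_coe, LinearMap.mem_ker, form_apply, ← h i, eval_pairPoly]
      rfl
    exact this hv

/-- The Jacobian factor makes the local equation hold on the whole conormal space, including where
the frame degenerates. -/
theorem mul_pairPoly_mem {r : ℕ} {e : Fin r ⊕ Fin n ≃ Fin N}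
    {G : Fin r ⊕ Fin n → MvPolynomial (Fin N) ℂ} (hdim : IsPureDim X n)
    (hG : ∀ j, G (Sum.inl j) ∈ vanishingIdeal ℂ X) (i : Fin n) :
    rename Sum.inl (jacDet e G) * pairPoly (frameField e G i) ∈
      vanishingIdeal ℂ (conormal X (regularLocus X n)) := by
  refine mem_vanishingIdeal'.2 fun q hq => ?_
  rw [eval_mul, eval_rename, mul_eq_zero, or_iff_not_imp_left]
  intro hdet
  exact (forall_form_eq_zero_iff hdim hG hq.1.1 hdet).1 hq.2 i

theorem rename_mem_vanishingIdeal_conormal {A U : Set (Fin N → ℂ)} (hU : U ⊆ A)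
    {p : MvPolynomial (Fin N) ℂ} (hp : p ∈ vanishingIdeal ℂ A) :
    rename Sum.inl p ∈ vanishingIdeal ℂ (conormal A U) := by
  refine mem_vanishingIdeal'.2 fun q hq => ?_
  rw [eval_rename]
  exact mem_vanishingIdeal'.1 hp _ (hU hq.1)

theorem comp_inl_mem_tangentSpace {A U : Set (Fin N → ℂ)} (hU : U ⊆ A) {q v : Fin N ⊕ Fin N → ℂ}
    (hv : v ∈ tangentSpace (conormal A U) q) : v ∘ Sum.inl ∈ tangentSpace A (q ∘ Sum.inl) := by
  refine mem_tangentSpace.2 fun p hp => ?_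
  rw [← dpoly_rename]
  exact mem_tangentSpace.1 hv _ (rename_mem_vanishingIdeal_conormal hU hp)

theorem regularLocus_subset : regularLocus X n ⊆ X := fun _ h => h.1

/-- Over the regular locus, the conormal space is closed. -/
theorem mem_conormal_of_mem_zariskiClosure (hX : IsZariskiClosed X) (hdim : IsPureDim X n)
    {q : Fin N ⊕ Fin N → ℂ} (hq : q ∈ zariskiClosure (conormal X (regularLocus X n)))
    (hx : q ∘ Sum.inl ∈ regularLocus X n) : q ∈ conormal X (regularLocus X n) := by
  obtain ⟨r, e, G, d, hG, h0, hd, hdet, hloc⟩ := exists_chart hX hdim hx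
  refine ⟨hx, (forall_form_eq_zero_iff hdim hG hx.1 (hdet _ hd)).2 fun i => ?_⟩
  have := mem_zeroLocus'.1 hq _ (mul_pairPoly_mem (e := e) hdim hG i)
  rw [eval_mul, eval_rename] at this
  exact (mul_eq_zero.1 this).resolve_left (hdet _ hd)

theorem comp_inl_mem_of_mem_zariskiClosure (hX : IsZariskiClosed X)
    {q : Fin N ⊕ Fin N → ℂ} (hq : q ∈ zariskiClosure (conormal X (regularLocus X n))) :
    q ∘ Sum.inl ∈ X := by
  rw [← hX.zariskiClosure_eq]
  refine mem_zeroLocus'.2 fun p hp => ?_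
  rw [← eval_rename]
  exact mem_zeroLocus'.1 hq _ (rename_mem_vanishingIdeal_conormal regularLocus_subset hp)

/-- The function `ξ - ∑ λ_j g_j`, which is critical at a point where `ξ` is conormal. -/
theorem exists_lagrange {r : ℕ} (e : Fin r ⊕ Fin n ≃ Fin N)
    {G : Fin r ⊕ Fin n → MvPolynomial (Fin N) ℂ} {x ξ : Fin N → ℂ}
    (hdet : eval x (jacDet e G) ≠ 0) (hξ : ∀ v ∈ frameKer G x, form ξ v = 0) :
    ∃ c : Fin r → ℂ, ∀ v, form ξ v = ∑ j, c j * dpoly (G (Sum.inl j)) x v := by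
  let L : (Fin N → ℂ) ≃ₗ[ℂ] (Fin r ⊕ Fin n → ℂ) :=
    LinearEquiv.ofBijective (dmap G x) (bijective_dmap e hdet)
  have hL : ∀ w, dmap G x (L.symm w) = w := fun w => L.apply_symm_apply w
  refine ⟨fun j => form ξ (L.symm (Pi.single (Sum.inl j) 1)), fun v => ?_⟩
  have h1 : v = L.symm (∑ a, dmap G x v a • Pi.single a 1) := by
    rw [LinearEquiv.eq_symm_apply]
    ext a
    simp [L, Finset.sum_apply, Pi.single_apply]
  conv_lhs => rw [h1]
  simp only [map_sum, map_smul, smul_eq_mul, dmap_apply]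
  rw [Fintype.sum_sum_type, add_eq_left.2]
  · exact Finset.sum_congr rfl fun a _ => mul_comm _ _
  · refine Finset.sum_eq_zero fun i _ => ?_
    rw [hξ, mul_zero]
    rw [mem_frameKer]
    intro j
    rw [← dmap_apply, hL]
    simp

/-- The function `ξ - ∑ c_j g_j`. -/
noncomputable def lagrange {r : ℕ} (G : Fin r ⊕ Fin n → MvPolynomial (Fin N) ℂ) (ξ : Fin N → ℂ)
    (c : Fin r → ℂ) : MvPolynomial (Fin N) ℂ :=
  ∑ l, C (ξ l) * MvPolynomial.X l - ∑ j, C (c j) * G (Sum.inl j)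

theorem dpoly_lagrange {r : ℕ} (G : Fin r ⊕ Fin n → MvPolynomial (Fin N) ℂ) (ξ : Fin N → ℂ)
    (c : Fin r → ℂ) (x v : Fin N → ℂ) : dpoly (lagrange G ξ c) x v =
      form ξ v - ∑ j, c j * dpoly (G (Sum.inl j)) x v := by
  simp only [lagrange, dpoly_sub, dpoly_sum, dpoly_C_mul, dpoly_X, form_apply]

/-- The tangent spaces of the conormal space. -/
theorem tangentSpace_conormal_le (hdim : IsPureDim X n) {r : ℕ} {e : Fin r ⊕ Fin n ≃ Fin N}
    {G : Fin r ⊕ Fin n → MvPolynomial (Fin N) ℂ} (hG : ∀ j, G (Sum.inl j) ∈ vanishingIdeal ℂ X)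
    {q : Fin N ⊕ Fin N → ℂ} (hq : q ∈ conormal X (regularLocus X n))
    (hdet : eval (q ∘ Sum.inl) (jacDet e G) ≠ 0) {c : Fin r → ℂ}
    (hc : ∀ v, form (q ∘ Sum.inr) v = ∑ j, c j * dpoly (G (Sum.inl j)) (q ∘ Sum.inl) v) :
    tangentSpace (conormal X (regularLocus X n)) q ≤
      graphOver (tangentSpace X (q ∘ Sum.inl))
        (hess (lagrange G (q ∘ Sum.inr) c) (q ∘ Sum.inl)) := by
  intro v hv
  have hv1 := comp_inl_mem_tangentSpace regularLocus_subset hv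
  refine ⟨hv1, ?_⟩
  set x := q ∘ Sum.inl with hx
  set ξ := q ∘ Sum.inr with hξ
  set L := lagrange G ξ c with hL
  -- Differentiating the conormality equation produces derivatives of the frame field.
  -- Differentiating the identities dG_j(frame field) = 0 trades these for second derivatives of the
  -- G_j, which combine to the Hessian of ξ - ∑ c_j G_j.
  have key : ∀ i, ∑ l, v (Sum.inr l) * eval x (frameField e G i l) +
      ∑ l, dpoly (pderiv l L) x (v ∘ Sum.inl) * eval x (frameField e G i l) = 0 := by
    intro i
    have h1 := mem_tangentSpace.1 hv _ (mul_pairPoly_mem (e := e) hdim hG i)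
    have h2 := (forall_form_eq_zero_iff hdim hG hq.1.1 hdet).1 hq.2 i
    rw [dpoly_mul, h2, zero_mul, add_zero, eval_rename, dpoly_pairPoly] at h1
    have h3 := (mul_eq_zero.1 h1).resolve_left hdet
    rw [← h3]
    congr 1
    have h4 : ∀ j, ∑ l, eval x (pderiv l (G (Sum.inl j))) *
        dpoly (frameField e G i l) x (v ∘ Sum.inl) = -∑ l, eval x (frameField e G i l) *
          dpoly (pderiv l (G (Sum.inl j))) x (v ∘ Sum.inl) := by
      intro j
      have h5 := sum_pderiv_mul_frameField e G (Sum.inl j) i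
      rw [if_neg (by simp)] at h5
      have h6 := congrArg (fun p => dpoly p x (v ∘ Sum.inl)) h5
      simp only [dpoly_sum, dpoly_mul, Finset.sum_add_distrib] at h6
      rw [show dpoly (0 : MvPolynomial (Fin N) ℂ) x (v ∘ Sum.inl) = 0 by
        simpa using dpoly_C 0 x (v ∘ Sum.inl)] at h6
      linear_combination h6
    have h7 : ∀ l, ξ l = ∑ j, c j * eval x (pderiv l (G (Sum.inl j))) := by
      intro l
      have := hc (Pi.single l 1)
      simpa [form_apply, dpoly_apply, Pi.single_apply] using this
    have h8 : ∀ l, dpoly (pderiv l L) x (v ∘ Sum.inl) =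
        -∑ j, c j * dpoly (pderiv l (G (Sum.inl j))) x (v ∘ Sum.inl) := by
      intro l
      have h9 : pderiv l L = C (ξ l) - ∑ j, C (c j) * pderiv l (G (Sum.inl j)) := by
        simp only [hL, lagrange, map_sub, map_sum, pderiv_C_mul, pderiv_X]
        simp [Pi.single_apply]
      rw [h9, dpoly_sub, dpoly_C, dpoly_sum, zero_sub]
      simp only [dpoly_C_mul]
    simp only [h8]
    change _ = ∑ l, ξ l * dpoly (frameField e G i l) x (v ∘ Sum.inl)
    simp only [h7, Finset.sum_mul, neg_mul, Finset.sum_neg_distrib]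
    rw [Finset.sum_comm, Finset.sum_comm (f := fun l j => c j * _ * _)]
    rw [← Finset.sum_neg_distrib]
    refine Finset.sum_congr rfl fun j _ => ?_
    have := h4 j
    simp only [mul_assoc, ← Finset.mul_sum]
    rw [this, mul_neg]
    congr 2
    exact Finset.sum_congr rfl fun l _ => mul_comm _ _
  have hle : tangentSpace X x ≤ LinearMap.ker (form (v ∘ Sum.inr) + hess L x (v ∘ Sum.inl)) := by
    rw [tangentSpace_eq_frameKer hdim hG hq.1.1 hdet, ← span_frameField e hdet, Submodule.span_le]
    rintro _ ⟨i, rfl⟩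
    rw [SetLike.mem_coe, LinearMap.mem_ker, LinearMap.add_apply, hess_apply, form_apply]
    exact key i
  intro w hw
  exact LinearMap.mem_ker.1 (hle hw)

theorem finrank_tangentSpace_conormal_le (hX : IsZariskiClosed X) (hdim : IsPureDim X n)
    {q : Fin N ⊕ Fin N → ℂ} (hq : q ∈ conormal X (regularLocus X n)) :
    Module.finrank ℂ (tangentSpace (conormal X (regularLocus X n)) q) ≤ N := by
  obtain ⟨r, e, G, d, hG, h0, hd, hdet, hloc⟩ := exists_chart hX hdim hq.1
  obtain ⟨c, hc⟩ := exists_lagrange e (hdet _ hd) (ξ := q ∘ Sum.inr) (fun v hv => by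
    rw [← tangentSpace_eq_frameKer hdim hG hq.1.1 (hdet _ hd)] at hv
    exact hq.2 v hv)
  refine (Submodule.finrank_mono (tangentSpace_conormal_le hdim hG hq (hdet _ hd) hc)).trans ?_
  simpa using finrank_graphOver_le (tangentSpace X (q ∘ Sum.inl)) (hess (lagrange G (q ∘ Sum.inr) c) (q ∘ Sum.inl))

end Conormal

end AffinePolar

namespace AffinePolar

open MvPolynomial

/-! ### Dimension estimates for components. -/

section Dimension

variable {σ : Type} [Fintype σ]

theorem subset_zariskiClosure (A : Set (σ → ℂ)) : A ⊆ zariskiClosure A := fun _ hx =>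
  mem_zeroLocus'.2 fun _ hp => mem_vanishingIdeal'.1 hp _ hx

theorem vanishingIdeal_le_of_subset_zariskiClosure {A B : Set (σ → ℂ)}
    (h : B ⊆ zariskiClosure A) : vanishingIdeal ℂ A ≤ vanishingIdeal ℂ B := fun _ hp =>
  mem_vanishingIdeal'.2 fun _ hy => mem_zeroLocus'.1 (h hy) _ hp

theorem vanishingIdeal_zariskiClosure (A : Set (σ → ℂ)) :
    vanishingIdeal ℂ (zariskiClosure A) = vanishingIdeal ℂ A :=
  le_antisymm (vanishingIdeal_anti_mono (subset_zariskiClosure A))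
    (vanishingIdeal_le_of_subset_zariskiClosure subset_rfl)

/-- The components of the intersection with a few hypersurfaces are not too small. -/
theorem le_ringKrullDim_of_cut {Z B : Set (σ → ℂ)} {d : ℕ}
    (hZ : ∀ P ∈ (vanishingIdeal ℂ Z).minimalPrimes, (d : WithBot ℕ∞) ≤
      ringKrullDim (MvPolynomial σ ℂ ⧸ P)) (S : Finset (MvPolynomial σ ℂ))
    {Q : Ideal (MvPolynomial σ ℂ)} (hQ : Q ∈ (vanishingIdeal ℂ B).minimalPrimes)
    {u : MvPolynomial σ ℂ} (hu : u ∉ Q) (hBZ : B ⊆ zariskiClosure Z)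
    (hBS : ∀ p ∈ S, ∀ y ∈ B, eval y p = 0)
    (hB : ∀ y ∈ zariskiClosure Z, (∀ p ∈ S, eval y p = 0) → eval y u ≠ 0 → y ∈ B) :
    (d : WithBot ℕ∞) ≤ ringKrullDim (MvPolynomial σ ℂ ⧸ Q) + S.card := by
  have hQp : Q.IsPrime := hQ.1.1
  have hIQ : vanishingIdeal ℂ Z ≤ Q :=
    (vanishingIdeal_le_of_subset_zariskiClosure hBZ).trans hQ.1.2
  obtain ⟨P, hP, hPQ⟩ := Ideal.exists_minimalPrimes_le hIQ
  have hPp : P.IsPrime := hP.1.1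
  have hJ : P ⊔ Ideal.span (S : Set (MvPolynomial σ ℂ)) ≤ Q := by
    refine sup_le hPQ (Ideal.span_le.2 fun p hp => ?_)
    exact hQ.1.2 (mem_vanishingIdeal'.2 (hBS p hp))
  obtain ⟨Q', hQ', hQQ⟩ := Ideal.exists_minimalPrimes_le hJ
  have hQ'p : Q'.IsPrime := hQ'.1.1
  -- Since `u` is not in `Q'`, the points of `Q'` with `u` nonzero are dense, and they belong to
  -- `B`. Minimality of `Q` then gives `Q = Q'`, to which Krull's height theorem applies.
  have hBQ : vanishingIdeal ℂ B ≤ Q' := by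
    intro p hp
    have h1 : u * p ∈ vanishingIdeal ℂ (zeroLocus ℂ Q') := by
      refine mem_vanishingIdeal'.2 fun y hy => ?_
      rw [eval_mul, mul_eq_zero, or_iff_not_imp_left]
      intro hyu
      refine mem_vanishingIdeal'.1 hp y (hB y ?_ ?_ hyu)
      · exact mem_zeroLocus'.2 fun g hg =>
          mem_zeroLocus'.1 hy g (hQ'.1.2 (Ideal.mem_sup_left (hP.1.2 hg)))
      · exact fun g hg => mem_zeroLocus'.1 hy g
          (hQ'.1.2 (Ideal.mem_sup_right (Ideal.subset_span hg)))
    rw [IsPrime.vanishingIdeal_zeroLocus] at h1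
    exact (hQ'p.mem_or_mem h1).resolve_left fun h => hu (hQQ h)
  have hQeq : Q = Q' := le_antisymm (hQ.2 ⟨hQ'p, hBQ⟩ hQQ) hQQ
  obtain ⟨s, hs⟩ := exists_ringKrullDim_quotient_eq P
  exact (hZ P hP).trans (hQeq ▸ ringKrullDim_le_of_mem_minimalPrimes_sup_span P S Q' hQ')

/-- A closed subset which is avoided by the generic points of `A` has smaller dimension. -/
theorem ringKrullDim_lt_of_generic {A B : Set (σ → ℂ)} {d : ℕ}
    (hA : ∀ P ∈ (vanishingIdeal ℂ A).minimalPrimes, ringKrullDim (MvPolynomial σ ℂ ⧸ P) ≤ d)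
    (hBA : B ⊆ zariskiClosure A)
    (h : ∀ a ∈ A, ∃ c : MvPolynomial σ ℂ, eval a c ≠ 0 ∧ ∀ b ∈ B, eval b c = 0)
    {Q : Ideal (MvPolynomial σ ℂ)} (hQ : Q ∈ (vanishingIdeal ℂ B).minimalPrimes) :
    ringKrullDim (MvPolynomial σ ℂ ⧸ Q) < d := by
  have hQp : Q.IsPrime := hQ.1.1
  obtain ⟨P, hP, hPQ⟩ := Ideal.exists_minimalPrimes_le
    ((vanishingIdeal_le_of_subset_zariskiClosure hBA).trans hQ.1.2)
  have hPp : P.IsPrime := hP.1.1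
  -- Were the two equal, the polynomial vanishing on `B` but not at a generic point of `P` in `A`
  -- would give a contradiction.
  have hlt : P < Q := by
    refine lt_of_le_of_ne hPQ ?_
    rintro rfl
    obtain ⟨q, hq, -, hqP, -⟩ := exists_generic_point' hP
      (fun h1 => hPp.ne_top ((Ideal.eq_top_iff_one _).2 h1))
    obtain ⟨c, hc, hcB⟩ := h q hq
    exact hc (mem_zeroLocus'.1 hqP c (hQ.1.2 (mem_vanishingIdeal'.2 hcB)))
  have h1 := (ringKrullDim_add_one_le_of_lt hlt).trans (hA P hP)
  obtain ⟨s, hs⟩ := exists_ringKrullDim_quotient_eq Q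
  rw [hs] at h1 ⊢
  norm_cast at h1 ⊢

/-- A set of dimension at most `d` is a finite union of sets with tangent spaces of dimension at
most `d`. -/
theorem exists_stratification (A : Set (σ → ℂ)) (d : ℕ)
    (hA : ∀ P ∈ (vanishingIdeal ℂ A).minimalPrimes, ringKrullDim (MvPolynomial σ ℂ ⧸ P) ≤ d) :
    ∃ s : Set (Set (σ → ℂ)), s.Finite ∧ A = ⋃₀ s ∧
      ∀ E ∈ s, ∀ q ∈ E, Module.finrank ℂ (tangentSpace E q) ≤ d := by
  -- Noetherian induction on the vanishing ideal: the part where a good polynomial `h` is nonzero is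
  -- split off, and the rest has a strictly larger ideal.
  have hwf : WellFounded ((· > ·) : Ideal (MvPolynomial σ ℂ) → _ → Prop) :=
    wellFounded_gt
  generalize hI : vanishingIdeal ℂ A = I
  induction I using hwf.induction generalizing A with
  | h I ih =>
    subst hI
    rcases Set.eq_empty_or_nonempty A with rfl | hne
    · exact ⟨∅, Set.finite_empty, by simp, by simp⟩
    have key : ∀ P ∈ (vanishingIdeal ℂ A).minimalPrimes, ∃ h ∉ P, ∀ q ∈ A, eval q h ≠ 0 →
        Module.finrank ℂ (tangentSpace A q) ≤ d := by
      intro P hP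
      have hPp : P.IsPrime := hP.1.1
      obtain ⟨h, hh, hq⟩ := exists_tangentSpace_eq_of_mem_minimalPrimes hP
      obtain ⟨g, hg, hq'⟩ := exists_finrank_tangentSpace_eq P
      refine ⟨h * g, fun hm => (hPp.mem_or_mem hm).elim hh hg, fun q hqA hqe => ?_⟩
      rw [eval_mul] at hqe
      obtain ⟨h1, h2⟩ := hq q hqA (left_ne_zero_of_mul hqe)
      rw [h2]
      have h3 := (hq' q h1 (right_ne_zero_of_mul hqe)).le.trans (hA P hP)
      exact_mod_cast h3
    have hne_top : vanishingIdeal ℂ A ≠ ⊤ := by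
      obtain ⟨a, ha⟩ := hne
      intro htop
      have : (1 : MvPolynomial σ ℂ) ∈ vanishingIdeal ℂ A := by rw [htop]; trivial
      simpa using mem_vanishingIdeal'.1 this a ha
    obtain ⟨⟨P, hP⟩⟩ := Ideal.nonempty_minimalPrimes hne_top
    obtain ⟨h, hhP, hh⟩ := key P hP
    let A' : Set (σ → ℂ) := {q | q ∈ A ∧ eval q h = 0}
    have hle : vanishingIdeal ℂ A ≤ vanishingIdeal ℂ A' := vanishingIdeal_anti_mono fun q hq => hq.1
    have hlt : vanishingIdeal ℂ A' > vanishingIdeal ℂ A := by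
      refine lt_of_le_of_ne hle fun heq => hhP (hP.1.2 ?_)
      rw [heq]
      exact mem_vanishingIdeal'.2 fun q hq => hq.2
    have hA' : ∀ P ∈ (vanishingIdeal ℂ A').minimalPrimes,
        ringKrullDim (MvPolynomial σ ℂ ⧸ P) ≤ d := by
      rw [← ringKrullDim_quotient_le_iff] at hA ⊢
      exact (ringKrullDim_le_of_surjective (Ideal.Quotient.factor hle)
        (Ideal.Quotient.factor_surjective hle)).trans hA
    obtain ⟨s, hs, hsA, hsd⟩ := ih _ hlt A' hA' rfl
    refine ⟨insert {q | q ∈ A ∧ eval q h ≠ 0} s, hs.insert _, ?_, ?_⟩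
    · rw [Set.sUnion_insert, ← hsA]
      ext q
      by_cases hq : eval q h = 0 <;> simp [A', hq]
    · rintro E (rfl | hE) q hq
      · exact (Submodule.finrank_mono (tangentSpace_mono (fun q hq => hq.1) q)).trans
          (hh q hq.1 hq.2)
      · exact hsd E hE q hq

theorem exists_le_of_mem_minimalPrimes_sUnion {s : Set (Set (σ → ℂ))} (hs : s.Finite)
    {Q : Ideal (MvPolynomial σ ℂ)} [Q.IsPrime] (hQ : vanishingIdeal ℂ (⋃₀ s) ≤ Q) :
    ∃ E ∈ s, vanishingIdeal ℂ E ≤ Q := by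
  classical
  by_contra hno
  push Not at hno
  have h1 : ∀ E ∈ s, ∃ p, p ∈ vanishingIdeal ℂ E ∧ p ∉ Q := fun E hE =>
    Set.not_subset.1 (hno E hE)
  choose! p hp hpQ using h1
  have h2 : ∏ E ∈ hs.toFinset, p E ∈ Q := by
    refine hQ (mem_vanishingIdeal'.2 ?_)
    rintro y ⟨E, hE, hy⟩
    rw [map_prod]
    exact Finset.prod_eq_zero (hs.mem_toFinset.2 hE) (mem_vanishingIdeal'.1 (hp E hE) y hy)
  obtain ⟨E, hE, hEQ⟩ := (Ideal.IsPrime.prod_mem_iff).1 h2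
  exact hpQ E (hs.mem_toFinset.1 hE) hEQ

end Dimension

/-! ### Transversality to a generic linear subspace. -/

section Kleiman

variable {N m : ℕ}

theorem mem_prodH {H : Submodule ℂ (Fin N → ℂ)} {v : Fin N ⊕ Fin N → ℂ} :
    v ∈ prodH H ↔ v ∘ Sum.inr ∈ H := Iff.rfl

/-- A linear form in the second variable, as a polynomial. -/
noncomputable def linPoly (φ : Module.Dual ℂ (Fin N → ℂ)) : MvPolynomial (Fin N ⊕ Fin N) ℂ :=
  ∑ l, C (φ (Pi.single l 1)) * X (Sum.inr l)

theorem sum_dual_apply (φ : Module.Dual ℂ (Fin N → ℂ)) (v : Fin N → ℂ) :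
    ∑ l, φ (Pi.single l 1) * v l = φ v := by
  conv_rhs => rw [← Finset.univ_sum_single v, map_sum]
  refine Finset.sum_congr rfl fun l _ => ?_
  rw [show (Pi.single l (v l) : Fin N → ℂ) = v l • Pi.single l 1 by
    rw [← Pi.single_smul, smul_eq_mul, mul_one], map_smul, smul_eq_mul, mul_comm]

theorem eval_linPoly (φ : Module.Dual ℂ (Fin N → ℂ)) (q : Fin N ⊕ Fin N → ℂ) :
    eval q (linPoly φ) = φ (q ∘ Sum.inr) := by
  rw [← sum_dual_apply]
  simp [linPoly]

theorem dpoly_linPoly (φ : Module.Dual ℂ (Fin N → ℂ)) (q v : Fin N ⊕ Fin N → ℂ) :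
    dpoly (linPoly φ) q v = φ (v ∘ Sum.inr) := by
  rw [← sum_dual_apply]
  simp [linPoly, dpoly_sum, dpoly_C_mul, dpoly_X]

/-- A covector component outside `H` is detected by a linear form vanishing on `H`, which is an
equation of the intersection. -/
theorem tangentSpace_inter_overH_le (D : Set (Fin N ⊕ Fin N → ℂ)) (H : Submodule ℂ (Fin N → ℂ))
    (q : Fin N ⊕ Fin N → ℂ) : tangentSpace (D ∩ overH H) q ≤ tangentSpace D q ⊓ prodH H := by
  refine le_inf (tangentSpace_mono Set.inter_subset_left q) fun v hv => ?_
  rw [mem_prodH]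
  by_contra hno
  obtain ⟨φ, hφ, hφH⟩ := Submodule.exists_le_ker_of_notMem hno
  apply hφ
  rw [← dpoly_linPoly φ q]
  refine mem_tangentSpace.1 hv _ (mem_vanishingIdeal'.2 fun y hy => ?_)
  rw [eval_linPoly]
  exact hφH hy.2.1

theorem finrank_prodH_le (H : Submodule ℂ (Fin N → ℂ)) :
    Module.finrank ℂ (prodH H) ≤ N + Module.finrank ℂ H := by
  let ψ : prodH H →ₗ[ℂ] (Fin N → ℂ) × H :=
    ((LinearMap.funLeft ℂ ℂ (Sum.inl : Fin N → Fin N ⊕ Fin N)).domRestrict (prodH H)).prod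
      (LinearMap.codRestrict H
        ((LinearMap.funLeft ℂ ℂ (Sum.inr : Fin N → Fin N ⊕ Fin N)).domRestrict (prodH H))
        fun v => v.2)
  have hψ : Function.Injective ψ := by
    rintro ⟨v, hv⟩ ⟨w, hw⟩ h
    have h1 : v ∘ Sum.inl = w ∘ Sum.inl := congrArg Prod.fst h
    have h2 : v ∘ Sum.inr = w ∘ Sum.inr := congrArg Subtype.val (congrArg Prod.snd h)
    apply Subtype.ext
    ext (l | l)
    · exact congrFun h1 l
    · exact congrFun h2 l
  have := LinearMap.finrank_le_finrank_of_injective hψ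
  rwa [Module.finrank_prod, Module.finrank_fintype_fun_eq_card, Fintype.card_fin] at this

theorem finrank_inf_prodH_add_le {H : Submodule ℂ (Fin N → ℂ)}
    {T : Submodule ℂ (Fin N ⊕ Fin N → ℂ)} (h : T ⊔ prodH H = ⊤) :
    Module.finrank ℂ (T ⊓ prodH H : Submodule ℂ (Fin N ⊕ Fin N → ℂ)) + N ≤
      Module.finrank ℂ T + Module.finrank ℂ H := by
  have h1 := Submodule.finrank_sup_add_finrank_inf_eq T (prodH H)
  rw [h, finrank_top, Module.finrank_fintype_fun_eq_card, Fintype.card_sum, Fintype.card_fin] at h1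
  have := finrank_prodH_le H
  omega

/-- The span of the rows of a matrix. -/
noncomputable def rowSpan (b : Fin m × Fin N → ℂ) : Submodule ℂ (Fin N → ℂ) :=
  Submodule.span ℂ (Set.range fun j i => b (j, i))

theorem mem_rowSpan {b : Fin m × Fin N → ℂ} {ξ : Fin N → ℂ} :
    ξ ∈ rowSpan b ↔ ∃ a : Fin m → ℂ, ∀ i, ∑ j, a j * b (j, i) = ξ i := by
  rw [rowSpan, Submodule.mem_span_range_iff_exists_fun]
  refine exists_congr fun a => ?_
  rw [funext_iff]
  refine forall_congr' fun i => ?_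
  simp

theorem finrank_rowSpan_le (b : Fin m × Fin N → ℂ) : Module.finrank ℂ (rowSpan b) ≤ m := by
  have := finrank_range_le_card (R := ℂ) (fun (j : Fin m) (i : Fin N) => b (j, i))
  rwa [Set.finrank, Fintype.card_fin] at this

/-- The intersection of any set with `ℂ^N × H` is transverse for generic `H`. -/
theorem thin_not_transverse (D : Set (Fin N ⊕ Fin N → ℂ)) :
    Thin {b : Fin m × Fin N → ℂ | ∃ q ∈ D ∩ overH (rowSpan b),
      tangentSpace D q ⊔ prodH (rowSpan b) ≠ ⊤} := by
  let f : Fin m × Fin N → MvPolynomial ((Fin m × Fin N) ⊕ (Fin m ⊕ Fin N)) ℂ :=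
    fun ji => X (Sum.inl ji)
  let Ψ : Fin N ⊕ Fin N → MvPolynomial ((Fin m × Fin N) ⊕ (Fin m ⊕ Fin N)) ℂ :=
    Sum.elim (fun i => X (Sum.inr (Sum.inr i)))
      fun i => ∑ j, X (Sum.inr (Sum.inl j)) * X (Sum.inl (j, i))
  -- The bad incidence set: a point (b, a, x) stands for the pair with covector ∑ a_j b_j over `x`.
  -- It is shown that the projection to `b` is critical at all of its points.
  let A : Set ((Fin m × Fin N) ⊕ (Fin m ⊕ Fin N) → ℂ) := {z | evalMap Ψ z ∈ D ∧
    evalMap Ψ z ∘ Sum.inr ≠ 0 ∧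
    tangentSpace D (evalMap Ψ z) ⊔ prodH (rowSpan (evalMap f z)) ≠ ⊤}
  have hdΨ : ∀ z v i, dmap Ψ z v (Sum.inr i) = ∑ j, (z (Sum.inr (Sum.inl j)) * v (Sum.inl (j, i)) +
      z (Sum.inl (j, i)) * v (Sum.inr (Sum.inl j))) := by
    intro z v i
    simp [Ψ, dmap_apply, dpoly_sum, dpoly_mul, dpoly_X]
  refine Thin.mono (B' := evalMap f '' A) ?_ ?_
  · apply thin_image_of_critical
    intro z hz
    by_contra hno
    push Not at hno
    obtain ⟨hzD, hz0, hzT⟩ := hz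
    apply hzT
    have ha : ∃ j, z (Sum.inr (Sum.inl j)) ≠ 0 := by
      by_contra hall
      push Not at hall
      apply hz0
      ext i
      simp [evalMap_apply, Ψ, hall]
    obtain ⟨j₀, hj₀⟩ := ha
    rw [eq_top_iff]
    intro u _
    -- Only a row `j₀` with a nonzero coefficient is moved, so that the covector moves by exactly
    -- the given one. The variation of the coefficients contributes a combination of the rows.
    obtain ⟨v, hv, hvw⟩ := hno fun ji =>
      if ji.1 = j₀ then u (Sum.inr ji.2) / z (Sum.inr (Sum.inl j₀)) else 0
    have hvT := dmap_mem_tangentSpace (B := D) (fun z hz => hz.1) hv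
    have hvb : ∀ j i, v (Sum.inl (j, i)) =
        if j = j₀ then u (Sum.inr i) / z (Sum.inr (Sum.inl j₀)) else 0 := by
      intro j i
      have := congrFun hvw (j, i)
      simpa [f, dmap_apply, dpoly_X] using this
    have : u = dmap Ψ z v + (u - dmap Ψ z v) := by abel
    rw [this]
    refine Submodule.add_mem_sup hvT ?_
    rw [mem_prodH, ← neg_mem_iff, mem_rowSpan]
    refine ⟨fun j => v (Sum.inr (Sum.inl j)), fun i => ?_⟩
    simp only [Function.comp_apply, Pi.neg_apply, Pi.sub_apply, hdΨ, hvb, Finset.sum_add_distrib,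
      mul_ite, mul_zero, Finset.sum_ite_eq', Finset.mem_univ, if_true]
    rw [mul_div_cancel₀ _ hj₀]
    simp only [evalMap_apply, f, eval_X]
    rw [neg_sub, add_sub_cancel_left]
    exact Finset.sum_congr rfl fun j _ => mul_comm _ _
  · rintro b ⟨q, ⟨hqD, hqH, hq0⟩, hqT⟩
    obtain ⟨a, ha⟩ := mem_rowSpan.1 hqH
    have hΨq : evalMap Ψ (Sum.elim b (Sum.elim a (q ∘ Sum.inl))) = q := by
      ext (i | i)
      · simp [evalMap_apply, Ψ]
      · simpa [evalMap_apply, Ψ] using ha i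
    have hfb : evalMap f (Sum.elim b (Sum.elim a (q ∘ Sum.inl))) = b := by
      ext ji
      simp [evalMap_apply, f]
    refine ⟨Sum.elim b (Sum.elim a (q ∘ Sum.inl)), ?_, hfb⟩
    change _ ∧ _ ∧ _
    rw [hΨq, hfb]
    exact ⟨hqD, hq0, hqT⟩

/-- The intersection with `ℂ^N × H` has the expected dimension for generic `H`. -/
theorem thin_excess_dimension (D : Set (Fin N ⊕ Fin N → ℂ)) (d : ℕ)
    (hD : ∀ P ∈ (vanishingIdeal ℂ D).minimalPrimes,
      ringKrullDim (MvPolynomial (Fin N ⊕ Fin N) ℂ ⧸ P) ≤ d) :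
    Thin {b : Fin m × Fin N → ℂ |
      ¬ ∀ Q ∈ (vanishingIdeal ℂ (D ∩ overH (rowSpan b))).minimalPrimes,
        ∃ s : ℕ, ringKrullDim (MvPolynomial (Fin N ⊕ Fin N) ℂ ⧸ Q) = s ∧ s + N ≤ d + m} := by
  -- Transversality only controls tangent spaces of dimension at most `d`, so `D` is first cut into
  -- finitely many pieces having such tangent spaces.
  obtain ⟨s, hs, rfl, hsd⟩ := exists_stratification D d hD
  refine Thin.mono (thin_biUnion hs fun E _ => thin_not_transverse (m := m) E) ?_
  intro b hb
  by_contra hno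
  apply hb
  simp only [Set.mem_iUnion, Set.mem_ofPred_eq, not_exists, not_and, not_not, ne_eq] at hno
  intro Q hQ
  have hQp : Q.IsPrime := hQ.1.1
  have hun : ⋃₀ s ∩ overH (rowSpan b) = ⋃₀ ((fun E => E ∩ overH (rowSpan b)) '' s) := by
    rw [Set.sUnion_image, Set.sUnion_eq_biUnion, Set.iUnion₂_inter]
  obtain ⟨F, ⟨E, hE, rfl⟩, hEQ⟩ := exists_le_of_mem_minimalPrimes_sUnion (hs.image _)
    (Q := Q) (hun ▸ hQ.1.2)
  have hQE : Q ∈ (vanishingIdeal ℂ (E ∩ overH (rowSpan b))).minimalPrimes := by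
    refine ⟨⟨hQp, hEQ⟩, fun J hJ hJQ => hQ.2 ⟨hJ.1, le_trans ?_ hJ.2⟩ hJQ⟩
    exact vanishingIdeal_anti_mono (Set.inter_subset_inter_left _ (Set.subset_sUnion_of_mem hE))
  obtain ⟨q, hq, -, -, -, hfin⟩ := exists_generic_point' hQE
    (fun h1 => hQp.ne_top ((Ideal.eq_top_iff_one _).2 h1))
  refine ⟨_, hfin.symm, ?_⟩
  have h1 := finrank_inf_prodH_add_le (hno E hE q hq)
  have h2 := Submodule.finrank_mono (tangentSpace_inter_overH_le E (rowSpan b) q)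
  have h3 := hsd E hE q hq.1
  have h4 := finrank_rowSpan_le b
  omega

end Kleiman

end AffinePolar

namespace AffinePolar

open MvPolynomial

/-! ### Dimension of the conormal space and genericity of (P). -/

section ConormalDimension

variable {N n : ℕ} {X : Set (Fin N → ℂ)}

theorem one_notMem_of_mem_minimalPrimes {R : Type*} [CommRing R] {I Q : Ideal R}
    (hQ : Q ∈ I.minimalPrimes) : (1 : R) ∉ Q := fun h =>
  hQ.1.1.ne_top ((Ideal.eq_top_iff_one _).2 h)

/-- The upper bound comes from the tangent spaces. The lower bound holds because, near a regular
point, the `r` equations of X and the `n` conormality equations, r + n = N in total, define the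
conormal space in ℂ^(2N). -/
theorem isPureDim_conormal (hX : IsZariskiClosed X) (hdim : IsPureDim X n) :
    IsPureDim (conormal X (regularLocus X n)) N := by
  classical
  intro Q hQ
  have hQp : Q.IsPrime := hQ.1.1
  obtain ⟨q, hq, -, hqQ, -, hfin⟩ := exists_generic_point' hQ (one_notMem_of_mem_minimalPrimes hQ)
  have hle := finrank_tangentSpace_conormal_le hX hdim hq
  obtain ⟨r, e, G, d, hG, h0, hd, hdet, hloc⟩ := exists_chart hX hdim hq.1
  let eqs : Fin r ⊕ Fin n → MvPolynomial (Fin N ⊕ Fin N) ℂ :=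
    Sum.elim (fun j => rename Sum.inl (G (Sum.inl j))) fun i => pairPoly (frameField e G i)
  -- The factor `d` makes the local equations valid on the whole conormal space without changing
  -- them on the chart.
  have hcut := le_ringKrullDim_of_cut (Z := Set.univ) (d := N + N) (fun P hP => ?_)
    (Finset.univ.image fun a => rename Sum.inl d * eqs a) hQ (u := rename Sum.inl d)
    (fun h => hd ?_) (fun y _ => ?_) ?_ ?_
  · have hcard : (Finset.univ.image fun a => rename Sum.inl d * eqs a).card ≤ N := by
      refine Finset.card_image_le.trans ?_
      rw [Finset.card_univ, Fintype.card_congr e, Fintype.card_fin]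
    rw [← hfin] at hcut ⊢
    have h1 : N + N ≤ Module.finrank ℂ (tangentSpace (conormal X (regularLocus X n)) q) +
        (Finset.univ.image fun a => rename Sum.inl d * eqs a).card := by exact_mod_cast hcut
    have : Module.finrank ℂ (tangentSpace (conormal X (regularLocus X n)) q) = N := by omega
    rw [this]
  · have huniv : vanishingIdeal ℂ (Set.univ : Set (Fin N ⊕ Fin N → ℂ)) = ⊥ := by
      rw [eq_bot_iff]
      intro p hp
      rw [Ideal.mem_bot]
      exact MvPolynomial.funext fun y => by
        rw [mem_vanishingIdeal'.1 hp y trivial, map_zero]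
    rw [huniv] at hP
    have hPp : P.IsPrime := hP.1.1
    have hPbot : P = ⊥ := le_antisymm (hP.2 ⟨Ideal.isPrime_bot, le_rfl⟩ bot_le) bot_le
    rw [hPbot, ringKrullDim_eq_of_ringEquiv (RingEquiv.quotientBot _),
      MvPolynomial.ringKrullDim_of_isNoetherianRing]
    simp
  · rw [← mem_zeroLocus'.1 hqQ _ h, eval_rename]
  · exact mem_zeroLocus'.2 fun p hp => mem_vanishingIdeal'.1 hp y trivial
  · intro p hp y hy
    obtain ⟨a, -, rfl⟩ := Finset.mem_image.1 hp
    rw [eval_mul, eval_rename, mul_eq_zero, or_iff_not_imp_left]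
    intro hyd
    rcases a with j | i
    · simp only [eqs, Sum.elim_inl, eval_rename]
      exact mem_vanishingIdeal'.1 (hG j) _ hy.1.1
    · exact (forall_form_eq_zero_iff hdim hG hy.1.1 (hdet _ hyd)).1 hy.2 i
  · intro y _ hy hyd
    have hya : ∀ a, eval y (eqs a) = 0 := by
      intro a
      have := hy _ (Finset.mem_image.2 ⟨a, Finset.mem_univ _, rfl⟩)
      rw [eval_mul] at this
      exact (mul_eq_zero.1 this).resolve_left hyd
    rw [eval_rename] at hyd
    have hyX : y ∘ Sum.inl ∈ X := hloc _ hyd fun j => by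
      simpa [eqs, eval_rename] using hya (Sum.inl j)
    exact ⟨mem_regularLocus_of_frame hdim hG hyX (hdet _ hyd),
      (forall_form_eq_zero_iff hdim hG hyX (hdet _ hyd)).2 fun i => hya (Sum.inr i)⟩

/-- The intersection of the conormal space with `ℂ^N × H` is nowhere of dimension less than the
dimension of `H`. -/
theorem le_ringKrullDim_inter_overH (hX : IsZariskiClosed X) (hdim : IsPureDim X n)
    (H : Submodule ℂ (Fin N → ℂ)) {Q : Ideal (MvPolynomial (Fin N ⊕ Fin N) ℂ)}
    (hQ : Q ∈ (vanishingIdeal ℂ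
      (zariskiClosure (conormal X (regularLocus X n)) ∩ overH H)).minimalPrimes) :
    (Module.finrank ℂ H : WithBot ℕ∞) ≤ ringKrullDim (MvPolynomial (Fin N ⊕ Fin N) ℂ ⧸ Q) := by
  classical
  have hQp : Q.IsPrime := hQ.1.1
  obtain ⟨q, hq, -, hqQ, -⟩ := exists_generic_point' hQ (one_notMem_of_mem_minimalPrimes hQ)
  obtain ⟨l, hl⟩ := Function.ne_iff.1 hq.2.2
  let b := Module.finBasis ℂ H.dualAnnihilator
  have hb : ∀ ξ, (∀ a, (b a : Module.Dual ℂ (Fin N → ℂ)) ξ = 0) → ξ ∈ H := by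
    intro ξ hξ
    rw [← Subspace.forall_mem_dualAnnihilator_apply_eq_zero_iff]
    intro φ hφ
    have h1 := b.sum_repr ⟨φ, hφ⟩
    have h2 := congrArg (fun ψ : H.dualAnnihilator => (ψ : Module.Dual ℂ (Fin N → ℂ)) ξ) h1
    simp only [AddSubmonoidClass.coe_finsetSum, Submodule.coe_smul, LinearMap.sum_apply,
      LinearMap.smul_apply, hξ, smul_zero, Finset.sum_const_zero] at h2
    exact h2.symm
  have hfr := Subspace.finrank_add_finrank_dualAnnihilator_eq H
  rw [Module.finrank_fintype_fun_eq_card, Fintype.card_fin] at hfr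
  -- `H` is cut out by N - dim H linear forms. A coordinate of the covector that is nonzero at a
  -- generic point keeps away from the zero covector.
  have hcut := le_ringKrullDim_of_cut (Z := conormal X (regularLocus X n)) (d := N)
    (fun P hP => (isPureDim_conormal hX hdim P hP).ge)
    (Finset.univ.image fun a => linPoly (b a : Module.Dual ℂ (Fin N → ℂ))) hQ
    (u := MvPolynomial.X (Sum.inr l)) (fun h => hl ?_) Set.inter_subset_left ?_ ?_
  · have hcard : (Finset.univ.image fun a => linPoly (b a : Module.Dual ℂ (Fin N → ℂ))).card ≤
        Module.finrank ℂ H.dualAnnihilator := by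
      refine Finset.card_image_le.trans ?_
      rw [Finset.card_univ, Fintype.card_fin]
    obtain ⟨s, hs⟩ := exists_ringKrullDim_quotient_eq Q
    rw [hs] at hcut ⊢
    have h1 : N ≤ s + (Finset.univ.image fun a =>
      linPoly (b a : Module.Dual ℂ (Fin N → ℂ))).card := by exact_mod_cast hcut
    have h2 : Module.finrank ℂ H ≤ s := by omega
    exact_mod_cast h2
  · have := mem_zeroLocus'.1 hqQ _ h
    rwa [eval_X] at this
  · intro p hp y hy
    obtain ⟨a, -, rfl⟩ := Finset.mem_image.1 hp
    rw [eval_linPoly]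
    exact (Submodule.mem_dualAnnihilator _).1 (b a).2 _ hy.2.1
  · intro y hy hyb hyl
    refine ⟨hy, hb _ fun a => ?_, fun h0 => hyl ?_⟩
    · rw [← eval_linPoly]
      exact hyb _ (Finset.mem_image.2 ⟨a, Finset.mem_univ _, rfl⟩)
    · rw [eval_X]
      exact congrFun h0 l

/-- The part of the closed conormal space over the singular locus is small. -/
theorem ringKrullDim_singular_lt (hX : IsZariskiClosed X) (hdim : IsPureDim X n)
    {Q : Ideal (MvPolynomial (Fin N ⊕ Fin N) ℂ)}
    (hQ : Q ∈ (vanishingIdeal ℂ {q | q ∈ zariskiClosure (conormal X (regularLocus X n)) ∧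
      q ∘ Sum.inl ∉ regularLocus X n}).minimalPrimes) :
    ringKrullDim (MvPolynomial (Fin N ⊕ Fin N) ℂ ⧸ Q) < N := by
  refine ringKrullDim_lt_of_generic (A := conormal X (regularLocus X n))
    (fun P hP => (isPureDim_conormal hX hdim P hP).le) (fun q hq => hq.1) (fun a ha => ?_) hQ
  obtain ⟨d, hd, hreg⟩ := exists_eval_ne_zero_of_mem_regularLocus hdim ha.1
  refine ⟨rename Sum.inl d, by rwa [eval_rename], fun q hq => ?_⟩
  rw [eval_rename]
  by_contra h
  exact hq.2 (hreg _ (comp_inl_mem_of_mem_zariskiClosure hX hq.1) h)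

/-- The conormal spaces of `X` and of a smaller set meet in a small set. -/
theorem ringKrullDim_inter_conormal_lt (hX : IsZariskiClosed X) (hdim : IsPureDim X n)
    {S : Set (Fin N → ℂ)} (hS : algDim S < n) {Q : Ideal (MvPolynomial (Fin N ⊕ Fin N) ℂ)}
    (hQ : Q ∈ (vanishingIdeal ℂ (zariskiClosure (conormal X (regularLocus X n)) ∩
      zariskiClosure (conormal S S))).minimalPrimes) :
    ringKrullDim (MvPolynomial (Fin N ⊕ Fin N) ℂ ⧸ Q) < N := by
  have hQp : Q.IsPrime := hQ.1.1
  by_contra hno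
  rw [not_lt] at hno
  obtain ⟨P, hP, hPQ⟩ := Ideal.exists_minimalPrimes_le
    ((vanishingIdeal_le_of_subset_zariskiClosure Set.inter_subset_left).trans hQ.1.2)
  have hPp : P.IsPrime := hP.1.1
  -- Otherwise the intersection contains a whole component `P` of the conormal space of X.
  have hPQ' : P = Q := eq_of_le_of_ringKrullDim_le hPQ hQp
    ((isPureDim_conormal hX hdim P hP).le.trans hno)
  subst hPQ'
  have hSP : ∀ p ∈ vanishingIdeal ℂ S, rename Sum.inl p ∈ P := fun p hp =>
    ((vanishingIdeal_le_of_subset_zariskiClosure Set.inter_subset_right).trans hQ.1.2)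
      (rename_mem_vanishingIdeal_conormal subset_rfl hp)
  -- The closure of the projection of `P` to ℂ^N. It lies in the closure of `S` and has dimension
  -- less than `n`, while the fibre directions have dimension at most N - n, too few for a tangent
  -- space of dimension N.
  let p₀ : Ideal (MvPolynomial (Fin N) ℂ) :=
    P.comap (rename (Sum.inl : Fin N → Fin N ⊕ Fin N)).toRingHom
  have hp₀ : p₀.IsPrime := Ideal.comap_isPrime _ _
  have hmem : ∀ p, p ∈ p₀ ↔ rename Sum.inl p ∈ P := fun p => Iff.rfl
  have hdim₀ : ringKrullDim (MvPolynomial (Fin N) ℂ ⧸ p₀) < n :=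
    (ringKrullDim_le_of_surjective (Ideal.Quotient.factor (S := vanishingIdeal ℂ S) (T := p₀) hSP)
      (Ideal.Quotient.factor_surjective _)).trans_lt hS
  obtain ⟨g, hg, hgfin⟩ := exists_finrank_tangentSpace_eq p₀
  obtain ⟨q, hq, hqg, hqP, hqT, hqfin⟩ := exists_generic_point' hP (u := rename Sum.inl g)
    fun h => hg ((hmem g).2 h)
  rw [isPureDim_conormal hX hdim P hP, Nat.cast_inj] at hqfin
  have hx₀ : q ∘ Sum.inl ∈ zeroLocus ℂ p₀ := mem_zeroLocus'.2 fun p hp => by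
    rw [← eval_rename]
    exact mem_zeroLocus'.1 hqP _ ((hmem p).1 hp)
  have h1 := hgfin _ hx₀ (by rwa [eval_rename] at hqg)
  rw [← h1, Nat.cast_lt] at hdim₀
  obtain ⟨r, e, G, d, hG, h0, hd, hdet, hloc⟩ := exists_chart hX hdim hq.1
  obtain ⟨c, hc⟩ := exists_lagrange e (hdet _ hd) (ξ := q ∘ Sum.inr) (fun v hv => by
    rw [← tangentSpace_eq_frameKer hdim hG hq.1.1 (hdet _ hd)] at hv
    exact hq.2 v hv)
  have hT := tangentSpace_conormal_le hdim hG hq (hdet _ hd) hc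
  have h2 := finrank_le_of_fiber (E := tangentSpace (conormal X (regularLocus X n)) q)
    (T := tangentSpace X (q ∘ Sum.inl)) (T' := tangentSpace (zeroLocus ℂ p₀) (q ∘ Sum.inl))
    (fun v hv => ?_) (fun v hv h0 w hw => ?_)
  · rw [hqfin, hq.1.2, Fintype.card_fin] at h2
    omega
  · refine mem_tangentSpace.2 fun p hp => ?_
    rw [IsPrime.vanishingIdeal_zeroLocus] at hp
    rw [← dpoly_rename]
    rw [hqT, mem_tangentSpace, IsPrime.vanishingIdeal_zeroLocus] at hv
    exact hv _ ((hmem p).1 hp)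
  · have := (mem_graphOver.1 (hT hv)).2 w hw
    rwa [h0, map_zero, LinearMap.zero_apply, add_zero] at this

theorem finrank_rowSpan {m : ℕ} {b : Fin m × Fin N → ℂ}
    (hb : LinearIndependent ℂ fun j i => b (j, i)) : Module.finrank ℂ (rowSpan b) = m := by
  rw [rowSpan, finrank_span_eq_card hb, Fintype.card_fin]

/-- Generic subspaces satisfy the genericity conditions with respect to the conormal space. -/
theorem thin_not_polarGeneric (hnN : n < N) (hX : IsZariskiClosed X) (hdim : IsPureDim X n)
    {strata : Set (Set (Fin N → ℂ))} (hS : strata.Finite) (m : ℕ) :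
    Thin {b : Fin m × Fin N → ℂ | LinearIndependent ℂ (fun j i => b (j, i)) ∧
      ¬ PolarGeneric X n strata (rowSpan b)} := by
  have hpure := isPureDim_conormal hX hdim
  have hlt : ∀ {Q : Ideal (MvPolynomial (Fin N ⊕ Fin N) ℂ)}, Q.IsPrime →
      ringKrullDim (MvPolynomial (Fin N ⊕ Fin N) ℂ ⧸ Q) < N →
      ringKrullDim (MvPolynomial (Fin N ⊕ Fin N) ℂ ⧸ Q) ≤ (N - 1 : ℕ) := by
    intro Q hQ h
    obtain ⟨s, hs⟩ := exists_ringKrullDim_quotient_eq Q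
    rw [hs] at h ⊢
    norm_cast at h ⊢
    omega
  have t1 := thin_excess_dimension (m := m) (zariskiClosure (conormal X (regularLocus X n))) N
    (by rw [vanishingIdeal_zariskiClosure]; exact fun P hP => (hpure P hP).le)
  have t2 := thin_not_transverse (m := m) (conormal X (regularLocus X n))
  have t3 := thin_excess_dimension (m := m)
    {q | q ∈ zariskiClosure (conormal X (regularLocus X n)) ∧ q ∘ Sum.inl ∉ regularLocus X n}
    (N - 1) (fun Q hQ => hlt hQ.1.1 (ringKrullDim_singular_lt hX hdim hQ))
  have t4 := thin_biUnion (s := {S | S ∈ strata ∧ algDim S < n})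
    (B := fun S => {b : Fin m × Fin N → ℂ | ¬ ∀ Q ∈ (vanishingIdeal ℂ
      ((zariskiClosure (conormal X (regularLocus X n)) ∩ zariskiClosure (conormal S S)) ∩
        overH (rowSpan b))).minimalPrimes,
        ∃ s : ℕ, ringKrullDim (MvPolynomial (Fin N ⊕ Fin N) ℂ ⧸ Q) = s ∧ s + N ≤ N - 1 + m})
    (hS.subset fun S hS => hS.1) fun S hS => thin_excess_dimension _ (N - 1)
      (fun Q hQ => hlt hQ.1.1 (ringKrullDim_inter_conormal_lt hX hdim hS.2 hQ))
  refine (((t1.union t2).union t3).union t4).mono ?_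
  rintro b ⟨hb, hbad⟩
  by_contra hno
  apply hbad
  have hm := finrank_rowSpan hb
  simp only [Set.mem_union, not_or, Set.mem_ofPred_eq, not_not, Set.mem_iUnion, not_exists] at hno
  obtain ⟨⟨⟨h1, h2⟩, h3⟩, h4⟩ := hno
  refine ⟨fun Q hQ => ?_, fun q hq => ?_, ?_, fun S hSs hSn => ?_⟩
  · obtain ⟨s, hs, hsN⟩ := h1 Q hQ
    have h5 := le_ringKrullDim_inter_overH hX hdim (rowSpan b) hQ
    rw [hs, hm] at h5 ⊢
    have : m ≤ s := by exact_mod_cast h5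
    have : s = m := by omega
    rw [this]
  · by_contra hT
    exact h2 q ⟨hq, hT⟩
  -- Every component of the full intersection has dimension at least `m`, but the part over the
  -- singular locus has dimension below `m`. So each component is in the closure of the part over
  -- the regular locus.
  · intro y hy
    refine mem_zeroLocus'.2 fun p hp => ?_
    suffices p ∈ vanishingIdeal ℂ (zariskiClosure (conormal X (regularLocus X n)) ∩
        overH (rowSpan b)) from mem_vanishingIdeal'.1 this y hy
    refine mem_vanishingIdeal_of_forall_minimalPrimes fun Q hQ => ?_
    have hQp : Q.IsPrime := hQ.1.1
    obtain ⟨E, hE, hEQ⟩ := exists_le_of_mem_minimalPrimes_sUnion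
      (s := {conormal X (regularLocus X n) ∩ overH (rowSpan b),
        {q | q ∈ zariskiClosure (conormal X (regularLocus X n)) ∧ q ∘ Sum.inl ∉ regularLocus X n} ∩
          overH (rowSpan b)}) (Set.toFinite _) (Q := Q) (by
      refine le_trans (vanishingIdeal_anti_mono ?_) hQ.1.2
      rintro z ⟨hz, hzH⟩
      by_cases hzr : z ∘ Sum.inl ∈ regularLocus X n
      · exact ⟨_, Or.inl rfl, mem_conormal_of_mem_zariskiClosure hX hdim hz hzr, hzH⟩
      · exact ⟨_, Or.inr rfl, ⟨hz, hzr⟩, hzH⟩)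
    rcases hE with rfl | rfl
    · exact hEQ hp
    · exfalso
      obtain ⟨Q', hQ', hQQ⟩ := Ideal.exists_minimalPrimes_le hEQ
      obtain ⟨s, hs, hsN⟩ := h3 Q' hQ'
      have h5 := le_ringKrullDim_inter_overH hX hdim (rowSpan b) hQ
      have h6 := h5.trans (ringKrullDim_le_of_surjective (Ideal.Quotient.factor hQQ)
        (Ideal.Quotient.factor_surjective hQQ))
      rw [hs, hm] at h6
      have : m ≤ s := by exact_mod_cast h6
      omega
  · rw [hm]
    refine (ringKrullDim_quotient_lt_iff _ m).2 fun Q hQ => ?_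
    obtain ⟨s, hs, hsN⟩ := h4 S ⟨hSs, hSn⟩ Q hQ
    rw [hs, Nat.cast_lt]
    omega

end ConormalDimension

end AffinePolar

namespace AffinePolar

open MvPolynomial

/-! ### Open subsets of the Grassmannian and transversality at infinity. -/

section Grassmannian

variable {N m : ℕ}

/-- Replaces maximal minors: full row rank gives a right inverse, and each fixed `c` gives a
polynomial condition on `B`. -/
theorem linearIndependent_iff_exists_det {ι : Type*} [Fintype ι] (B : Matrix (Fin m) ι ℂ) :
    LinearIndependent ℂ (fun j i => B j i) ↔ ∃ c : Matrix ι (Fin m) ℂ, (B * c).det ≠ 0 := by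
  classical
  constructor
  · intro h
    have hr : B.rank = m := by
      have := LinearIndependent.rank_matrix (M := B) h
      rwa [Fintype.card_fin] at this
    have hs : LinearMap.range B.mulVecLin = ⊤ :=
      Submodule.eq_top_of_finrank_eq (by
        rw [Module.finrank_fintype_fun_eq_card, Fintype.card_fin]
        exact hr)
    obtain ⟨c, hc⟩ := Matrix.mulVec_surjective_iff_exists_right_inverse.1
      (LinearMap.range_eq_top.1 hs)
    exact ⟨c, by rw [hc]; simp⟩
  · rintro ⟨c, hc⟩
    have hinj : Function.Injective B.vecMul := by
      have h1 : Function.Injective (B * c).vecMul := by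
        rw [Matrix.vecMul_injective_iff_isUnit, Matrix.isUnit_iff_isUnit_det]
        exact hc.isUnit
      intro v w hvw
      apply h1
      change Matrix.vecMul v B = Matrix.vecMul w B at hvw
      change Matrix.vecMul v (B * c) = Matrix.vecMul w (B * c)
      rw [← Matrix.vecMul_vecMul, ← Matrix.vecMul_vecMul, hvw]
    exact Matrix.vecMul_injective_iff.1 hinj

/-- The determinant of `b * c`, as a polynomial in `b`. -/
noncomputable def detPoly (c : Matrix (Fin N) (Fin m) ℂ) : MvPolynomial (Fin m × Fin N) ℂ :=
  (Matrix.of fun j l => ∑ i, X (j, i) * C (c i l) : Matrix (Fin m) (Fin m) _).det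

theorem eval_detPoly (c : Matrix (Fin N) (Fin m) ℂ) (b : Fin m × Fin N → ℂ) :
    eval b (detPoly c) = ((Matrix.of fun j i => b (j, i)) * c).det := by
  rw [detPoly, RingHom.map_det]
  congr 1
  ext j l
  simp [Matrix.mul_apply]

theorem linearIndependent_iff_detPoly {b : Fin m × Fin N → ℂ} :
    LinearIndependent ℂ (fun j i => b (j, i)) ↔ ∃ c, eval b (detPoly c) ≠ 0 := by
  simp only [eval_detPoly]
  exact linearIndependent_iff_exists_det (Matrix.of fun j i => b (j, i))

theorem exists_detPoly_ne_zero (hm : m ≤ N) :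
    ∃ c : Matrix (Fin N) (Fin m) ℂ, detPoly c ≠ 0 := by
  let b : Fin m × Fin N → ℂ := fun ji => if Fin.castLE hm ji.1 = ji.2 then 1 else 0
  let c : Matrix (Fin N) (Fin m) ℂ := Matrix.of fun i l => if Fin.castLE hm l = i then 1 else 0
  refine ⟨c, fun h0 => ?_⟩
  have h1 := eval_detPoly c b
  have h2 : (Matrix.of fun j i => b (j, i)) * c = 1 := by
    ext j l
    rw [Matrix.mul_apply, Finset.sum_eq_single (Fin.castLE hm j)]
    · simp [b, c, Matrix.one_apply, eq_comm]
    · intro i _ hi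
      simp [b, Ne.symm hi]
    · simp
  rw [h0, map_zero, h2, Matrix.det_one] at h1
  exact zero_ne_one h1

/-- Left multiplication by a matrix, as a polynomial map. -/
noncomputable def mulLeftPoly (g : Matrix (Fin m) (Fin m) ℂ) :
    Fin m × Fin N → MvPolynomial (Fin m × Fin N) ℂ :=
  fun ji => ∑ s, C (g ji.1 s) * X (s, ji.2)

theorem evalMap_mulLeftPoly (g : Matrix (Fin m) (Fin m) ℂ) (b : Fin m × Fin N → ℂ) (j : Fin m)
    (i : Fin N) : evalMap (mulLeftPoly g) b (j, i) = ∑ s, g j s * b (s, i) := by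
  simp [evalMap_apply, mulLeftPoly]

theorem rowSpan_le_iff {b : Fin m × Fin N → ℂ} {H : Submodule ℂ (Fin N → ℂ)} :
    rowSpan b ≤ H ↔ ∀ j, (fun i => b (j, i)) ∈ H := by
  rw [rowSpan, Submodule.span_le, Set.range_subset_iff]
  rfl

/-- The bad bases lie in {F = 0}, which need not be invariant under change of basis. The subspaces
having at least one basis with `F` nonzero form the open set. -/
theorem exists_isZariskiOpenDenseGr (hm : m ≤ N) {p : Submodule ℂ (Fin N → ℂ) → Prop}
    (h : Thin {b : Fin m × Fin N → ℂ | LinearIndependent ℂ (fun j i => b (j, i)) ∧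
      ¬ p (rowSpan b)}) :
    ∃ Ω : Set (Submodule ℂ (Fin N → ℂ)), IsZariskiOpenDenseGr m Ω ∧ ∀ H ∈ Ω, p H := by
  obtain ⟨F, hF, hFb⟩ := h
  refine ⟨{H | ∃ b : Fin m × Fin N → ℂ, LinearIndependent ℂ (fun j i => b (j, i)) ∧
    rowSpan b = H ∧ eval b F ≠ 0}, ⟨?_, ?_, ?_⟩, ?_⟩
  · rintro _ ⟨b, hb, rfl, -⟩
    exact finrank_rowSpan hb
  -- A basis `b` is good exactly if for some matrix `g` the rows of `g b` are independent and `F` is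
  -- nonzero there; the generators are these conditions for all `g` and all test matrices `c`.
  · refine ⟨Ideal.span (Set.range fun gc : Matrix (Fin m) (Fin m) ℂ × Matrix (Fin N) (Fin m) ℂ =>
      bind₁ (mulLeftPoly gc.1) (detPoly gc.2 * F)), ?_⟩
    ext b
    rw [zeroLocus_span, Set.mem_compl_iff]
    constructor
    · intro hb
      rintro _ ⟨⟨g, c⟩, rfl⟩
      by_contra hne
      change eval b _ ≠ 0 at hne
      rw [eval_bind₁, eval_mul] at hne
      apply hb
      set b' := evalMap (mulLeftPoly g) b with hb'
      have hLI' : LinearIndependent ℂ (fun j i => b' (j, i)) :=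
        linearIndependent_iff_detPoly.2 ⟨c, left_ne_zero_of_mul hne⟩
      have hle : rowSpan b' ≤ rowSpan b := by
        rw [rowSpan_le_iff]
        intro j
        rw [mem_rowSpan]
        exact ⟨g j, fun i => (evalMap_mulLeftPoly g b j i).symm⟩
      have heq : rowSpan b' = rowSpan b := by
        refine Submodule.eq_of_le_of_finrank_le hle ?_
        rw [finrank_rowSpan hLI']
        exact finrank_rowSpan_le b
      refine ⟨?_, b', hLI', heq, right_ne_zero_of_mul hne⟩
      rw [linearIndependent_iff_card_le_finrank_span, Fintype.card_fin, Set.finrank]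
      exact (finrank_rowSpan hLI').ge.trans (Submodule.finrank_mono hle)
    · rintro hb ⟨hLI, b', hLI', hspan, hne⟩
      have hmem : ∀ j, ∃ a : Fin m → ℂ, ∀ i, ∑ s, a s * b (s, i) = b' (j, i) := by
        intro j
        have hspan' : rowSpan b' = rowSpan b := hspan
        refine (mem_rowSpan (ξ := fun i => b' (j, i))).1 ?_
        rw [← hspan']
        exact rowSpan_le_iff.1 le_rfl j
      choose g hg using hmem
      obtain ⟨c, hc⟩ := linearIndependent_iff_detPoly.1 hLI'
      have h1 := hb _ ⟨(Matrix.of g, c), rfl⟩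
      have h2 : evalMap (mulLeftPoly (Matrix.of g)) b = b' := by
        ext ⟨j, i⟩
        rw [evalMap_mulLeftPoly]
        exact hg j i
      change eval b _ = 0 at h1
      rw [eval_bind₁, h2, eval_mul] at h1
      exact mul_ne_zero hc hne h1
  · obtain ⟨c, hc⟩ := exists_detPoly_ne_zero hm
    have hd := (isZariskiOpenDense_ne_zero (mul_ne_zero hc hF)).2
    rw [Set.eq_univ_iff_forall] at hd ⊢
    intro y
    refine mem_zeroLocus'.2 fun p hp => mem_zeroLocus'.1 (hd y) p ?_
    refine vanishingIdeal_anti_mono ?_ hp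
    intro b hb
    rw [Set.mem_ofPred_eq, eval_mul] at hb
    have hLI := linearIndependent_iff_detPoly.2 ⟨c, left_ne_zero_of_mul hb⟩
    exact ⟨hLI, b, hLI, rfl, right_ne_zero_of_mul hb⟩
  · rintro _ ⟨b, hb, rfl, hne⟩
    by_contra hp
    exact hne (hFb b ⟨hb, hp⟩)

theorem mem_commonKer {H : Submodule ℂ (Fin N → ℂ)} {v : Fin N → ℂ} :
    v ∈ commonKer H ↔ ∀ ξ ∈ H, form ξ v = 0 := by
  simp [commonKer, Submodule.mem_iInf]

theorem mem_commonKer_span {ι : Type*} {ω : ι → Fin N → ℂ} {v : Fin N → ℂ} :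
    v ∈ commonKer (Submodule.span ℂ (Set.range ω)) ↔ ∀ j, form (ω j) v = 0 := by
  rw [mem_commonKer]
  constructor
  · exact fun h j => h _ (Submodule.subset_span ⟨j, rfl⟩)
  · intro h ξ hξ
    have hform : ∀ ξ, form ξ v = form v ξ := fun ξ => by
      simp only [form_apply, mul_comm]
    have : Submodule.span ℂ (Set.range ω) ≤ LinearMap.ker (form v) := by
      rw [Submodule.span_le]
      rintro _ ⟨j, rfl⟩
      rw [SetLike.mem_coe, LinearMap.mem_ker, ← hform, h]
    rw [hform]
    exact this hξ

theorem thin_not_transverse_at_infinity (T : Set (Fin (N + 1) → ℂ))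
    (hT : ∀ z ∈ T, (fun i : Fin N => z i.succ) ≠ 0) :
    Thin {b : Fin m × Fin N → ℂ | ∃ z ∈ T, (fun i : Fin N => z i.succ) ∈ commonKer (rowSpan b) ∧
      (tangentSpace T z).map (LinearMap.funLeft ℂ ℂ (Fin.succ : Fin N → Fin (N + 1))) ⊔
        commonKer (rowSpan b) ≠ ⊤} := by
  let f : Fin m × Fin N → MvPolynomial ((Fin m × Fin N) ⊕ Fin (N + 1)) ℂ := fun ji => X (Sum.inl ji)
  let g : Fin (N + 1) → MvPolynomial ((Fin m × Fin N) ⊕ Fin (N + 1)) ℂ := fun i => X (Sum.inr i)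
  let R : Fin m → MvPolynomial ((Fin m × Fin N) ⊕ Fin (N + 1)) ℂ := fun j =>
    ∑ i : Fin N, X (Sum.inl (j, i)) * X (Sum.inr i.succ)
  let A : Set ((Fin m × Fin N) ⊕ Fin (N + 1) → ℂ) := {y | evalMap g y ∈ T ∧
    (∀ j, eval y (R j) = 0) ∧
    (tangentSpace T (evalMap g y)).map (LinearMap.funLeft ℂ ℂ (Fin.succ : Fin N → Fin (N + 1))) ⊔
        commonKer (rowSpan (evalMap f y)) ≠ ⊤}
  refine Thin.mono (B' := evalMap f '' A) ?_ ?_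
  · apply thin_image_of_critical
    intro y hy
    by_contra hno
    push Not at hno
    obtain ⟨hyT, hyR, hyne⟩ := hy
    apply hyne
    obtain ⟨i₀, hi₀⟩ := Function.ne_iff.1 (hT _ hyT)
    have hi₀' : y (Sum.inr i₀.succ) ≠ 0 := by simpa [g, evalMap_apply] using hi₀
    rw [eq_top_iff]
    intro u _
    -- Only the column `i₀`, where the point has a nonzero coordinate, is moved. The entries are
    -- chosen so that the differentiated incidence equations put the difference of `u` and the
    -- point's variation into the common kernel.
    obtain ⟨v, hv, hvw⟩ := hno fun ji => if ji.2 = i₀ then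
      -(∑ i, y (Sum.inl (ji.1, i)) * u i) / y (Sum.inr i₀.succ) else 0
    have hvT := dmap_mem_tangentSpace (B := T) (fun z hz => hz.1) hv
    have hvb : ∀ j i, v (Sum.inl (j, i)) = if i = i₀ then
        -(∑ i, y (Sum.inl (j, i)) * u i) / y (Sum.inr i₀.succ) else 0 := by
      intro j i
      have := congrFun hvw (j, i)
      simpa [f, dmap_apply, dpoly_X] using this
    have hgv : ∀ i, dmap g y v i = v (Sum.inr i) := fun i => by simp [g, dmap_apply, dpoly_X]
    have : u = (fun i : Fin N => dmap g y v i.succ) +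
        (u - fun i : Fin N => dmap g y v i.succ) := by abel
    rw [this]
    refine Submodule.add_mem_sup ⟨_, hvT, rfl⟩ ?_
    rw [rowSpan, mem_commonKer_span]
    intro j
    have hR := mem_tangentSpace.1 hv (R j) (mem_vanishingIdeal'.2 fun z hz => hz.2.1 j)
    simp only [R, dpoly_sum, dpoly_mul, dpoly_X, eval_X, hvb, mul_ite, mul_zero,
      Finset.sum_add_distrib, Finset.sum_ite_eq', Finset.mem_univ, if_true] at hR
    rw [mul_div_cancel₀ _ hi₀'] at hR
    simp only [form_apply, Pi.sub_apply, hgv, mul_sub, Finset.sum_sub_distrib, evalMap_apply, f,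
      eval_X]
    linear_combination -hR
  · rintro b ⟨z, hzT, hzb, hzne⟩
    have hg : evalMap g (Sum.elim b z) = z := by
      ext i; simp [g, evalMap_apply]
    have hf : evalMap f (Sum.elim b z) = b := by
      ext i; simp [f, evalMap_apply]
    refine ⟨Sum.elim b z, ?_, hf⟩
    change _ ∧ _ ∧ _
    rw [hg, hf]
    refine ⟨hzT, fun j => ?_, hzne⟩
    rw [rowSpan, mem_commonKer_span] at hzb
    simpa [R, form_apply] using hzb j

/-- Generic subspaces satisfy the transversality condition at infinity. -/
theorem thin_not_transGeneric {X : Set (Fin N → ℂ)} {hatStrata : Set (Set (Fin (N + 1) → ℂ))}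
    (hhat : IsWhitneyStratification (projCone X) hatStrata) (m : ℕ) :
    Thin {b : Fin m × Fin N → ℂ | LinearIndependent ℂ (fun j i => b (j, i)) ∧
      ¬ TransGeneric hatStrata (rowSpan b)} := by
  have h := thin_biUnion (s := {T | T ∈ hatStrata ∧ ∀ z ∈ T, z 0 = 0})
    (hhat.finite.subset fun T hT => hT.1)
    (fun T hT => thin_not_transverse_at_infinity (m := m) T fun z hz h0 => ?_)
  · refine h.mono ?_
    rintro b ⟨-, hb⟩
    by_contra hno
    apply hb
    intro T hT hT0 z hz hzb
    by_contra hne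
    exact hno (Set.mem_biUnion (x := T) ⟨hT, hT0⟩ ⟨z, hz, hzb, hne⟩)
  · have hmem : z ∈ projCone X := by
      rw [← hhat.sUnion_eq]
      exact ⟨T, hT.1, hz⟩
    apply hmem.2
    ext i
    refine Fin.cases ?_ (fun i => ?_) i
    · exact hT.2 z hz
    · exact congrFun h0 i

end Grassmannian

end AffinePolar

namespace AffinePolar

open MvPolynomial

/-! ### Images of dominant maps. -/

section Chevalley

variable {σ κ : Type} [Fintype σ] [Fintype κ]

theorem not_thin_univ : ¬ Thin (Set.univ : Set (κ → ℂ)) := by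
  rintro ⟨F, hF, h⟩
  exact hF (MvPolynomial.funext fun x => by rw [h x trivial, map_zero])

theorem isZariskiClosed_setOf (s : Set (MvPolynomial σ ℂ)) :
    IsZariskiClosed {y : σ → ℂ | ∀ p ∈ s, eval y p = 0} :=
  ⟨Ideal.span s, by rw [zeroLocus_span]; rfl⟩

open PrimeSpectrum in
/-- A dominant polynomial map on a basic locally closed set contains a dense open set in its
image. -/
theorem exists_ne_zero_subset_image {B : Set (σ → ℂ)} (hB : IsZariskiClosed B)
    (u : MvPolynomial σ ℂ) (f : κ → MvPolynomial σ ℂ)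
    (h : ¬ Thin (evalMap f '' {y | y ∈ B ∧ eval y u ≠ 0})) :
    ∃ F : MvPolynomial κ ℂ, F ≠ 0 ∧ ∀ t, eval t F ≠ 0 →
      ∃ y ∈ B, eval y u ≠ 0 ∧ evalMap f y = t := by
  obtain ⟨I, rfl⟩ := hB
  let φ : MvPolynomial κ ℂ →+* MvPolynomial σ ℂ := (bind₁ f).toRingHom
  have hφ : φ.FinitePresentation := by
    let : Algebra (MvPolynomial κ ℂ) (MvPolynomial σ ℂ) := φ.toAlgebra
    have : IsScalarTower ℂ (MvPolynomial κ ℂ) (MvPolynomial σ ℂ) :=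
      IsScalarTower.of_algebraMap_eq fun c => ((bind₁ f).commutes c).symm
    have h1 : Algebra.FiniteType (MvPolynomial κ ℂ) (MvPolynomial σ ℂ) :=
      Algebra.FiniteType.of_restrictScalars_finiteType ℂ _ _
    exact Algebra.FinitePresentation.of_finiteType.1 h1
  obtain ⟨s, hs⟩ := (isNoetherianRing_iff_ideal_fg _).1 inferInstance I
  let g : Fin s.card → MvPolynomial σ ℂ := fun i => (s.equivFin.symm i : MvPolynomial σ ℂ)
  have hg : Ideal.span (Set.range g) = I := by
    rw [← hs]
    congr 1
    ext p
    constructor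
    · rintro ⟨i, rfl⟩
      exact (s.equivFin.symm i).2
    · intro hp
      exact ⟨s.equivFin ⟨p, hp⟩, by simp [g]⟩
  let K : ConstructibleSetData (MvPolynomial σ ℂ) := {⟨u, s.card, g⟩}
  have hK : ∀ p : PrimeSpectrum (MvPolynomial σ ℂ), p ∈ K.toSet ↔ I ≤ p.asIdeal ∧ u ∉ p.asIdeal := by
    intro p
    rw [← hg, Ideal.span_le]
    simp [K, ConstructibleSetData.toSet, BasicConstructibleSetData.toSet, PrimeSpectrum.mem_zeroLocus]
  -- By Chevalley the image in the spectrum is constructible. The generic point is in it, so the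
  -- equations of some basic piece `C` are zero and its inequation `C.f` defines the required open
  -- set.
  obtain ⟨L, hL⟩ := exists_constructibleSetData_iff.2
    (isConstructible_comap_image hφ K.isConstructible_toSet)
  obtain ⟨Q, hQ, hQf⟩ := exists_algebraicIndependent_of_not_thin h
  have hQp : Q.IsPrime := hQ.1.1
  have hQK : (⟨Q, hQp⟩ : PrimeSpectrum (MvPolynomial σ ℂ)) ∈ K.toSet := by
    rw [hK]
    refine ⟨le_trans (fun p hp => mem_vanishingIdeal'.2 fun y hy => mem_zeroLocus'.1 hy.1 p hp)
      hQ.1.2, fun hu => ?_⟩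
    obtain ⟨q, hq, -, hqQ, -⟩ := exists_generic_point' hQ (one_notMem_of_mem_minimalPrimes hQ)
    exact hq.2 (mem_zeroLocus'.1 hqQ u hu)
  have hcomap : Q.comap φ = ⊥ := by
    rw [eq_bot_iff]
    intro p hp
    rw [Ideal.mem_comap] at hp
    rw [Ideal.mem_bot]
    refine hQf.eq_zero_of_aeval_eq_zero p ?_
    have h1 : aeval (fun j => Ideal.Quotient.mk Q (f j)) p = Ideal.Quotient.mk Q (bind₁ f p) := by
      rw [bind₁, ← Ideal.Quotient.mkₐ_eq_mk ℂ, ← AlgHom.comp_apply, comp_aeval]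
    rw [h1]
    exact Ideal.Quotient.eq_zero_iff_mem.2 hp
  have hgen : comap φ ⟨Q, hQp⟩ ∈ L.toSet := by
    rw [hL]
    exact ⟨_, hQK, rfl⟩
  obtain ⟨C, hC, hCgen⟩ := Set.mem_iUnion₂.1 hgen
  have hCg : ∀ i, C.g i = 0 := by
    intro i
    have h1 : C.g i ∈ Q.comap φ := hCgen.1 ⟨i, rfl⟩
    rwa [hcomap, Ideal.mem_bot] at h1
  refine ⟨C.f, fun h0 => hCgen.2 ?_, fun t ht => ?_⟩
  · rw [h0]
    rintro _ rfl
    exact Ideal.zero_mem _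
  · let mt : Ideal (MvPolynomial κ ℂ) := vanishingIdeal ℂ {t}
    have hmt : mt.IsPrime := by
      refine ⟨fun htop => ?_, fun {p q} hpq => ?_⟩
      · have : (1 : MvPolynomial κ ℂ) ∈ mt := by rw [htop]; trivial
        simpa using mem_vanishingIdeal'.1 this t rfl
      · have := mem_vanishingIdeal'.1 hpq t rfl
        rw [eval_mul, mul_eq_zero] at this
        refine this.imp ?_ ?_ <;>
        · intro h1
          refine mem_vanishingIdeal'.2 ?_
          rintro _ rfl
          exact h1
    have hmem : (⟨mt, hmt⟩ : PrimeSpectrum (MvPolynomial κ ℂ)) ∈ L.toSet := by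
      refine Set.mem_iUnion₂.2 ⟨C, hC, ?_, fun h1 => ht ?_⟩
      · rintro _ ⟨i, rfl⟩
        rw [hCg]
        exact Ideal.zero_mem _
      · exact mem_vanishingIdeal'.1 (h1 rfl) t rfl
    rw [hL] at hmem
    obtain ⟨p, hpK, hpt⟩ := hmem
    obtain ⟨hIp, hup⟩ := (hK p).1 hpK
    have hpp := p.isPrime
    have hpt' : p.asIdeal.comap φ = mt := congrArg PrimeSpectrum.asIdeal hpt
    -- The prime `p` lies over the maximal ideal of `t`. The Nullstellensatz gives a closed point of
    -- `p` with `u` nonzero, and this point still maps to `t`.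
    rw [← IsPrime.vanishingIdeal_zeroLocus (K := ℂ) p.asIdeal, mem_vanishingIdeal'] at hup
    push Not at hup
    obtain ⟨y, hy, hyu⟩ := hup
    refine ⟨y, mem_zeroLocus'.2 fun a ha => mem_zeroLocus'.1 hy a (hIp ha), hyu, ?_⟩
    ext j
    have h1 : (X j - MvPolynomial.C (t j) : MvPolynomial κ ℂ) ∈ mt := by
      refine mem_vanishingIdeal'.2 ?_
      rintro _ rfl
      simp
    rw [← hpt', Ideal.mem_comap] at h1
    have h2 := mem_zeroLocus'.1 hy _ h1
    change eval y (bind₁ f _) = 0 at h2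
    rw [eval_bind₁] at h2
    simpa [sub_eq_zero] using h2

end Chevalley

/-! ### Number of points in general fibres. -/

section Fibres

variable {σ κ : Type} [Fintype σ] [Fintype κ]

/-- If the `f j` are independent, every coordinate is algebraic over them by the dimension bound,
and its equation limits the values on a fibre wherever the leading coefficient survives. If they are
dependent, the general fibre is empty. -/
theorem exists_fibre_bound_of_prime (Q : Ideal (MvPolynomial σ ℂ)) [Q.IsPrime]
    (f : κ → MvPolynomial σ ℂ)
    (hQ : ringKrullDim (MvPolynomial σ ℂ ⧸ Q) ≤ (Fintype.card κ : WithBot ℕ∞)) :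
    ∃ M : ℕ, ∃ F : MvPolynomial κ ℂ, F ≠ 0 ∧ ∀ t, eval t F ≠ 0 →
      (zeroLocus ℂ Q ∩ {y | evalMap f y = t}).encard ≤ M := by
  classical
  by_cases hf : AlgebraicIndependent ℂ fun j => Ideal.Quotient.mk Q (f j)
  · have key : ∀ l, ∃ g : Polynomial (MvPolynomial κ ℂ), g ≠ 0 ∧ ∀ y ∈ zeroLocus ℂ Q,
        (g.map (eval (evalMap f y))).eval (y l) = 0 := by
      intro l
      have hno : ¬ AlgebraicIndependent ℂ fun o : Option κ =>
          Ideal.Quotient.mk Q (o.elim (X l) f) := by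
        intro hind
        have h1 := (card_le_ringKrullDim hind).trans hQ
        rw [Nat.cast_le, Fintype.card_option] at h1
        omega
      rw [algebraicIndependent_iff] at hno
      push Not at hno
      obtain ⟨G, hG, hG0⟩ := hno
      refine ⟨optionEquivLeft ℂ κ G, by simpa using hG0, fun y hy => ?_⟩
      rw [← optionEquivLeft_elim_eval]
      have h1 : aeval (fun o : Option κ => Ideal.Quotient.mk Q (o.elim (X l) f)) G =
          Ideal.Quotient.mk Q (bind₁ (fun o : Option κ => o.elim (X l) f) G) := by
        rw [bind₁, ← Ideal.Quotient.mkₐ_eq_mk ℂ, ← AlgHom.comp_apply, comp_aeval]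
      rw [h1, Ideal.Quotient.eq_zero_iff_mem] at hG
      have h2 := mem_zeroLocus'.1 hy _ hG
      rw [eval_bind₁] at h2
      rw [← h2]
      congr 2
      ext o
      cases o <;> simp [evalMap_apply]
    choose g hg hgy using key
    refine ⟨∏ l, (g l).natDegree, ∏ l, (g l).leadingCoeff,
      Finset.prod_ne_zero_iff.2 fun l _ => Polynomial.leadingCoeff_ne_zero.2 (hg l),
      fun t ht => ?_⟩
    rw [map_prod, Finset.prod_ne_zero_iff] at ht
    have hsub : (zeroLocus ℂ Q ∩ {y | evalMap f y = t}) ⊆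
        (Fintype.piFinset fun l => ((g l).map (eval t)).roots.toFinset : Set (σ → ℂ)) := by
      rintro y ⟨hy, rfl⟩
      rw [Finset.mem_coe, Fintype.mem_piFinset]
      intro l
      rw [Multiset.mem_toFinset, Polynomial.mem_roots']
      refine ⟨fun h0 => ht l (Finset.mem_univ _) ?_, hgy l y hy⟩
      have := congrArg (fun p : Polynomial ℂ => p.coeff (g l).natDegree) h0
      simpa using this
    refine (Set.encard_le_encard hsub).trans ?_
    rw [Set.encard_coe_eq_coe_finsetCard, Nat.cast_le, Fintype.card_piFinset]
    refine Finset.prod_le_prod' fun l _ => ?_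
    exact (Multiset.toFinset_card_le _).trans ((Polynomial.card_roots' _).trans
      Polynomial.natDegree_map_le)
  · rw [algebraicIndependent_iff] at hf
    push Not at hf
    obtain ⟨G, hG, hG0⟩ := hf
    refine ⟨0, G, hG0, fun t ht => ?_⟩
    rw [Nat.cast_zero, nonpos_iff_eq_zero, Set.encard_eq_zero, Set.eq_empty_iff_forall_notMem]
    rintro y ⟨hy, rfl⟩
    have h1 : aeval (fun j => Ideal.Quotient.mk Q (f j)) G = Ideal.Quotient.mk Q (bind₁ f G) := by
      rw [bind₁, ← Ideal.Quotient.mkₐ_eq_mk ℂ, ← AlgHom.comp_apply, comp_aeval]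
    rw [h1, Ideal.Quotient.eq_zero_iff_mem] at hG
    have h2 := mem_zeroLocus'.1 hy _ hG
    rw [eval_bind₁] at h2
    exact ht h2

theorem exists_fibre_bound {P : Set (σ → ℂ)} (f : κ → MvPolynomial σ ℂ)
    (hP : ∀ Q ∈ (vanishingIdeal ℂ P).minimalPrimes,
      ringKrullDim (MvPolynomial σ ℂ ⧸ Q) ≤ (Fintype.card κ : WithBot ℕ∞)) :
    ∃ M : ℕ, ∃ F : MvPolynomial κ ℂ, F ≠ 0 ∧ ∀ t, eval t F ≠ 0 →
      (P ∩ {y | evalMap f y = t}).encard ≤ M := by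
  classical
  have hfin := (vanishingIdeal ℂ P).finite_minimalPrimes_of_isNoetherianRing (MvPolynomial σ ℂ)
  have key : ∀ Q ∈ (vanishingIdeal ℂ P).minimalPrimes, ∃ M : ℕ, ∃ F : MvPolynomial κ ℂ, F ≠ 0 ∧
      ∀ t, eval t F ≠ 0 → (zeroLocus ℂ Q ∩ {y | evalMap f y = t}).encard ≤ M := by
    intro Q hQ
    have hQp : Q.IsPrime := hQ.1.1
    exact exists_fibre_bound_of_prime Q f (hP Q hQ)
  choose! M F hF hFt using key
  refine ⟨∑ Q ∈ hfin.toFinset, M Q, ∏ Q ∈ hfin.toFinset, F Q,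
    Finset.prod_ne_zero_iff.2 fun Q hQ => hF Q (hfin.mem_toFinset.1 hQ), fun t ht => ?_⟩
  rw [map_prod, Finset.prod_ne_zero_iff] at ht
  have hsub : P ∩ {y | evalMap f y = t} ⊆
      ⋃ Q ∈ hfin.toFinset, zeroLocus ℂ Q ∩ {y | evalMap f y = t} := by
    rintro y ⟨hy, hyt⟩
    obtain ⟨Q, hQ, hyQ⟩ := exists_minimalPrimes_le_of_mem hy
    exact Set.mem_biUnion (hfin.mem_toFinset.2 hQ) ⟨hyQ, hyt⟩
  refine (Set.encard_le_encard hsub).trans ?_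
  have hle : ∀ s : Finset (Ideal (MvPolynomial σ ℂ)), s ⊆ hfin.toFinset →
      (⋃ Q ∈ s, zeroLocus ℂ Q ∩ {y | evalMap f y = t}).encard ≤ (∑ Q ∈ s, M Q : ℕ) := by
    intro s
    induction s using Finset.induction_on with
    | empty => simp
    | insert Q s hQs ih =>
      intro hs
      rw [Finset.set_biUnion_insert, Finset.sum_insert hQs]
      refine (Set.encard_union_le _ _).trans ?_
      rw [Nat.cast_add]
      have hQm := hs (Finset.mem_insert_self Q s)
      exact add_le_add (hFt Q (hfin.mem_toFinset.1 hQm) t (ht Q hQm))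
        (ih fun R hR => hs (Finset.mem_insert_of_mem hR))
  exact hle _ subset_rfl

/-- The set of parameters with at least `d` points in the fibre is not Zariski dense, or contains
an open dense set. -/
theorem exists_ne_zero_le_encard {P : Set (σ → ℂ)} (hP : IsZariskiClosed P)
    (f : κ → MvPolynomial σ ℂ) (d : ℕ)
    (h : ¬ Thin {t | (d : ℕ∞) ≤ (P ∩ {y | evalMap f y = t}).encard}) :
    ∃ F : MvPolynomial κ ℂ, F ≠ 0 ∧ ∀ t, eval t F ≠ 0 →
      (d : ℕ∞) ≤ (P ∩ {y | evalMap f y = t}).encard := by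
  classical
  -- Equations of the `d`-fold fibre product: `d` points of `P` with a common image `t`.
  let s : Set (MvPolynomial ((Fin d × σ) ⊕ κ) ℂ) :=
    {p | ∃ i, ∃ p₀ ∈ vanishingIdeal ℂ P, p = rename (fun l => Sum.inl (i, l)) p₀} ∪
      {p | ∃ i j, p = rename (fun l => Sum.inl (i, l)) (f j) - X (Sum.inr j)}
  let B : Set ((Fin d × σ) ⊕ κ → ℂ) := {y | ∀ p ∈ s, eval y p = 0}
  have hB : IsZariskiClosed B := isZariskiClosed_setOf s
  have hPcl := hP.zariskiClosure_eq
  have hmemB : ∀ y, y ∈ B ↔ ∀ i, (fun l => y (Sum.inl (i, l))) ∈ P ∧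
      evalMap f (fun l => y (Sum.inl (i, l))) = y ∘ Sum.inr := by
    intro y
    constructor
    · intro hy i
      constructor
      · rw [← hPcl]
        refine mem_zeroLocus'.2 fun p hp => ?_
        have := hy _ (Or.inl ⟨i, p, hp, rfl⟩)
        rwa [eval_rename] at this
      · ext j
        have := hy _ (Or.inr ⟨i, j, rfl⟩)
        rw [eval_sub, eval_rename, eval_X, sub_eq_zero] at this
        exact this
    · rintro hy _ (⟨i, p, hp, rfl⟩ | ⟨i, j, rfl⟩)
      · rw [eval_rename]
        exact mem_vanishingIdeal'.1 hp _ (hy i).1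
      · rw [eval_sub, eval_rename, eval_X, sub_eq_zero]
        exact congrFun (hy i).2 j
  -- Distinctness of the `d` points: `l` selects for each pair a coordinate in which the two points
  -- differ. The value `none` serves the diagonal pairs, which the product omits; elsewhere it gives
  -- the factor 0.
  let u : (Fin d × Fin d → Option σ) → MvPolynomial ((Fin d × σ) ⊕ κ) ℂ := fun l =>
    ∏ ij ∈ Finset.univ.filter fun ij : Fin d × Fin d => ij.1 ≠ ij.2,
      (l ij).elim 0 fun a => X (Sum.inl (ij.1, a)) - X (Sum.inl (ij.2, a))
  let pr : κ → MvPolynomial ((Fin d × σ) ⊕ κ) ℂ := fun j => X (Sum.inr j)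
  have hpr : ∀ y, evalMap pr y = y ∘ Sum.inr := fun y => by
    ext j; simp [pr, evalMap_apply]
  have hback : ∀ l y, y ∈ B → eval y (u l) ≠ 0 →
      (d : ℕ∞) ≤ (P ∩ {z | evalMap f z = y ∘ Sum.inr}).encard := by
    intro l y hy hyu
    rw [map_prod, Finset.prod_ne_zero_iff] at hyu
    have hinj : Function.Injective fun (i : Fin d) (a : σ) => y (Sum.inl (i, a)) := by
      intro i j hij
      by_contra hne
      apply hyu (i, j) (by simp [hne])
      cases l (i, j) with
      | none => simp
      | some a =>
        rw [Option.elim_some, eval_sub, eval_X, eval_X, sub_eq_zero]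
        exact congrFun hij a
    have h1 : (d : ℕ∞) = (Set.range fun (i : Fin d) (a : σ) => y (Sum.inl (i, a))).encard := by
      rw [← Set.image_univ, hinj.encard_image, Set.encard_univ]
      simp
    rw [h1]
    refine Set.encard_le_encard ?_
    rintro _ ⟨i, rfl⟩
    exact (hmemB y).1 hy i
  have hcover : {t | (d : ℕ∞) ≤ (P ∩ {y | evalMap f y = t}).encard} ⊆
      ⋃ l ∈ (Set.univ : Set (Fin d × Fin d → Option σ)),
        evalMap pr '' {y | y ∈ B ∧ eval y (u l) ≠ 0} := by
    intro t ht
    obtain ⟨s', hs', hcard⟩ := Set.exists_subset_encard_eq ht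
    have hfin : s'.Finite := Set.finite_of_encard_eq_coe hcard
    have hc : hfin.toFinset.card = d := by
      rw [hfin.encard_eq_coe_toFinset_card] at hcard
      exact_mod_cast hcard
    let e := hfin.toFinset.equivFinOfCardEq hc
    let z : Fin d → σ → ℂ := fun i => (e.symm i : σ → ℂ)
    have hz : ∀ i, z i ∈ P ∩ {y | evalMap f y = t} := fun i =>
      hs' (hfin.mem_toFinset.1 (e.symm i).2)
    have hzinj : Function.Injective z := fun i j hij => e.symm.injective (Subtype.ext hij)
    have hex : ∀ ij : Fin d × Fin d, ∃ a : Option σ, ij.1 ≠ ij.2 → ∃ l, a = some l ∧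
        z ij.1 l ≠ z ij.2 l := by
      intro ij
      by_cases hij : ij.1 = ij.2
      · exact ⟨none, fun h => absurd hij h⟩
      · obtain ⟨l, hl⟩ := Function.ne_iff.1 (fun h => hij (hzinj h))
        exact ⟨some l, fun _ => ⟨l, rfl, hl⟩⟩
    choose l hl using hex
    let y : (Fin d × σ) ⊕ κ → ℂ := Sum.elim (fun ia => z ia.1 ia.2) t
    refine Set.mem_biUnion (x := l) trivial ⟨y, ⟨(hmemB y).2 fun i => ?_, ?_⟩, hpr y⟩
    · exact ⟨(hz i).1, (hz i).2⟩
    · rw [map_prod, Finset.prod_ne_zero_iff]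
      intro ij hij
      obtain ⟨a, ha, hza⟩ := hl ij (Finset.mem_filter.1 hij).2
      rw [ha, Option.elim_some, eval_sub, eval_X, eval_X, sub_ne_zero]
      exact hza
  have hl : ∃ l, ¬ Thin (evalMap pr '' {y | y ∈ B ∧ eval y (u l) ≠ 0}) := by
    by_contra hno
    push Not at hno
    exact h ((thin_biUnion Set.finite_univ fun l _ => hno l).mono hcover)
  obtain ⟨l, hl⟩ := hl
  obtain ⟨F, hF, hFt⟩ := exists_ne_zero_subset_image hB (u l) pr hl
  refine ⟨F, hF, fun t ht => ?_⟩
  obtain ⟨y, hy, hyu, rfl⟩ := hFt t ht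
  rw [hpr]
  exact hback l y hy hyu

/-- The number of points in the general fibre of a map which is generically finite. -/
theorem exists_generic_fibre_card {P : Set (σ → ℂ)} (hP : IsZariskiClosed P)
    (f : κ → MvPolynomial σ ℂ)
    (hdim : ∀ Q ∈ (vanishingIdeal ℂ P).minimalPrimes,
      ringKrullDim (MvPolynomial σ ℂ ⧸ Q) ≤ (Fintype.card κ : WithBot ℕ∞)) :
    ∃ d : ℕ, ∃ F : MvPolynomial κ ℂ, F ≠ 0 ∧ ∀ t, eval t F ≠ 0 →
      (P ∩ {y | evalMap f y = t}).encard = d := by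
  classical
  -- The degree is one less than the least `d` for which having at least `d` points is a thin
  -- condition.
  have hex : ∃ d : ℕ, Thin {t | (d : ℕ∞) ≤ (P ∩ {y | evalMap f y = t}).encard} := by
    obtain ⟨M, F, hF, hFt⟩ := exists_fibre_bound f hdim
    refine ⟨M + 1, F, hF, fun t ht => ?_⟩
    by_contra h0
    have h1 := ht.trans (hFt t h0)
    rw [Nat.cast_le] at h1
    omega
  have h0 : Nat.find hex ≠ 0 := by
    intro h0
    have := Nat.find_spec hex
    rw [h0] at this
    refine not_thin_univ (κ := κ) (this.mono fun t _ => ?_)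
    simp
  obtain ⟨d, hd⟩ := Nat.exists_eq_succ_of_ne_zero h0
  obtain ⟨F₁, hF₁, h1⟩ := exists_ne_zero_le_encard hP f d
    (Nat.find_min hex (by rw [hd]; exact Nat.lt_succ_self d))
  obtain ⟨F₂, hF₂, h2⟩ := Nat.find_spec hex
  refine ⟨d, F₁ * F₂, mul_ne_zero hF₁ hF₂, fun t ht => ?_⟩
  rw [eval_mul] at ht
  refine le_antisymm ?_ (h1 t (left_ne_zero_of_mul ht))
  by_contra hlt
  apply right_ne_zero_of_mul ht
  apply h2
  rw [hd]
  rw [not_le] at hlt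
  change ((d + 1 : ℕ) : ℕ∞) ≤ _
  rw [Nat.cast_add, Nat.cast_one]
  exact Order.add_one_le_of_lt hlt

end Fibres

end AffinePolar

namespace AffinePolar

open MvPolynomial

/-! ### Completion of independent functions to a frame. -/

section FrameExtension

variable {σ α : Type} [Fintype σ] [Fintype α] [DecidableEq α]

/-- Functions with independent differentials can be completed to a frame. -/
theorem exists_frame_extension (g : α → MvPolynomial σ ℂ) (x : σ → ℂ)
    (hg : Function.Surjective (dmap g x)) :
    ∃ (d : ℕ) (e : α ⊕ Fin d ≃ σ) (G : α ⊕ Fin d → MvPolynomial σ ℂ),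
      (∀ a, G (Sum.inl a) = g a) ∧ (∀ i, eval x (G (Sum.inr i)) = 0) ∧
      eval x (jacDet e G) ≠ 0 := by
  classical
  set K := LinearMap.ker (dmap g x) with hK
  have hrank := LinearMap.finrank_range_add_finrank_ker (dmap g x)
  rw [LinearMap.range_eq_top.2 hg, finrank_top, Module.finrank_fintype_fun_eq_card,
    Module.finrank_fintype_fun_eq_card] at hrank
  obtain ⟨π, hπ⟩ := K.exists_isCompl.imp fun K' h => h
  -- The coordinates of a projection onto the kernel of dg complete the differentials of `g` to a
  -- basis.
  let pr : (σ → ℂ) →ₗ[ℂ] K := Submodule.projectionOnto K π hπ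
  have hpr : ∀ v : K, pr v = v := fun v => Submodule.projectionOnto_apply_left hπ v
  let b := Module.finBasis ℂ K
  let ℓ : Fin (Module.finrank ℂ K) → MvPolynomial σ ℂ := fun i =>
    ∑ l, C (b.coord i (pr (Pi.single l 1))) * (X l - C (x l))
  have hℓ : ∀ i v, dpoly (ℓ i) x v = b.coord i (pr v) := by
    intro i v
    simp only [ℓ, dpoly_sum, dpoly_C_mul, dpoly_sub, dpoly_X, dpoly_C, sub_zero]
    conv_rhs => rw [← Finset.univ_sum_single v, map_sum, map_sum]
    refine Finset.sum_congr rfl fun l _ => ?_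
    rw [show (Pi.single l (v l) : σ → ℂ) = v l • Pi.single l 1 by
      rw [← Pi.single_smul, smul_eq_mul, mul_one], map_smul, map_smul, smul_eq_mul, mul_comm]
  let e : α ⊕ Fin (Module.finrank ℂ K) ≃ σ := Fintype.equivOfCardEq (by
    rw [Fintype.card_sum, Fintype.card_fin]; exact hrank)
  refine ⟨_, e, Sum.elim g ℓ, fun _ => rfl, fun i => by simp [ℓ], ?_⟩
  rw [eval_jacDet_ne_zero_iff, injective_iff_map_eq_zero]
  intro v hv
  have hvK : v ∈ K := by
    rw [hK, LinearMap.mem_ker]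
    ext a
    exact congrFun hv (Sum.inl a)
  have h1 : ∀ i, b.coord i ⟨v, hvK⟩ = 0 := by
    intro i
    have := congrFun hv (Sum.inr i)
    rw [dmap_apply, Sum.elim_inr, hℓ, show pr v = ⟨v, hvK⟩ from hpr ⟨v, hvK⟩] at this
    exact this
  have h2 : (⟨v, hvK⟩ : K) = 0 := b.forall_coord_eq_zero_iff.1 h1
  exact congrArg Subtype.val h2

end FrameExtension

/-! ### Derivatives along a parametrization. -/

section Param

variable {σ : Type} [Fintype σ] {β : Type} [Fintype β]

theorem mem_tangentSpace_of_param {A : Set (σ → ℂ)} {φ : (β → ℂ) → (σ → ℂ)}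
    (hφ : AnalyticAt ℂ φ 0) (hA : ∀ᶠ u in 𝓝 0, φ u ∈ A) (v : β → ℂ) :
    fderiv ℂ φ 0 v ∈ tangentSpace A (φ 0) := by
  refine mem_tangentSpace.2 fun p hp => ?_
  have h1 := hasFDerivAt_eval_comp p hφ.differentiableAt
  have h2 : HasFDerivAt (fun u => eval (φ u) p) (0 : (β → ℂ) →L[ℂ] ℂ) 0 :=
    (hasFDerivAt_const (0 : ℂ) 0).congr_of_eventuallyEq
      (hA.mono fun u hu => mem_vanishingIdeal'.1 hp _ hu)
  exact congrArg (fun L : (β → ℂ) →L[ℂ] ℂ => L v) (h1.unique h2)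

/-- The second derivative at a critical point is given by the Hessian. -/
theorem fderiv_fderiv_eval_comp {φ : (β → ℂ) → (σ → ℂ)} (hφ : AnalyticAt ℂ φ 0)
    {p : MvPolynomial σ ℂ} (hp : dpoly p (φ 0) = 0) (v w : β → ℂ) :
    fderiv ℂ (fderiv ℂ fun u => eval (φ u) p) 0 v w =
      hess p (φ 0) (fderiv ℂ φ 0 v) (fderiv ℂ φ 0 w) := by
  classical
  have hψ := analyticAt_eval_comp hφ p
  have h0 : ∀ l, eval (φ 0) (pderiv l p) = 0 := by
    intro l
    have := congrArg (fun L : (σ → ℂ) →ₗ[ℂ] ℂ => L (Pi.single l 1)) hp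
    simpa [dpoly_apply, Pi.single_apply] using this
  have h1 : HasFDerivAt (fun u => fderiv ℂ (fun u => eval (φ u) p) u w)
      ((ContinuousLinearMap.apply ℂ ℂ w).comp (fderiv ℂ (fderiv ℂ fun u => eval (φ u) p) 0)) 0 :=
    (ContinuousLinearMap.apply ℂ ℂ w).hasFDerivAt.comp 0
      hψ.fderiv.differentiableAt.hasFDerivAt
  have h2 : ∀ᶠ u in 𝓝 (0 : β → ℂ), fderiv ℂ (fun u => eval (φ u) p) u w =
      ∑ l, eval (φ u) (pderiv l p) * fderiv ℂ φ u w l := by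
    filter_upwards [hφ.eventually_analyticAt] with u hu
    rw [(hasFDerivAt_eval_comp p hu.differentiableAt).fderiv]
    exact dpoly_apply _ _ _
  have h3 : ∀ l, HasFDerivAt (fun u => fderiv ℂ φ u w l)
      (((ContinuousLinearMap.proj l : (σ → ℂ) →L[ℂ] ℂ).comp
        (ContinuousLinearMap.apply ℂ (σ → ℂ) w)).comp (fderiv ℂ (fderiv ℂ φ) 0)) 0 := fun l =>
    ((ContinuousLinearMap.proj l : (σ → ℂ) →L[ℂ] ℂ).comp
        (ContinuousLinearMap.apply ℂ (σ → ℂ) w)).hasFDerivAt.comp 0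
      hφ.fderiv.differentiableAt.hasFDerivAt
  have h4 : HasFDerivAt (fun u => ∑ l, eval (φ u) (pderiv l p) * fderiv ℂ φ u w l) _ 0 :=
    HasFDerivAt.fun_sum fun l _ =>
      (hasFDerivAt_eval_comp (pderiv l p) hφ.differentiableAt).mul (h3 l)
  have h5 := h1.unique (h4.congr_of_eventuallyEq h2)
  have h6 := congrArg (fun L : (β → ℂ) →L[ℂ] ℂ => L v) h5
  refine Eq.trans h6 ?_
  -- At a critical point of `p` the terms containing second derivatives of `φ` are multiplied by
  -- first derivatives of `p` and drop out.
  rw [hess_apply, _root_.sum_apply]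
  refine Finset.sum_congr rfl fun l _ => ?_
  rw [_root_.add_apply, _root_.smul_apply,
    _root_.smul_apply, h0, zero_smul, zero_add, smul_eq_mul, mul_comm]
  rfl

end Param

/-! ### Linear forms and parametrized slices. -/

section Slice

variable {N n k : ℕ} {X : Set (Fin N → ℂ)}

/-- A linear form as a polynomial. -/
noncomputable def formPoly (ξ : Fin N → ℂ) : MvPolynomial (Fin N) ℂ := ∑ l, C (ξ l) * MvPolynomial.X l

theorem eval_formPoly (ξ x : Fin N → ℂ) : eval x (formPoly ξ) = form ξ x := by
  simp [formPoly, form_apply]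

theorem dpoly_formPoly (ξ x v : Fin N → ℂ) : dpoly (formPoly ξ) x v = form ξ v := by
  simp [formPoly, form_apply, dpoly_sum, dpoly_C_mul, dpoly_X]

/-- The polynomial map `(ω_1, …, ω_k)`. -/
noncomputable def initPoly (ω : Fin (k + 1) → Fin N → ℂ) (j : Fin k) : MvPolynomial (Fin N) ℂ :=
  formPoly (initForms ω j)

theorem evalMap_initPoly (ω : Fin (k + 1) → Fin N → ℂ) (x : Fin N → ℂ) (j : Fin k) :
    evalMap (initPoly ω) x j = form (initForms ω j) x := eval_formPoly _ _

theorem mem_slicePlane_iff {ω : Fin (k + 1) → Fin N → ℂ} {t : Fin k → ℂ} {x : Fin N → ℂ} :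
    x ∈ slicePlane ω t ↔ evalMap (initPoly ω) x = t := by
  rw [funext_iff]
  simp only [evalMap_initPoly]
  rfl

theorem surjective_forms {m : ℕ} {η : Fin m → Fin N → ℂ} (h : LinearIndependent ℂ η)
    (w : Fin m → ℂ) : ∃ u : Fin N → ℂ, ∀ j, form (η j) u = w j := by
  have h1 : Matrix.rank (Matrix.of η) = m := by
    have := LinearIndependent.rank_matrix (M := Matrix.of η) h
    rwa [Fintype.card_fin] at this
  have hs : LinearMap.range (Matrix.of η).mulVecLin = ⊤ :=
    Submodule.eq_top_of_finrank_eq (by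
      rw [Module.finrank_fintype_fun_eq_card, Fintype.card_fin]
      exact h1)
  obtain ⟨u, hu⟩ := LinearMap.range_eq_top.1 hs w
  exact ⟨u, fun j => congrFun hu j⟩

theorem exists_mem_forms_eq {m : ℕ} {η : Fin m → Fin N → ℂ} (h : LinearIndependent ℂ η)
    {T : Submodule ℂ (Fin N → ℂ)}
    (hT : T ⊔ commonKer (Submodule.span ℂ (Set.range η)) = ⊤) (w : Fin m → ℂ) :
    ∃ u ∈ T, ∀ j, form (η j) u = w j := by
  obtain ⟨u, hu⟩ := surjective_forms h w
  have hu' : u ∈ T ⊔ commonKer (Submodule.span ℂ (Set.range η)) := by rw [hT]; trivial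
  obtain ⟨a, ha, b, hb, rfl⟩ := Submodule.mem_sup.1 hu'
  refine ⟨a, ha, fun j => ?_⟩
  rw [← hu j, map_add, mem_commonKer_span.1 hb j, add_zero]

/-- A form vanishing on `T ∩ ker η` is a combination of the `η_j` on `T`. -/
theorem exists_eq_sum_forms {m : ℕ} {η : Fin m → Fin N → ℂ} {T : Submodule ℂ (Fin N → ℂ)}
    {μ : (Fin N → ℂ) →ₗ[ℂ] ℂ} (h : ∀ v ∈ T, (∀ j, form (η j) v = 0) → μ v = 0) :
    ∃ c : Fin m → ℂ, ∀ v ∈ T, μ v = ∑ j, c j * form (η j) v := by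
  have h1 : μ.domRestrict T ∈ Submodule.span ℂ
      (Set.range fun j => (form (η j)).domRestrict T) := by
    apply mem_span_of_iInf_ker_le_ker
    intro v hv
    simp only [Submodule.mem_iInf, LinearMap.mem_ker] at hv
    exact h v v.2 hv
  obtain ⟨c, hc⟩ := (Submodule.mem_span_range_iff_exists_fun ℂ).1 h1
  refine ⟨c, fun v hv => ?_⟩
  have h2 := congrArg (fun L : T →ₗ[ℂ] ℂ => L ⟨v, hv⟩) hc
  simp only [LinearMap.sum_apply, LinearMap.smul_apply, smul_eq_mul] at h2
  exact h2.symm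

/-- A local parametrization of the slice of `Y`, where `Y` is `X` near a regular point `x`. -/
theorem exists_slice_param {r : ℕ} {e : Fin r ⊕ Fin n ≃ Fin N}
    {G : Fin r ⊕ Fin n → MvPolynomial (Fin N) ℂ} {x : Fin N → ℂ}
    (hdet : eval x (jacDet e G) ≠ 0) {ω : Fin (k + 1) → Fin N → ℂ}
    (hω : LinearIndependent ℂ (initForms ω))
    (hT : frameKer G x ⊔ commonKer (Submodule.span ℂ (Set.range (initForms ω))) = ⊤)
    {t : Fin k → ℂ} (hxt : x ∈ slicePlane ω t) {Y : Set (Fin N → ℂ)} (hxY : x ∈ Y)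
    (hYG : ∀ y ∈ Y, ∀ j, eval y (G (Sum.inl j)) = 0) {d : MvPolynomial (Fin N) ℂ}
    (hd : eval x d ≠ 0)
    (hdY : ∀ y, eval y d ≠ 0 → (∀ j, eval y (G (Sum.inl j)) = 0) → y ∈ Y) :
    ∃ (d : ℕ) (φ : (Fin d → ℂ) → (Fin N → ℂ)), AnalyticAt ℂ φ 0 ∧ φ 0 = x ∧
      Function.Injective (fderiv ℂ φ 0) ∧ Filter.map φ (𝓝 0) = 𝓝[Y ∩ slicePlane ω t] x ∧
      ∀ v, v ∈ frameKer G x ∧ (∀ j, form (initForms ω j) v = 0) ↔ ∃ w, fderiv ℂ φ 0 w = v := by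
  -- The equations of `Y` together with those of the plane; transversality makes their differentials
  -- independent.
  let g : Fin r ⊕ Fin k → MvPolynomial (Fin N) ℂ :=
    Sum.elim (G ∘ Sum.inl) fun j => initPoly ω j - C (t j)
  have hgd : ∀ j v, dpoly (g (Sum.inr j)) x v = form (initForms ω j) v := by
    intro j v
    simp only [g, Sum.elim_inr, dpoly_sub, dpoly_C, sub_zero, initPoly, dpoly_formPoly]
  have hsurj : Function.Surjective (dmap g x) := by
    intro w
    obtain ⟨v₁, hv₁⟩ := (bijective_dmap e hdet).2 (Sum.elim (w ∘ Sum.inl) 0)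
    obtain ⟨v₂, hv₂, hv₂'⟩ := exists_mem_forms_eq hω hT
      fun j => w (Sum.inr j) - form (initForms ω j) v₁
    refine ⟨v₁ + v₂, ?_⟩
    ext (j | j)
    · rw [dmap_apply, map_add]
      have h1 := congrFun hv₁ (Sum.inl j)
      have h2 := mem_frameKer.1 hv₂ j
      change dpoly (G (Sum.inl j)) x v₁ = w (Sum.inl j) at h1
      change dpoly (G (Sum.inl j)) x v₁ + dpoly (G (Sum.inl j)) x v₂ = _
      rw [h1, h2, add_zero]
    · rw [dmap_apply, hgd, map_add, hv₂']
      ring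
  obtain ⟨d', e', G', hG', h0', hdet'⟩ := exists_frame_extension g x hsurj
  have hgzero : ∀ y, (∀ a, eval y (g a) = 0) ↔
      (∀ j, eval y (G (Sum.inl j)) = 0) ∧ y ∈ slicePlane ω t := by
    intro y
    rw [mem_slicePlane_iff, funext_iff]
    constructor
    · intro h
      refine ⟨fun j => h (Sum.inl j), fun j => ?_⟩
      have := h (Sum.inr j)
      simp only [g, Sum.elim_inr, eval_sub, eval_C, sub_eq_zero] at this
      exact this
    · rintro ⟨h1, h2⟩ (j | j)
      · exact h1 j
      · simp only [g, Sum.elim_inr, eval_sub, eval_C, sub_eq_zero]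
        exact h2 j
  have hx0 : ∀ a, eval x (G' a) = 0 := by
    rintro (a | i)
    · rw [hG']
      exact (hgzero x).2 ⟨hYG x hxY, hxt⟩ a
    · exact h0' i
  obtain ⟨φ, hφ, hφ0, hφG, hφmap⟩ := exists_param e' hx0 hdet'
  have hφG0 : ∀ᶠ u in 𝓝 (0 : Fin d' → ℂ), ∀ a, eval (φ u) (G' a) =
      (Sum.elim 0 u : (Fin r ⊕ Fin k) ⊕ Fin d' → ℂ) a := hφG
  refine ⟨d', φ, hφ, hφ0, injective_fderiv_param hφ.differentiableAt hφG0, ?_, fun v => ?_⟩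
  · rw [hφmap]
    -- On the open set where `d` is nonzero, the zero set of all equations coincides with the slice
    -- of `Y`.
    refine nhdsWithin_eq_nhdsWithin (s := {y | eval y d ≠ 0}) hd ?_ ?_
    · exact isOpen_ne_fun (MvPolynomial.continuous_eval d) continuous_const
    · ext y
      simp only [hG', Set.mem_inter_iff, Set.mem_ofPred_eq, hgzero, and_congr_left_iff,
        and_congr_left_iff]
      intro hy _
      exact ⟨hdY y hy, fun h => hYG y h⟩
  · have hrange := range_fderiv_param e' hφ.differentiableAt hφG0 (by rw [hφ0]; exact hdet')
    rw [hφ0] at hrange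
    have h1 : (∃ w, fderiv ℂ φ 0 w = v) ↔ v ∈ frameKer G' x := by
      rw [← hrange]
      rfl
    rw [h1, mem_frameKer, mem_frameKer]
    simp only [hG']
    constructor
    · rintro ⟨h2, h3⟩ (j | j)
      · exact h2 j
      · rw [hgd]; exact h3 j
    · intro h
      exact ⟨fun j => h (Sum.inl j), fun j => by rw [← hgd]; exact h (Sum.inr j)⟩

end Slice

end AffinePolar

namespace AffinePolar

open MvPolynomial

/-! ### Cones in the covector and the Euler vector. -/

section Cones

variable {N : ℕ}

theorem card_lt_finrank {E κ : Type*} [AddCommGroup E] [Module ℂ E] [FiniteDimensional ℂ E]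
    [Fintype κ] {T : Submodule ℂ E} {L : E →ₗ[ℂ] (κ → ℂ)} (hL : ∀ w, ∃ v ∈ T, L v = w)
    {v₀ : E} (hv₀ : v₀ ∈ T) (h0 : v₀ ≠ 0) (hLv₀ : L v₀ = 0) :
    Fintype.card κ < Module.finrank ℂ T := by
  have hs : LinearMap.range (L.domRestrict T) = ⊤ := LinearMap.range_eq_top.2 fun w => by
    obtain ⟨v, hv, rfl⟩ := hL w
    exact ⟨⟨v, hv⟩, rfl⟩
  have h1 := LinearMap.finrank_range_add_finrank_ker (L.domRestrict T)
  rw [hs, finrank_top, Module.finrank_fintype_fun_eq_card] at h1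
  have h2 : 0 < Module.finrank ℂ (LinearMap.ker (L.domRestrict T)) := by
    rw [Module.finrank_pos_iff_exists_ne_zero]
    refine ⟨⟨⟨v₀, hv₀⟩, hLv₀⟩, fun h => h0 ?_⟩
    exact congrArg (fun z : LinearMap.ker (L.domRestrict T) => (z : E)) h
  omega

/-- Subsets of `ℂ^N × (ℂ^N ∖ 0)` that are cones in the second factor. -/
def IsConic (A : Set (Fin N ⊕ Fin N → ℂ)) : Prop :=
  ∀ q ∈ A, q ∘ Sum.inr ≠ 0 ∧ ∀ s : ℂ, s ≠ 0 → Sum.elim (q ∘ Sum.inl) (s • (q ∘ Sum.inr)) ∈ A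

theorem IsConic.euler_mem_tangentSpace {A : Set (Fin N ⊕ Fin N → ℂ)} (hA : IsConic A)
    {q : Fin N ⊕ Fin N → ℂ} (hq : q ∈ A) :
    (Sum.elim 0 (q ∘ Sum.inr) : Fin N ⊕ Fin N → ℂ) ∈ tangentSpace A q := by
  set w : Fin N ⊕ Fin N → ℂ := Sum.elim 0 (q ∘ Sum.inr) with hw
  let φ : (Unit → ℂ) → (Fin N ⊕ Fin N → ℂ) := fun u => q + u () • w
  have hφ : AnalyticAt ℂ φ 0 := by
    have : AnalyticAt ℂ (fun u : Unit → ℂ => u ()) 0 :=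
      (ContinuousLinearMap.proj (R := ℂ) (φ := fun _ : Unit => ℂ) ()).analyticAt 0
    exact analyticAt_const.add (this.smul analyticAt_const)
  have hd : HasFDerivAt φ
      ((ContinuousLinearMap.proj (R := ℂ) (φ := fun _ : Unit => ℂ) ()).smulRight w) 0 :=
    ((ContinuousLinearMap.proj (R := ℂ) (φ := fun _ : Unit => ℂ) ()).hasFDerivAt.smul_const
      w).const_add q
  have hφ0 : φ 0 = q := by simp [φ]
  -- The arc scales the covector by 1 + u, which is nonzero for small u; its velocity is the Euler
  -- vector.
  have h1 : ∀ᶠ u in 𝓝 (0 : Unit → ℂ), φ u ∈ A := by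
    have h2 : ∀ᶠ u in 𝓝 (0 : Unit → ℂ), 1 + u () ≠ 0 := by
      have : Continuous fun u : Unit → ℂ => 1 + u () := by fun_prop
      exact this.continuousAt.eventually_ne (by simp)
    filter_upwards [h2] with u hu
    have := (hA q hq).2 _ hu
    convert this using 1
    ext (i | i)
    · simp [φ, hw]
    · simp [φ, hw]; ring
  have h3 := mem_tangentSpace_of_param hφ h1 (fun _ => 1)
  rw [hd.fderiv, hφ0] at h3
  simpa using h3

theorem evalMap_rename_inl {κ : Type} (f : κ → MvPolynomial (Fin N) ℂ)
    (q : Fin N ⊕ Fin N → ℂ) :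
    evalMap (fun j => rename Sum.inl (f j)) q = evalMap f (q ∘ Sum.inl) := by
  ext j
  rw [evalMap_apply, evalMap_apply, eval_rename]

theorem dmap_rename_inl {κ : Type} (f : κ → MvPolynomial (Fin N) ℂ)
    (q v : Fin N ⊕ Fin N → ℂ) :
    dmap (fun j => rename Sum.inl (f j)) q v = dmap f (q ∘ Sum.inl) (v ∘ Sum.inl) := by
  ext j
  rw [dmap_apply, dmap_apply, dpoly_rename]

/-- A dominant map depending only on the base point is submersive at some `q` and kills the Euler
vector there, so the tangent space has at least one dimension to spare. -/
theorem IsConic.exists_card_lt {κ : Type} [Fintype κ] {A : Set (Fin N ⊕ Fin N → ℂ)}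
    (hA : IsConic A) {f : κ → MvPolynomial (Fin N) ℂ}
    (hf : ¬ Thin (evalMap f '' ((fun q => q ∘ Sum.inl) '' A))) :
    ∃ Q ∈ (vanishingIdeal ℂ A).minimalPrimes, ∃ q ∈ A,
      (Module.finrank ℂ (tangentSpace A q) : WithBot ℕ∞) =
        ringKrullDim (MvPolynomial (Fin N ⊕ Fin N) ℂ ⧸ Q) ∧
      Fintype.card κ < Module.finrank ℂ (tangentSpace A q) := by
  rw [Set.image_image] at hf
  have hf' : ¬ Thin (evalMap (fun j => rename Sum.inl (f j)) '' A) := by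
    rwa [show evalMap (fun j => rename Sum.inl (f j)) =
      fun q : Fin N ⊕ Fin N → ℂ => evalMap f (q ∘ Sum.inl) from
        funext (evalMap_rename_inl f)]
  obtain ⟨Q, hQ, q, hq, hdim, hsurj⟩ := exists_submersive_point hf'
  refine ⟨Q, hQ, q, hq, hdim, card_lt_finrank hsurj (hA.euler_mem_tangentSpace hq) ?_ ?_⟩
  · intro h
    apply (hA q hq).1
    ext i
    exact congrFun h (Sum.inr i)
  · rw [dmap_rename_inl]
    exact map_zero _

/-- The dimension drops under the projection of a cone. -/
theorem IsConic.ringKrullDim_image_le {A : Set (Fin N ⊕ Fin N → ℂ)} (hA : IsConic A) {m : ℕ}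
    (h : ∀ q ∈ A, Module.finrank ℂ (tangentSpace A q) ≤ m + 1)
    {Q : Ideal (MvPolynomial (Fin N) ℂ)}
    (hQ : Q ∈ (vanishingIdeal ℂ ((fun q : Fin N ⊕ Fin N → ℂ => q ∘ Sum.inl) '' A)).minimalPrimes) :
    ringKrullDim (MvPolynomial (Fin N) ℂ ⧸ Q) ≤ m := by
  have : Q.IsPrime := hQ.1.1
  -- The normalization of the component gives a dominant map to `s`-space that factors through the
  -- projection of the cone.
  obtain ⟨s, hs, g, hg, -⟩ := exists_noether_normalization (MvPolynomial (Fin N) ℂ ⧸ Q)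
  choose y hy using fun i => Ideal.Quotient.mk_surjective (I := Q) (g (MvPolynomial.X i))
  rw [hs]
  have hthin : ¬ Thin (evalMap y '' ((fun q : Fin N ⊕ Fin N → ℂ => q ∘ Sum.inl) '' A)) := by
    rintro ⟨F, hF, hF'⟩
    apply hF
    apply hg
    rw [map_zero]
    have h1 : bind₁ y F ∈ Q := hQ.1.2 (mem_vanishingIdeal'.2 fun x hx => by
      rw [eval_bind₁]
      exact hF' _ ⟨x, hx, rfl⟩)
    have h2 : (Ideal.Quotient.mkₐ ℂ Q).comp (bind₁ y) = g := by
      ext i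
      simpa using hy i
    rw [← h2]
    exact Ideal.Quotient.eq_zero_iff_mem.2 h1
  obtain ⟨-, -, q, hq, -, hlt⟩ := hA.exists_card_lt hthin
  have := h q hq
  rw [Fintype.card_fin] at hlt
  exact_mod_cast (by omega : s ≤ m)

end Cones

/-! ### The critical set and generic values of the first forms. -/

section Crit

variable {N n k : ℕ} {X : Set (Fin N → ℂ)}

theorem form_sum_smul {ι : Type*} [Fintype ι] (a : ι → ℂ) (ω : ι → Fin N → ℂ) (v : Fin N → ℂ) :
    form (∑ j, a j • ω j) v = ∑ j, a j * form (ω j) v := by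
  simp only [form_apply, Finset.sum_apply, Pi.smul_apply, smul_eq_mul, Finset.sum_mul,
    Finset.mul_sum, mul_assoc]
  exact Finset.sum_comm

/-- A dependence on the tangent space is the same as a nonzero conormal form in the span, as the
forms themselves are independent. -/
theorem mem_crit_iff {m : ℕ} {ω : Fin m → Fin N → ℂ} (hω : LinearIndependent ℂ ω)
    {x : Fin N → ℂ} : x ∈ crit X n ω ↔ x ∈ regularLocus X n ∧ ∃ a : Fin m → ℂ,
      ∑ j, a j • ω j ≠ 0 ∧ ∀ v ∈ tangentSpace X x, form (∑ j, a j • ω j) v = 0 := by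
  refine and_congr_right fun _ => ?_
  rw [Fintype.not_linearIndependent_iff]
  refine exists_congr fun a => ?_
  rw [and_comm]
  refine and_congr ?_ ?_
  · constructor
    · rintro ⟨i, hi⟩ h
      exact hi (Fintype.linearIndependent_iff.1 hω a h i)
    · intro h
      by_contra! h'
      exact h (by simp [h'])
  · simp only [form_sum_smul]
    constructor
    · intro h v hv
      have := congrArg (fun L : tangentSpace X x →ₗ[ℂ] ℂ => L ⟨v, hv⟩) h
      simpa [LinearMap.sum_apply] using this
    · intro h
      ext ⟨v, hv⟩
      simpa [LinearMap.sum_apply] using h v hv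

/-- The part of the conormal space over the span of `ω`, projecting to the critical set. -/
theorem image_inter_overH {m : ℕ} {ω : Fin m → Fin N → ℂ} (hω : LinearIndependent ℂ ω) :
    (fun q : Fin N ⊕ Fin N → ℂ => q ∘ Sum.inl) '' (conormal X (regularLocus X n) ∩
      overH (Submodule.span ℂ (Set.range ω))) = crit X n ω := by
  ext x
  rw [mem_crit_iff hω]
  constructor
  · rintro ⟨q, ⟨⟨hq1, hq2⟩, hq3, hq4⟩, rfl⟩
    obtain ⟨a, ha⟩ := (Submodule.mem_span_range_iff_exists_fun ℂ).1 hq3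
    refine ⟨hq1, a, ?_⟩
    rw [ha]
    exact ⟨hq4, hq2⟩
  · rintro ⟨hx, a, ha, ha'⟩
    exact ⟨Sum.elim x (∑ j, a j • ω j), ⟨⟨hx, ha'⟩,
      (Submodule.mem_span_range_iff_exists_fun ℂ).2 ⟨a, rfl⟩, ha⟩, rfl⟩

theorem conormal_smul {A U : Set (Fin N → ℂ)} {q : Fin N ⊕ Fin N → ℂ} (hq : q ∈ conormal A U)
    (s : ℂ) : Sum.elim (q ∘ Sum.inl) (s • (q ∘ Sum.inr)) ∈ conormal A U := by
  refine ⟨hq.1, fun v hv => ?_⟩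
  have := hq.2 v hv
  rw [form_apply] at this
  change form (s • (q ∘ Sum.inr)) v = 0
  rw [form_apply]
  simp only [Pi.smul_apply, smul_eq_mul, mul_assoc, ← Finset.mul_sum]
  rw [this, mul_zero]

theorem overH_smul {H : Submodule ℂ (Fin N → ℂ)} {q : Fin N ⊕ Fin N → ℂ} (hq : q ∈ overH H)
    {s : ℂ} (hs : s ≠ 0) : Sum.elim (q ∘ Sum.inl) (s • (q ∘ Sum.inr)) ∈ overH H :=
  ⟨H.smul_mem s hq.1, smul_ne_zero hs hq.2⟩

theorem isConic_conormal_inter_overH (A U : Set (Fin N → ℂ)) (H : Submodule ℂ (Fin N → ℂ)) :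
    IsConic (conormal A U ∩ overH H) := fun _ hq =>
  ⟨hq.2.2, fun s hs => ⟨conormal_smul hq.1 s, overH_smul hq.2 hs⟩⟩

theorem finrank_inf_prodH_le (hX : IsZariskiClosed X) (hdim : IsPureDim X n)
    {H : Submodule ℂ (Fin N → ℂ)} {q : Fin N ⊕ Fin N → ℂ}
    (hq : q ∈ conormal X (regularLocus X n))
    (h : tangentSpace (conormal X (regularLocus X n)) q ⊔ prodH H = ⊤) :
    Module.finrank ℂ (tangentSpace (conormal X (regularLocus X n)) q ⊓ prodH H :
      Submodule ℂ (Fin N ⊕ Fin N → ℂ)) ≤ Module.finrank ℂ H := by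
  have h1 := finrank_inf_prodH_add_le h
  have h2 := finrank_tangentSpace_conormal_le hX hdim hq
  omega

variable {strata : Set (Set (Fin N → ℂ))} {ω : Fin (k + 1) → Fin N → ℂ}

theorem finrank_span_forms (hω : LinearIndependent ℂ ω) :
    Module.finrank ℂ (Submodule.span ℂ (Set.range ω)) = k + 1 := by
  rw [finrank_span_eq_card hω, Fintype.card_fin]

/-- Transversality bounds the tangent spaces of the cone over the critical set by k + 1, and the
projection loses the Euler direction. -/
theorem ringKrullDim_crit_le (hX : IsZariskiClosed X) (hdim : IsPureDim X n)
    (hω : LinearIndependent ℂ ω)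
    (hgen : PolarGeneric X n strata (Submodule.span ℂ (Set.range ω)))
    {Q : Ideal (MvPolynomial (Fin N) ℂ)}
    (hQ : Q ∈ (vanishingIdeal ℂ (crit X n ω)).minimalPrimes) :
    ringKrullDim (MvPolynomial (Fin N) ℂ ⧸ Q) ≤ k := by
  rw [← image_inter_overH hω] at hQ
  refine (isConic_conormal_inter_overH _ _ _).ringKrullDim_image_le (fun q hq => ?_) hQ
  refine (Submodule.finrank_mono (tangentSpace_inter_overH_le _ _ q)).trans ?_
  exact (finrank_inf_prodH_le hX hdim hq.1 (hgen.transverse q hq)).trans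
    (finrank_span_forms hω).le

/-- The critical set is closed in the regular locus. -/
theorem mem_crit_of_mem_polarLocus (hX : IsZariskiClosed X) (hdim : IsPureDim X n)
    {x : Fin N → ℂ} (hx : x ∈ regularLocus X n) (hx' : x ∈ polarLocus X n ω) :
    x ∈ crit X n ω := by
  classical
  obtain ⟨r, e, G, d, hG, -, hd, hdet, -⟩ := exists_chart hX hdim hx
  -- On a chart, independence on the tangent space is independence of the vectors of values on the
  -- frame fields, a determinantal condition that is polynomial in the point.
  have key : ∀ y ∈ X, eval y (jacDet e G) ≠ 0 →
      (LinearIndependent ℂ (fun j => (form (ω j)).domRestrict (tangentSpace X y)) ↔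
      LinearIndependent ℂ
        (fun j (i : Fin n) => form (ω j) (evalMap (frameField e G i) y))) := by
    intro y hy hdet
    have hT := tangentSpace_eq_frameKer hdim hG hy hdet
    rw [Fintype.linearIndependent_iff, Fintype.linearIndependent_iff]
    refine forall_congr' fun g => imp_congr_left ?_
    have h1 : (∑ j, g j • (form (ω j)).domRestrict (tangentSpace X y) = 0) ↔
        ∀ v ∈ tangentSpace X y, form (∑ j, g j • ω j) v = 0 := by
      simp only [form_sum_smul]
      constructor
      · intro h v hv
        have := congrArg (fun L : tangentSpace X y →ₗ[ℂ] ℂ => L ⟨v, hv⟩) h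
        simpa [LinearMap.sum_apply] using this
      · intro h
        ext ⟨v, hv⟩
        simpa [LinearMap.sum_apply] using h v hv
    have h2 : (∑ j, g j • (fun i : Fin n => form (ω j) (evalMap (frameField e G i) y)) = 0) ↔
        ∀ i, form (∑ j, g j • ω j) (evalMap (frameField e G i) y) = 0 := by
      rw [funext_iff]
      simp only [form_sum_smul, Finset.sum_apply, Pi.smul_apply, smul_eq_mul, Pi.zero_apply]
    rw [h1, h2, hT]
    constructor
    · exact fun h i => h _ (frameField_mem_frameKer e G i y)
    · intro h v hv
      rw [← span_frameField e hdet] at hv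
      have h3 : Submodule.span ℂ (Set.range fun i => evalMap (frameField e G i) y) ≤
          LinearMap.ker (form (∑ j, g j • ω j)) := by
        rw [Submodule.span_le]
        rintro _ ⟨i, rfl⟩
        exact h i
      exact h3 hv
  refine ⟨hx, fun hli => ?_⟩
  rw [key x hx.1 (hdet x hd)] at hli
  obtain ⟨c, hc⟩ := (linearIndependent_iff_exists_det
    (Matrix.of fun j (i : Fin n) => form (ω j) (evalMap (frameField e G i) x))).1 hli
  let M : Matrix (Fin (k + 1)) (Fin n) (MvPolynomial (Fin N) ℂ) :=
    Matrix.of fun j i => ∑ l, C (ω j l) * frameField e G i l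
  let c' : Matrix (Fin n) (Fin (k + 1)) (MvPolynomial (Fin N) ℂ) := c.map C
  let D : MvPolynomial (Fin N) ℂ := (M * c').det
  have hD : ∀ y, eval y D =
      ((Matrix.of fun j (i : Fin n) => form (ω j) (evalMap (frameField e G i) y)) * c).det := by
    intro y
    simp only [D]
    rw [RingHom.map_det, RingHom.mapMatrix_apply, Matrix.map_mul]
    congr 2
    · ext j i
      simp [M, form_apply]
    · ext i j
      simp [c']
  have h1 : D * jacDet e G ∈ vanishingIdeal ℂ (crit X n ω) := by
    refine mem_vanishingIdeal'.2 fun y hy => ?_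
    rw [map_mul, mul_eq_zero, or_iff_not_imp_right]
    intro hy'
    by_contra h2
    rw [hD] at h2
    exact hy.2 ((key y hy.1.1 hy').2 ((linearIndependent_iff_exists_det _).2 ⟨c, h2⟩))
  have h2 := mem_zeroLocus'.1 hx' _ h1
  rw [map_mul, hD] at h2
  exact mul_ne_zero hc (hdet x hd) h2

theorem polarLocus_subset (hX : IsZariskiClosed X) : polarLocus X n ω ⊆ X := by
  intro x hx
  rw [← hX.zariskiClosure_eq]
  refine mem_zeroLocus'.2 fun p hp => mem_zeroLocus'.1 hx p ?_
  exact vanishingIdeal_anti_mono (fun y hy => hy.1.1) hp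

/-- The points of the polar locus outside the critical set do not meet the general slice. -/
theorem thin_polarLocus_diff_crit (hX : IsZariskiClosed X) (hdim : IsPureDim X n)
    (hω : LinearIndependent ℂ ω)
    (hgen : PolarGeneric X n strata (Submodule.span ℂ (Set.range ω))) :
    Thin (evalMap (initPoly ω) '' (polarLocus X n ω \ crit X n ω)) := by
  by_contra hthin
  obtain ⟨Q, hQ, hind⟩ := exists_algebraicIndependent_of_not_thin hthin
  have : Q.IsPrime := hQ.1.1
  have h1 := card_le_ringKrullDim hind
  rw [Fintype.card_fin] at h1
  refine absurd h1 (not_le.2 ?_)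
  -- The remaining points lie over the singular locus, so they form a set of dimension less than
  -- `k`, too small to dominate ℂ^k.
  refine ringKrullDim_lt_of_generic (A := crit X n ω)
    (fun P hP => ringKrullDim_crit_le hX hdim hω hgen hP) (fun x hx => hx.1) ?_ hQ
  intro a ha
  obtain ⟨d, hd, hd'⟩ := exists_eval_ne_zero_of_mem_regularLocus hdim ha.1
  refine ⟨d, hd, fun b hb => ?_⟩
  by_contra h2
  exact hb.2 (mem_crit_of_mem_polarLocus hX hdim (hd' b (polarLocus_subset hX hb.1) h2) hb.1)

theorem exists_polarLocus_fibre_card (hX : IsZariskiClosed X) (hdim : IsPureDim X n)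
    (hω : LinearIndependent ℂ ω)
    (hgen : PolarGeneric X n strata (Submodule.span ℂ (Set.range ω))) :
    ∃ d, HasDegree (polarLocus X n ω) ω d := by
  obtain ⟨d, F, hF, h⟩ := exists_generic_fibre_card (P := polarLocus X n ω) ⟨_, rfl⟩
    (initPoly ω) (fun Q hQ => by
      rw [Fintype.card_fin]
      rw [polarLocus, vanishingIdeal_zariskiClosure] at hQ
      exact ringKrullDim_crit_le hX hdim hω hgen hQ)
  refine ⟨d, _, isZariskiOpenDense_ne_zero hF, fun t ht => ?_⟩
  rw [← h t ht]
  congr 2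
  ext y
  exact mem_slicePlane_iff

/-- The general slice is transverse. -/
theorem thin_not_transverse_slice (D : Set (Fin N → ℂ)) (ω : Fin (k + 1) → Fin N → ℂ) :
    Thin (evalMap (initPoly ω) '' {x | x ∈ D ∧
      tangentSpace D x ⊔ commonKer (Submodule.span ℂ (Set.range (initForms ω))) ≠ ⊤}) := by
  refine thin_image_of_critical fun x hx => ?_
  by_contra! h
  apply hx.2
  rw [eq_top_iff]
  intro v _
  obtain ⟨u, hu, hu'⟩ := h fun j => form (initForms ω j) v
  refine Submodule.mem_sup.2 ⟨u, tangentSpace_mono (fun y hy => hy.1) x hu, v - u, ?_,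
    add_sub_cancel _ _⟩
  rw [mem_commonKer_span]
  intro j
  have := congrFun hu' j
  rw [dmap_apply, initPoly, dpoly_formPoly] at this
  rw [map_sub, this, sub_self]

/-- The critical points in small strata do not meet the general slice. -/
theorem thin_crit_inter_small (hω : LinearIndependent ℂ ω)
    (hgen : PolarGeneric X n strata (Submodule.span ℂ (Set.range ω)))
    {S : Set (Fin N → ℂ)} (hS : S ∈ strata) (hSX : S ⊆ X) (hSn : algDim S < n) :
    Thin (evalMap (initPoly ω) '' (crit X n ω ∩ S)) := by
  by_contra hthin
  -- This cone lies above the critical points in `S`. By (P)(d) its dimension is below k + 1, yet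
  -- dominating ℂ^k through the base requires at least k + 1.
  have hcon : IsConic (conormal X (regularLocus X n) ∩ conormal S S ∩
      overH (Submodule.span ℂ (Set.range ω))) := fun q hq =>
    ⟨hq.2.2, fun s hs => ⟨⟨conormal_smul hq.1.1 s, conormal_smul hq.1.2 s⟩, overH_smul hq.2 hs⟩⟩
  have himage : crit X n ω ∩ S ⊆ (fun q : Fin N ⊕ Fin N → ℂ => q ∘ Sum.inl) ''
      (conormal X (regularLocus X n) ∩ conormal S S ∩
        overH (Submodule.span ℂ (Set.range ω))) := by
    rintro x ⟨hx, hxS⟩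
    rw [← image_inter_overH hω] at hx
    obtain ⟨q, hq, rfl⟩ := hx
    exact ⟨q, ⟨⟨hq.1, hxS, fun v hv => hq.1.2 v (tangentSpace_mono hSX _ hv)⟩, hq.2⟩, rfl⟩
  obtain ⟨Q, hQ, q, hq, h1, h2⟩ := hcon.exists_card_lt (f := initPoly ω)
    fun h => hthin (h.mono (Set.image_mono himage))
  have h3 := hgen.small S hS hSn
  rw [finrank_span_forms hω, algDim] at h3
  have h4 : ringKrullDim (MvPolynomial (Fin N ⊕ Fin N) ℂ ⧸ vanishingIdeal ℂ
      (conormal X (regularLocus X n) ∩ conormal S S ∩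
        overH (Submodule.span ℂ (Set.range ω)))) < ((k + 1 : ℕ) : WithBot ℕ∞) := by
    refine lt_of_le_of_lt (ringKrullDim_le_of_surjective (Ideal.Quotient.factor
      (vanishingIdeal_anti_mono ?_)) (Ideal.Quotient.factor_surjective _)) h3
    exact Set.inter_subset_inter_left _
      (Set.inter_subset_inter (subset_zariskiClosure _) (subset_zariskiClosure _))
  have h5 := (ringKrullDim_quotient_lt_iff _ _).1 h4 Q hQ
  rw [← h1, Fintype.card_fin] at *
  have h6 : Module.finrank ℂ (tangentSpace (conormal X (regularLocus X n) ∩ conormal S S ∩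
    overH (Submodule.span ℂ (Set.range ω))) q) < k + 1 := by exact_mod_cast h5
  omega

/-- Over the general slice, the conormal space over `ω` projects submersively. -/
theorem thin_not_submersive (A : Set (Fin N ⊕ Fin N → ℂ)) (ω : Fin (k + 1) → Fin N → ℂ) :
    Thin (evalMap (initPoly ω) '' ((fun q : Fin N ⊕ Fin N → ℂ => q ∘ Sum.inl) ''
      {q | q ∈ A ∧ ∃ w : Fin k → ℂ, ∀ v ∈ tangentSpace A q,
        (fun j => form (initForms ω j) (v ∘ Sum.inl)) ≠ w})) := by
  rw [Set.image_image]
  have h := thin_image_of_critical (f := fun j => rename Sum.inl (initPoly ω j))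
    (A := {q | q ∈ A ∧ ∃ w : Fin k → ℂ, ∀ v ∈ tangentSpace A q,
        (fun j => form (initForms ω j) (v ∘ Sum.inl)) ≠ w}) ?_
  · refine h.mono (Set.image_congr fun q _ => ?_).le
    exact (evalMap_rename_inl _ _).symm
  · rintro q ⟨-, w, hw⟩
    refine ⟨w, fun v hv h => hw v (tangentSpace_mono (fun y hy => hy.1) q hv) ?_⟩
    rw [← h, dmap_rename_inl]
    ext j
    rw [dmap_apply, initPoly, dpoly_formPoly]

end Crit

end AffinePolar

namespace AffinePolar

open MvPolynomial

/-! ### Strata of full dimension. -/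

section OpenStrata

variable {N n : ℕ} {X S : Set (Fin N → ℂ)}

/-- The inclusion of tangent spaces at the regular point gives m ≤ n, and the failure of algDim S <
n gives n ≤ m. -/
theorem isPureDim_of_not_algDim_lt {m : ℕ} (hS : IsSmoothOfDim S m) (hSX : S ⊆ X)
    {x : Fin N → ℂ} (hxS : x ∈ S) (hx : x ∈ regularLocus X n) (hn : ¬ algDim S < n) :
    IsPureDim S n := by
  have h1 : m ≤ n := by
    rw [← hS.2.2 x hxS, ← hx.2]
    exact Submodule.finrank_mono (tangentSpace_mono hSX x)
  have h2 : n ≤ m := by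
    rw [algDim, ringKrullDim_quotient_lt_iff] at hn
    push Not at hn
    obtain ⟨Q, hQ, h⟩ := hn
    rw [hS.2.1 Q hQ] at h
    exact_mod_cast h
  rw [← le_antisymm h1 h2]
  exact hS.2.1

/-- A stratum of full dimension contains a neighbourhood of its regular points. -/
theorem exists_eval_ne_zero_of_mem_stratum (hS : IsZariskiLocallyClosed S) (hdim : IsPureDim S n)
    {x : Fin N → ℂ} (hxS : x ∈ S) {r : ℕ} (e : Fin r ⊕ Fin n ≃ Fin N)
    {G : Fin r ⊕ Fin n → MvPolynomial (Fin N) ℂ} (hG : ∀ j, G (Sum.inl j) ∈ vanishingIdeal ℂ S)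
    (h0 : ∀ i, eval x (G (Sum.inr i)) = 0) (hdet : eval x (jacDet e G) ≠ 0) :
    ∃ d, eval x d ≠ 0 ∧ ∀ y, eval y d ≠ 0 → (∀ j, eval y (G (Sum.inl j)) = 0) → y ∈ S := by
  obtain ⟨h, hx, hh⟩ := exists_mem_zariskiClosure_of_frame e hdim hG hxS h0 hdet
  obtain ⟨B, C, hB, ⟨I, rfl⟩, rfl⟩ := hS
  -- `S` is closed minus closed; the polynomial `p` keeps the neighbourhood away from the removed
  -- closed set.
  have h1 : ∃ p ∈ I, eval x p ≠ 0 := by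
    by_contra! h'
    exact hxS.2 (mem_zeroLocus'.2 h')
  obtain ⟨p, hp, hpx⟩ := h1
  refine ⟨h * p, by rw [map_mul]; exact mul_ne_zero hx hpx, fun y hy hyG => ?_⟩
  rw [map_mul] at hy
  refine ⟨?_, fun hyC => right_ne_zero_of_mul hy (mem_zeroLocus'.1 hyC p hp)⟩
  have h2 := hh y (left_ne_zero_of_mul hy) hyG
  rw [← hB.zariskiClosure_eq]
  exact mem_zeroLocus'.2 fun p hp =>
    mem_zeroLocus'.1 h2 p (vanishingIdeal_anti_mono Set.sdiff_subset hp)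

end OpenStrata

/-! ### Critical points on slices and Lagrange multipliers. -/

section Slices

variable {N n k : ℕ} {X : Set (Fin N → ℂ)} {ω : Fin (k + 1) → Fin N → ℂ} {t : Fin k → ℂ}

theorem linearIndependent_initForms (hω : LinearIndependent ℂ ω) :
    LinearIndependent ℂ (initForms ω) :=
  hω.comp _ (Fin.castSucc_injective k)

theorem form_eq_zero_of_mem_tangentSpace_slice {A : Set (Fin N → ℂ)} {x v : Fin N → ℂ}
    (hv : v ∈ tangentSpace (A ∩ slicePlane ω t) x) (j : Fin k) : form (initForms ω j) v = 0 := by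
  have := mem_tangentSpace.1 hv (formPoly (initForms ω j) - C (t j))
    (mem_vanishingIdeal'.2 fun y hy => by
      rw [map_sub, eval_formPoly, eval_C, hy.2 j, sub_self])
  rwa [dpoly_sub, dpoly_formPoly, dpoly_C, sub_zero] at this

theorem mem_tangentSpace_slice (hX : IsZariskiClosed X) (hdim : IsPureDim X n)
    (hω : LinearIndependent ℂ ω) {x : Fin N → ℂ} (hx : x ∈ regularLocus X n)
    (hT : tangentSpace X x ⊔ commonKer (Submodule.span ℂ (Set.range (initForms ω))) = ⊤)
    (hxt : x ∈ slicePlane ω t) {v : Fin N → ℂ} :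
    v ∈ tangentSpace (regularLocus X n ∩ slicePlane ω t) x ↔
      v ∈ tangentSpace X x ∧ ∀ j, form (initForms ω j) v = 0 := by
  refine ⟨fun hv => ⟨tangentSpace_mono (fun y hy => hy.1.1) x hv,
    form_eq_zero_of_mem_tangentSpace_slice hv⟩, fun hv => ?_⟩
  obtain ⟨r, e, G, d, hG, -, hd, hdet, hdX⟩ := exists_chart hX hdim hx
  have hTG := tangentSpace_eq_frameKer hdim hG hx.1 (hdet x hd)
  rw [hTG] at hT hv
  -- The slice may have more equations than those displayed; that every candidate is tangent to it
  -- is shown by a parametrization whose derivative attains all of them.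
  obtain ⟨d', φ, hφ, hφ0, -, hmap, hφT⟩ := exists_slice_param (hdet x hd)
    (linearIndependent_initForms hω) hT hxt hx
    (fun y hy j => mem_vanishingIdeal'.1 (hG j) y hy.1) hd
    (fun y hy hyG => mem_regularLocus_of_frame hdim hG (hdX y hy hyG) (hdet y hy))
  obtain ⟨w, rfl⟩ := (hφT v).1 hv
  have h1 : regularLocus X n ∩ slicePlane ω t ∈ Filter.map φ (𝓝 0) := by
    rw [hmap]
    exact self_mem_nhdsWithin
  have h2 := mem_tangentSpace_of_param hφ h1 w
  rwa [hφ0] at h2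

/-- The last form minus a combination of the other ones. -/
def reducedForm (ω : Fin (k + 1) → Fin N → ℂ) (c : Fin k → ℂ) : Fin N → ℂ :=
  ω (Fin.last k) - ∑ j, c j • initForms ω j

theorem form_reducedForm (c : Fin k → ℂ) (v : Fin N → ℂ) : form (reducedForm ω c) v =
    form (ω (Fin.last k)) v - ∑ j, c j * form (initForms ω j) v := by
  rw [← form_sum_smul]
  simp only [form_apply, reducedForm, Pi.sub_apply, sub_mul, Finset.sum_sub_distrib]

theorem reducedForm_eq (c : Fin k → ℂ) : reducedForm ω c =
    ∑ j, (Fin.snoc (fun j => - c j) 1 : Fin (k + 1) → ℂ) j • ω j := by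
  rw [Fin.sum_univ_castSucc]
  simp only [Fin.snoc_castSucc, Fin.snoc_last, one_smul, neg_smul, Finset.sum_neg_distrib]
  rw [neg_add_eq_sub]
  rfl

theorem reducedForm_ne_zero (hω : LinearIndependent ℂ ω) (c : Fin k → ℂ) :
    reducedForm ω c ≠ 0 := by
  intro h
  rw [reducedForm_eq] at h
  have := Fintype.linearIndependent_iff.1 hω _ h (Fin.last k)
  rw [Fin.snoc_last] at this
  exact one_ne_zero this

theorem exists_reducedForm (hX : IsZariskiClosed X) (hdim : IsPureDim X n)
    (hω : LinearIndependent ℂ ω) {x : Fin N → ℂ}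
    (hT : tangentSpace X x ⊔ commonKer (Submodule.span ℂ (Set.range (initForms ω))) = ⊤)
    (hx : x ∈ critPoints (regularLocus X n ∩ slicePlane ω t) (ω (Fin.last k))) :
    ∃ c, ∀ v ∈ tangentSpace X x, form (reducedForm ω c) v = 0 := by
  obtain ⟨c, hc⟩ := exists_eq_sum_forms (η := initForms ω) (T := tangentSpace X x)
    (μ := form (ω (Fin.last k))) fun v hv hv' =>
      hx.2 v ((mem_tangentSpace_slice hX hdim hω hx.1.1 hT hx.1.2).2 ⟨hv, hv'⟩)
  refine ⟨c, fun v hv => ?_⟩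
  rw [form_reducedForm, hc v hv, sub_self]

/-- Lagrange multipliers turn a critical point on the slice into a conormal form of the span.
Conversely, transversality forces any dependence on the tangent space to involve the last form. -/
theorem critPoints_slice_eq (hX : IsZariskiClosed X) (hdim : IsPureDim X n)
    (hω : LinearIndependent ℂ ω)
    (hT : ∀ x ∈ X ∩ slicePlane ω t,
      tangentSpace X x ⊔ commonKer (Submodule.span ℂ (Set.range (initForms ω))) = ⊤) :
    critPoints (regularLocus X n ∩ slicePlane ω t) (ω (Fin.last k)) =
      crit X n ω ∩ slicePlane ω t := by
  ext x
  constructor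
  · intro hx
    obtain ⟨c, hc⟩ := exists_reducedForm hX hdim hω (hT x ⟨hx.1.1.1, hx.1.2⟩) hx
    have h1 := reducedForm_ne_zero hω c
    rw [reducedForm_eq] at h1 hc
    exact ⟨(mem_crit_iff hω).2 ⟨hx.1.1, _, h1, hc⟩, hx.1.2⟩
  · rintro ⟨hx, hxt⟩
    obtain ⟨hreg, a, ha, ha'⟩ := (mem_crit_iff hω).1 hx
    have hsum : ∀ v, form (∑ j, a j • ω j) v = ∑ j, a (Fin.castSucc j) * form (initForms ω j) v +
        a (Fin.last k) * form (ω (Fin.last k)) v := fun v => by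
      rw [form_sum_smul, Fin.sum_univ_castSucc]
      rfl
    -- Without the last form the combination would vanish on the tangent space and on the common
    -- kernel, which together span everything.
    have hlast : a (Fin.last k) ≠ 0 := by
      intro h0
      apply ha
      have h1 : LinearMap.ker (form (∑ j, a j • ω j)) = ⊤ := by
        rw [eq_top_iff, ← hT x ⟨hreg.1, hxt⟩, sup_le_iff]
        refine ⟨ha', fun v hv => ?_⟩
        rw [LinearMap.mem_ker, hsum, h0, zero_mul, add_zero]
        exact Finset.sum_eq_zero fun j _ => by rw [mem_commonKer_span.1 hv j, mul_zero]
      ext i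
      have h2 := congrArg (fun L : (Fin N → ℂ) →ₗ[ℂ] ℂ => L (Pi.single i 1))
        (LinearMap.ker_eq_top.1 h1)
      simpa only [form_apply, Pi.single_apply, mul_ite, mul_one, mul_zero, Finset.sum_ite_eq',
        Finset.mem_univ, if_true, LinearMap.zero_apply, Pi.zero_apply] using h2
    refine ⟨⟨hreg, hxt⟩, fun v hv => ?_⟩
    have h1 := ha' v (tangentSpace_mono (fun y hy => hy.1.1) x hv)
    rw [hsum, Finset.sum_eq_zero fun j _ => by
      rw [form_eq_zero_of_mem_tangentSpace_slice hv j, mul_zero], zero_add] at h1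
    exact (mul_eq_zero.1 h1).resolve_left hlast

end Slices

/-! ### Nondegeneracy of the critical points. -/

section Morse

variable {N n k : ℕ} {X : Set (Fin N → ℂ)} {ω : Fin (k + 1) → Fin N → ℂ} {t : Fin k → ℂ}

/-- The kernel of `L` on `T` has dimension at most one, hence is the line of `v₀`. -/
theorem exists_smul_eq_of_finrank_le {E κ : Type*} [AddCommGroup E] [Module ℂ E]
    [FiniteDimensional ℂ E] [Fintype κ] {T : Submodule ℂ E} {L : E →ₗ[ℂ] (κ → ℂ)}
    (hL : ∀ w, ∃ v ∈ T, L v = w) (hT : Module.finrank ℂ T ≤ Fintype.card κ + 1)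
    {v₀ : E} (hv₀ : v₀ ∈ T) (h0 : v₀ ≠ 0) (hLv₀ : L v₀ = 0) {z : E} (hz : z ∈ T) (hLz : L z = 0) :
    ∃ c : ℂ, c • v₀ = z := by
  have hs : LinearMap.range (L.domRestrict T) = ⊤ := LinearMap.range_eq_top.2 fun w => by
    obtain ⟨v, hv, rfl⟩ := hL w
    exact ⟨⟨v, hv⟩, rfl⟩
  have h1 := LinearMap.finrank_range_add_finrank_ker (L.domRestrict T)
  rw [hs, finrank_top, Module.finrank_fintype_fun_eq_card] at h1
  let w₀ : LinearMap.ker (L.domRestrict T) := ⟨⟨v₀, hv₀⟩, hLv₀⟩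
  have hw₀ : w₀ ≠ 0 := fun h => h0 (congrArg (fun z : LinearMap.ker (L.domRestrict T) => (z : E)) h)
  have h2 : 0 < Module.finrank ℂ (LinearMap.ker (L.domRestrict T)) :=
    Module.finrank_pos_iff_exists_ne_zero.2 ⟨w₀, hw₀⟩
  have h3 : Module.finrank ℂ (LinearMap.ker (L.domRestrict T)) = 1 := by omega
  obtain ⟨c, hc⟩ := exists_smul_eq_of_finrank_eq_one h3 hw₀
    (⟨⟨z, hz⟩, hLz⟩ : LinearMap.ker (L.domRestrict T))
  exact ⟨c, congrArg (fun z : LinearMap.ker (L.domRestrict T) => (z : E)) hc⟩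

theorem hess_sub_C (p : MvPolynomial (Fin N) ℂ) (a : ℂ) (x : Fin N → ℂ) :
    hess (p - C a) x = hess p x := by
  ext v w
  simp [hess_apply]

theorem eval_lagrange {r : ℕ} (G : Fin r ⊕ Fin n → MvPolynomial (Fin N) ℂ) (ξ : Fin N → ℂ)
    (c : Fin r → ℂ) (x : Fin N → ℂ) : eval x (lagrange G ξ c) =
      form ξ x - ∑ j, c j * eval x (G (Sum.inl j)) := by
  simp [lagrange, form_apply]

/-- Transversality of the conormal space to `ω` yields a nondegenerate Hessian. -/
theorem eq_zero_of_hess_eq_zero (hX : IsZariskiClosed X) (hdim : IsPureDim X n)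
    (hω : LinearIndependent ℂ ω) {x ξ : Fin N → ℂ} (hξ : ξ ∈ Submodule.span ℂ (Set.range ω))
    (hξ0 : ξ ≠ 0) (hq : (Sum.elim x ξ : Fin N ⊕ Fin N → ℂ) ∈ conormal X (regularLocus X n))
    (htrans : tangentSpace (conormal X (regularLocus X n)) (Sum.elim x ξ) ⊔
      prodH (Submodule.span ℂ (Set.range ω)) = ⊤)
    (hsub : ∀ w : Fin k → ℂ, ∃ v ∈ tangentSpace (conormal X (regularLocus X n) ∩
      overH (Submodule.span ℂ (Set.range ω))) (Sum.elim x ξ),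
        (fun j => form (initForms ω j) (v ∘ Sum.inl)) = w)
    {r : ℕ} {e : Fin r ⊕ Fin n ≃ Fin N} {G : Fin r ⊕ Fin n → MvPolynomial (Fin N) ℂ}
    (hG : ∀ j, G (Sum.inl j) ∈ vanishingIdeal ℂ X) (hdet : eval x (jacDet e G) ≠ 0)
    {c : Fin r → ℂ} (hc : ∀ v, form ξ v = ∑ j, c j * dpoly (G (Sum.inl j)) x v)
    {u : Fin N → ℂ} (hu : u ∈ tangentSpace X x) (huω : ∀ j, form (initForms ω j) u = 0)
    (h : ∀ v ∈ tangentSpace X x, (∀ j, form (initForms ω j) v = 0) →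
      hess (lagrange G ξ c) x u v = 0) : u = 0 := by
  set q : Fin N ⊕ Fin N → ℂ := Sum.elim x ξ with hqdef
  -- Equality by dimension: the conormal space has pure dimension N, and the graph has at most that
  -- dimension.
  have hgraph : tangentSpace (conormal X (regularLocus X n)) q =
      graphOver (tangentSpace X x) (hess (lagrange G ξ c) x) := by
    refine Submodule.eq_of_le_of_finrank_le
      (tangentSpace_conormal_le hdim hG hq hdet hc) ?_
    refine (finrank_graphOver_le _ _).trans ?_
    rw [Fintype.card_fin]
    exact le_finrank_tangentSpace (isPureDim_conormal hX hdim) hq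
  -- The Hessian applied to `u` is a combination of the first forms on the tangent space; its
  -- negative is the covector part that makes `z` tangent to the conormal space while staying in the
  -- span.
  obtain ⟨b, hb⟩ := exists_eq_sum_forms h
  let z : Fin N ⊕ Fin N → ℂ := Sum.elim u (∑ j, (- b j) • initForms ω j)
  have hzT : z ∈ tangentSpace (conormal X (regularLocus X n)) q ⊓
      prodH (Submodule.span ℂ (Set.range ω)) := by
    refine ⟨?_, ?_⟩
    · rw [hgraph]
      refine mem_graphOver.2 ⟨hu, fun w hw => ?_⟩
      change form (∑ j, (- b j) • initForms ω j) w + hess (lagrange G ξ c) x u w = 0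
      rw [hb w hw, form_sum_smul, ← Finset.sum_add_distrib]
      exact Finset.sum_eq_zero fun j _ => by ring
    · change ∑ j, (- b j) • initForms ω j ∈ Submodule.span ℂ (Set.range ω)
      refine Submodule.sum_mem _ fun j _ => Submodule.smul_mem _ _ ?_
      exact Submodule.subset_span ⟨_, rfl⟩
  let L : (Fin N ⊕ Fin N → ℂ) →ₗ[ℂ] (Fin k → ℂ) :=
    LinearMap.pi fun j => (form (initForms ω j)).comp (LinearMap.funLeft ℂ ℂ Sum.inl)
  have hle := tangentSpace_inter_overH_le (conormal X (regularLocus X n))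
    (Submodule.span ℂ (Set.range ω)) q
  have hqW : q ∈ conormal X (regularLocus X n) ∩ overH (Submodule.span ℂ (Set.range ω)) :=
    ⟨hq, hξ, hξ0⟩
  -- Submersivity onto ℂ^k and the bound k + 1 make `z` a multiple of the Euler vector, whose base
  -- component is zero.
  obtain ⟨s, hs⟩ := exists_smul_eq_of_finrank_le (L := L) (z := z)
    (fun w => by
      obtain ⟨v, hv, hv'⟩ := hsub w
      exact ⟨v, hle hv, hv'⟩)
    (by
      rw [Fintype.card_fin]
      exact (finrank_inf_prodH_le hX hdim hq htrans).trans (finrank_span_forms hω).le)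
    (hle ((isConic_conormal_inter_overH _ _ _).euler_mem_tangentSpace hqW))
    (fun h0 => hξ0 (by
      ext i
      exact congrFun h0 (Sum.inr i)))
    (by
      ext j
      exact map_zero (form (initForms ω j))) hzT
    (by
      ext j
      exact huω j)
  ext i
  have := congrFun hs (Sum.inl i)
  simpa [z] using this.symm

theorem isMorsePoint_slice (hX : IsZariskiClosed X) (hdim : IsPureDim X n)
    (hω : LinearIndependent ℂ ω) {S : Set (Fin N → ℂ)} (hSX : S ⊆ X) {x : Fin N → ℂ}
    (hxS : x ∈ S) (hx : x ∈ critPoints (regularLocus X n ∩ slicePlane ω t) (ω (Fin.last k)))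
    (hT : tangentSpace X x ⊔ commonKer (Submodule.span ℂ (Set.range (initForms ω))) = ⊤)
    (htrans : ∀ q ∈ conormal X (regularLocus X n) ∩ overH (Submodule.span ℂ (Set.range ω)),
      tangentSpace (conormal X (regularLocus X n)) q ⊔
        prodH (Submodule.span ℂ (Set.range ω)) = ⊤)
    (hsub : ∀ q ∈ conormal X (regularLocus X n) ∩ overH (Submodule.span ℂ (Set.range ω)),
      q ∘ Sum.inl = x → ∀ w : Fin k → ℂ, ∃ v ∈ tangentSpace (conormal X (regularLocus X n) ∩
        overH (Submodule.span ℂ (Set.range ω))) q,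
          (fun j => form (initForms ω j) (v ∘ Sum.inl)) = w)
    {r : ℕ} {e : Fin r ⊕ Fin n ≃ Fin N} {G : Fin r ⊕ Fin n → MvPolynomial (Fin N) ℂ}
    (hG : ∀ j, G (Sum.inl j) ∈ vanishingIdeal ℂ X) (hdet : eval x (jacDet e G) ≠ 0)
    {d : MvPolynomial (Fin N) ℂ} (hd : eval x d ≠ 0)
    (hdS : ∀ y, eval y d ≠ 0 → (∀ j, eval y (G (Sum.inl j)) = 0) → y ∈ S) :
    IsMorsePoint (S ∩ slicePlane ω t) (fun y => form (ω (Fin.last k)) y) x := by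
  obtain ⟨b, hb⟩ := exists_reducedForm hX hdim hω hT hx
  set ξ := reducedForm ω b with hξdef
  have hTG := tangentSpace_eq_frameKer hdim hG hx.1.1.1 hdet
  have hq : (Sum.elim x ξ : Fin N ⊕ Fin N → ℂ) ∈ conormal X (regularLocus X n) :=
    ⟨hx.1.1, hb⟩
  have hξ : ξ ∈ Submodule.span ℂ (Set.range ω) := by
    rw [hξdef, reducedForm_eq]
    exact (Submodule.mem_span_range_iff_exists_fun ℂ).2 ⟨_, rfl⟩
  have hξ0 := reducedForm_ne_zero hω b
  have hqW : (Sum.elim x ξ : Fin N ⊕ Fin N → ℂ) ∈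
      conormal X (regularLocus X n) ∩ overH (Submodule.span ℂ (Set.range ω)) := ⟨hq, hξ, hξ0⟩
  obtain ⟨c, hc⟩ := exists_lagrange e hdet (ξ := ξ) (by rwa [← hTG])
  obtain ⟨d', φ, hφ, hφ0, hinj, hmap, hφT⟩ := exists_slice_param hdet
    (linearIndependent_initForms hω) (by rwa [← hTG]) hx.1.2 hxS
    (fun y hy j => mem_vanishingIdeal'.1 (hG j) y (hSX hy)) hd hdS
  -- On the slice the last form equals ξ + ∑ b_j t_j, and subtracting the equations of X changes
  -- nothing there. The resulting polynomial is critical at `x` in the whole space, so its Hessian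
  -- computes the second derivative.
  set p := lagrange G ξ c - C (-∑ j, b j * t j) with hp
  have hφS : ∀ᶠ u in 𝓝 0, φ u ∈ S ∩ slicePlane ω t := by
    change S ∩ slicePlane ω t ∈ Filter.map φ (𝓝 0)
    rw [hmap]
    exact self_mem_nhdsWithin
  have heq : ((fun y => form (ω (Fin.last k)) y) ∘ φ) =ᶠ[𝓝 0] fun u => eval (φ u) p := by
    filter_upwards [hφS] with u hu
    rw [hp, map_sub, eval_lagrange, eval_C, hξdef, form_reducedForm,
      Finset.sum_eq_zero (f := fun j => c j * eval (φ u) (G (Sum.inl j))) fun j _ => by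
        rw [mem_vanishingIdeal'.1 (hG j) _ (hSX hu.1), mul_zero]]
    simp only [show ∀ j, form (initForms ω j) (φ u) = t j from hu.2, Function.comp_apply]
    ring
  have hdp : dpoly p (φ 0) = 0 := by
    refine LinearMap.ext fun v => ?_
    rw [hφ0, hp, dpoly_sub, dpoly_C, sub_zero, dpoly_lagrange, ← hc, sub_self]
    rfl
  refine ⟨d', φ, hφ, hφ0, hinj, hmap, ?_, fun v hv => ?_⟩
  · rw [heq.fderiv_eq, (hasFDerivAt_eval_comp p hφ.differentiableAt).fderiv]
    ext1 v
    exact congrArg (fun L : (Fin N → ℂ) →ₗ[ℂ] ℂ => L (fderiv ℂ φ 0 v)) hdp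
  · have hmem := (hφT (fderiv ℂ φ 0 v)).2 ⟨v, rfl⟩
    have h0 : fderiv ℂ φ 0 v = 0 := by
      refine eq_zero_of_hess_eq_zero hX hdim hω hξ hξ0 hq (htrans _ hqW)
        (hsub _ hqW rfl) hG hdet hc (hTG ▸ hmem.1) hmem.2 fun w hw hw' => ?_
      rw [hTG] at hw
      obtain ⟨w, rfl⟩ := (hφT w).1 ⟨hw, hw'⟩
      have h1 := hv w
      rw [heq.fderiv.fderiv_eq, fderiv_fderiv_eval_comp hφ hdp, hp, hess_sub_C, hφ0] at h1
      exact h1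
    exact hinj (h0.trans (map_zero _).symm)

end Morse

/-! ### Complements of Zariski-open dense sets. -/

section OpenDense

variable {κ : Type} [Fintype κ]

theorem IsZariskiOpenDense.thin_compl {V : Set (κ → ℂ)} (hV : IsZariskiOpenDense V) :
    Thin Vᶜ := by
  obtain ⟨⟨I, hI⟩, hd⟩ := hV
  by_contra h
  have h1 : ∀ p ∈ I, p = 0 := by
    intro p hp
    by_contra hp0
    refine h ⟨p, hp0, fun b hb => ?_⟩
    rw [hI] at hb
    exact mem_zeroLocus'.1 hb p hp
  have h2 : V = ∅ := by
    rw [← Set.compl_univ_iff, hI, Set.eq_univ_iff_forall]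
    exact fun x => mem_zeroLocus'.2 fun p hp => by rw [h1 p hp, map_zero]
  have h3 : (0 : κ → ℂ) ∈ zariskiClosure V := by rw [hd]; trivial
  have h4 := mem_zeroLocus'.1 h3 1 (mem_vanishingIdeal'.2 fun y hy => by
    rw [h2] at hy; exact hy.elim)
  rw [map_one] at h4
  exact one_ne_zero h4

end OpenDense

end AffinePolar

/-! ### The main theorem. -/

open AffinePolar in
theorem corollary3p4 (N n k : ℕ) (hnN : n < N) (hkn : k ≤ n)
    (X : Set (Fin N → ℂ)) (hX : IsZariskiClosed X) (hdim : IsPureDim X n)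
    (strata : Set (Set (Fin N → ℂ))) (hS : IsWhitneyStratification X strata)
    (hatStrata : Set (Set (Fin (N + 1) → ℂ)))
    (hhat : IsProjectiveExtension X strata hatStrata) :
    (∃ Ω : Set (Submodule ℂ (Fin N → ℂ)), IsZariskiOpenDenseGr (k + 1) Ω ∧
      ∀ H ∈ Ω, PolarGeneric X n strata H) ∧
    (∃ Ω : Set (Submodule ℂ (Fin N → ℂ)), IsZariskiOpenDenseGr (k + 1) Ω ∧
      ∀ H ∈ Ω, TransGeneric hatStrata H) ∧
    ∀ ω : Fin (k + 1) → Fin N → ℂ, LinearIndependent ℂ ω →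
      PolarGeneric X n strata (Submodule.span ℂ (Set.range ω)) →
      TransGeneric hatStrata (Submodule.span ℂ (Set.range ω)) →
      (0 < k →
        PolarGeneric X n strata (Submodule.span ℂ (Set.range (initForms ω))) ∧
        TransGeneric hatStrata (Submodule.span ℂ (Set.range (initForms ω)))) →
      HasDegree (polarLocus X n ω) ω (polarDegree X n ω) ∧
      ∃ V : Set (Fin k → ℂ), IsZariskiOpenDense V ∧ ∀ t ∈ V,
        (∀ S ∈ strata, ∀ x ∈ S ∩ slicePlane ω t,
          tangentSpace S x ⊔ commonKer (Submodule.span ℂ (Set.range (initForms ω))) = ⊤) ∧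
        (critPoints (regularLocus X n ∩ slicePlane ω t) (ω (Fin.last k))).encard
          = polarDegree X n ω ∧
        ∀ x ∈ critPoints (regularLocus X n ∩ slicePlane ω t) (ω (Fin.last k)),
          IsStratifiedMorsePoint (sliceStrata strata (slicePlane ω t))
            (fun y => form (ω (Fin.last k)) y) x := by
  have hWS : ∀ S ∈ strata, S ⊆ X := fun S h => hS.sUnion_eq ▸ Set.subset_sUnion_of_mem h
  refine ⟨exists_isZariskiOpenDenseGr (by omega)
      (thin_not_polarGeneric hnN hX hdim hS.finite (k + 1)),
    exists_isZariskiOpenDenseGr (by omega) (thin_not_transGeneric hhat.whitney (k + 1)), ?_⟩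
  intro ω hω hgen _ _
  have hdeg : HasDegree (polarLocus X n ω) ω (polarDegree X n ω) :=
    Nat.sInf_mem (s := {d | HasDegree (polarLocus X n ω) ω d})
      (exists_polarLocus_fibre_card hX hdim hω hgen)
  refine ⟨hdeg, ?_⟩
  obtain ⟨V₀, hV₀, hcard⟩ := hdeg
  -- The bad parameters: a wrong number of points in the fibre, polar points outside the critical
  -- set, slices not transversal to X or to a stratum, critical points in small strata, and failure
  -- of the conormal cone over ω to be submersive onto ℂ^k.
  have hthin := ((((hV₀.thin_compl.union (thin_polarLocus_diff_crit hX hdim hω hgen)).union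
    (thin_not_transverse_slice X ω)).union
    (thin_biUnion hS.finite fun S _ => thin_not_transverse_slice S ω)).union
    (thin_biUnion (hS.finite.subset (Set.sep_subset strata fun S => algDim S < n))
      fun S h => thin_crit_inter_small hω hgen h.1 (hWS S h.1) h.2)).union
    (thin_not_submersive (conormal X (regularLocus X n) ∩
      overH (Submodule.span ℂ (Set.range ω))) ω)
  obtain ⟨V, hV, hVt⟩ := hthin.exists_open
  refine ⟨V, hV, fun t ht => ?_⟩
  have hbad := hVt t ht
  simp only [Set.mem_union, not_or, Set.mem_iUnion, not_exists] at hbad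
  obtain ⟨⟨⟨⟨⟨hb₀, hb₁⟩, hb₂⟩, hb₃⟩, hb₄⟩, hb₅⟩ := hbad
  have hTX : ∀ x ∈ X ∩ slicePlane ω t,
      tangentSpace X x ⊔ commonKer (Submodule.span ℂ (Set.range (initForms ω))) = ⊤ := by
    rintro x ⟨hx, hxt⟩
    by_contra h
    exact hb₂ ⟨x, ⟨hx, h⟩, mem_slicePlane_iff.1 hxt⟩
  have hcrit := critPoints_slice_eq hX hdim hω hTX
  refine ⟨?_, ?_, ?_⟩
  · rintro S hSs x ⟨hx, hxt⟩
    by_contra h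
    exact hb₃ S hSs ⟨x, ⟨hx, h⟩, mem_slicePlane_iff.1 hxt⟩
  · rw [hcrit, ← hcard t (Set.notMem_compl_iff.1 hb₀)]
    congr 1
    refine Set.Subset.antisymm
      (Set.inter_subset_inter_left _ (subset_zariskiClosure _)) fun x hx => ⟨?_, hx.2⟩
    by_contra h
    exact hb₁ ⟨x, ⟨hx.1, h⟩, mem_slicePlane_iff.1 hx.2⟩
  · intro x hx
    have hxc : x ∈ crit X n ω ∩ slicePlane ω t := hcrit ▸ hx
    obtain ⟨S, hSs, hxS⟩ := Set.mem_sUnion.1 (hS.sUnion_eq.symm ▸ hx.1.1.1 : x ∈ ⋃₀ strata)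
    -- The stratum of a critical point has full dimension, so near `x` it is defined by the frame
    -- equations of X.
    have hSn : ¬ algDim S < n := fun h =>
      hb₄ S ⟨hSs, h⟩ ⟨x, ⟨hxc.1, hxS⟩, mem_slicePlane_iff.1 hx.1.2⟩
    obtain ⟨m, hm⟩ := hS.smooth S hSs
    have hpure := isPureDim_of_not_algDim_lt hm (hWS S hSs) hxS hx.1.1 hSn
    obtain ⟨r, e, G, d₁, hG, h0, hd₁, hdet, -⟩ := exists_chart hX hdim hx.1.1
    obtain ⟨d, hd, hdS⟩ := exists_eval_ne_zero_of_mem_stratum hm.1 hpure hxS e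
      (fun j => MvPolynomial.vanishingIdeal_anti_mono (hWS S hSs) (hG j)) h0 (hdet x hd₁)
    refine ⟨S ∩ slicePlane ω t, ⟨S, hSs, rfl⟩, ⟨hxS, hx.1.2⟩, ?_, ?_⟩
    · refine isMorsePoint_slice hX hdim hω (hWS S hSs) hxS hx (hTX x ⟨hx.1.1.1, hx.1.2⟩)
        hgen.transverse ?_ hG (hdet x hd₁) hd hdS
      intro q hq hqx w
      by_contra! h
      exact hb₅ ⟨x, ⟨q, ⟨hq, w, h⟩, hqx⟩, mem_slicePlane_iff.1 hx.1.2⟩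
    · rintro _ ⟨S', hS', rfl⟩ hne y τ hy hyx -
      have hSS' : S' ≠ S := fun h => hne (by rw [h])
      -- Near `x` all points of X lie in `S`, so by disjointness no sequence in another stratum
      -- converges to `x` and the condition on limits is vacuous.
      have hev : ∀ᶠ i in atTop, MvPolynomial.eval (y i) d ≠ 0 :=
        (((MvPolynomial.continuous_eval d).tendsto x).comp hyx).eventually_ne hd
      obtain ⟨i, hi⟩ := hev.exists
      have hyS : y i ∈ S := hdS _ hi fun j =>
        mem_vanishingIdeal'.1 (hG j) _ (hWS S' hS' (hy i).1)
      exact (Set.disjoint_left.1 (hS.disjoint hS' hSs hSS') (hy i).1 hyS).elim
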